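/- Let $M$ be a smooth noncompact surface (Hausdorff, second countable, without boundary) and let $\omega$ be an area form on $M$ of infinite total area. A Riemannian metric $g$ on $M$ is called tame if it is smooth and complete, its injectivity radius is bounded below by a positive constant, and $\sup_M |\nabla^\ell R_g|_g < \infty$ for every $\ell \ge 0$, where $R_g$ is the curvature tensor. Let $\mathcal J_\omega$ be the set of smooth almost complex structures $J$ on $M$ that are tame to $\omega$, that is: $\omega(v,Jv)>0$ for all $v\neq 0$; the metric $g_J(v,w)=\frac12\big(\omega(v,Jw)+\omega(w,Jv)\big)$ (which on a surface equals $\omega(v,Jw)$) is tame; and $g_J$ is quasi-isometric to a tame metric $g$, i.e. $A^{-1}g(u,u)\le g_J(u,u)\le A\,g(u,u)$ for all tangent vectors $u$ and some constant $A\ge 1$ (this last condition follows from the previous one). Then $\mathcal J_\omega$ is not path-connected in the strong $C^\infty$ topology. This holds for both standard descriptions of that topology: (a) the strong (Whitney) $C^\infty$ topology, generated by the sets of those $J'\in\mathcal J_\omega$ such that, for every $i$ and every $k \le r$, the $k$-th derivatives of $J'$ and $J$ in the chart $e_i$ differ by less than $\varepsilon_i$ on $K_i$; here $J\in\mathcal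 J_\omega$, $(e_i)$ is a locally finite family of charts, $K_i$ is a compact subset of the domain of $e_i$, $\varepsilon_i>0$ and $r\in\mathbb N$; (b) the topology generated by the sets $\{J'\in\mathcal J_\omega : \sup_M|\nabla^k(g_{J'}-g_J)|_{g_J}<\delta_k \text{ for all } k\ge 0\}$, where $J\in\mathcal J_\omega$, $(\delta_k)$ is any sequence of positive numbers, and $\nabla$ is the Levi-Civita connection of $g_J$. (A path-connected space is nonempty by convention; so the claim says that, whenever $\mathcal J_\omega\neq\emptyset$, there are two elements of $\mathcal J_\omega$ that no continuous path in $\mathcal J_\omega$ joins.) -/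

import Mathlib

open Set Filter Topology MeasureTheory
open scoped Manifold ContDiff ENNReal

noncomputable section

/-! ## Tensor calculus in coordinates

Functions on `ℝⁿ` are only ever used on the (open) image of a coordinate chart. A covariant tensor
field of rank `m` is given in coordinates by its components `T y (a 0, …, a (m-1))`. -/

section Coordinates

variable {n : ℕ}

/-- The partial derivative `∂ᵢ f` at `y`. -/
def partialDeriv (i : Fin n) (f : EuclideanSpace ℝ (Fin n) → ℝ)
    (y : EuclideanSpace ℝ (Fin n)) : ℝ :=
  fderiv ℝ f y (EuclideanSpace.single i 1)

/-- The Christoffel symbols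
`Γᵏᵢⱼ = ½ ∑ₗ Gᵏˡ (∂ᵢ Gⱼₗ + ∂ⱼ Gᵢₗ - ∂ₗ Gᵢⱼ)` of the metric with coefficient matrix `G`. -/
def christoffel (G : EuclideanSpace ℝ (Fin n) → Matrix (Fin n) (Fin n) ℝ) (k i j : Fin n)
    (y : EuclideanSpace ℝ (Fin n)) : ℝ :=
  (1 / 2) * ∑ l, (G y)⁻¹ k l *
    (partialDeriv i (fun z => G z j l) y + partialDeriv j (fun z => G z i l) y
      - partialDeriv l (fun z => G z i j) y)

/-- The components `Rˡₖᵢⱼ` of the curvature tensor: `R(∂ᵢ, ∂ⱼ) ∂ₖ = ∑ₗ Rˡₖᵢⱼ ∂ₗ`. -/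
def curvatureCoeff (G : EuclideanSpace ℝ (Fin n) → Matrix (Fin n) (Fin n) ℝ) (l k i j : Fin n)
    (y : EuclideanSpace ℝ (Fin n)) : ℝ :=
  partialDeriv i (christoffel G l j k) y - partialDeriv j (christoffel G l i k) y
    + ∑ p, (christoffel G l i p y * christoffel G p j k y
      - christoffel G l j p y * christoffel G p i k y)

/-- The covariant curvature tensor, of rank four: the component with indices `(i, j, k, l)` is
`⟨R(∂ᵢ, ∂ⱼ) ∂ₖ, ∂ₗ⟩`. -/
def curvatureTensor (G : EuclideanSpace ℝ (Fin n) → Matrix (Fin n) (Fin n) ℝ)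
    (y : EuclideanSpace ℝ (Fin n)) (a : Fin 4 → Fin n) : ℝ :=
  ∑ p, G y p (a 3) * curvatureCoeff G p (a 2) (a 0) (a 1) y

/-- The Levi-Civita covariant derivative of a covariant tensor field of rank `m`; the direction of
differentiation is the first index of the result. -/
def covDeriv (G : EuclideanSpace ℝ (Fin n) → Matrix (Fin n) (Fin n) ℝ) {m : ℕ}
    (T : EuclideanSpace ℝ (Fin n) → (Fin m → Fin n) → ℝ)
    (y : EuclideanSpace ℝ (Fin n)) (a : Fin (m + 1) → Fin n) : ℝ :=
  partialDeriv (a 0) (fun z => T z (Fin.tail a)) y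
    - ∑ s : Fin m, ∑ k, christoffel G k (a 0) (Fin.tail a s) y *
        T y (Function.update (Fin.tail a) s k)

/-- The iterated covariant derivative `∇ᵏ T`. -/
def iterCovDeriv (G : EuclideanSpace ℝ (Fin n) → Matrix (Fin n) (Fin n) ℝ) {m : ℕ}
    (T : EuclideanSpace ℝ (Fin n) → (Fin m → Fin n) → ℝ) :
    (k : ℕ) → EuclideanSpace ℝ (Fin n) → (Fin (m + k) → Fin n) → ℝ
  | 0 => T
  | k + 1 => covDeriv G (iterCovDeriv G T k)

/-- The pointwise norm of a covariant tensor of rank `m` with respect to the inner product with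
matrix `A`: `|T|² = ∑ Aᵃ⁰ᵇ⁰ ⋯ T_{a₀…} T_{b₀…}`. -/
def tensorNorm (A : Matrix (Fin n) (Fin n) ℝ) {m : ℕ} (T : (Fin m → Fin n) → ℝ) : ℝ :=
  √(∑ a, ∑ b, (∏ s, A⁻¹ (a s) (b s)) * T a * T b)

end Coordinates

/-! ## Tensor fields on a manifold -/

section Manifolds

/-- A field of bilinear forms on the tangent spaces of `M`. -/
abbrev BilinField (n : ℕ) (M : Type*) [TopologicalSpace M]
    [ChartedSpace (EuclideanSpace ℝ (Fin n)) M] :=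
  ∀ x : M, TangentSpace (𝓡 n) x →L[ℝ] TangentSpace (𝓡 n) x →L[ℝ] ℝ

/-- A field of endomorphisms of the tangent spaces of `M`. -/
abbrev EndField (n : ℕ) (M : Type*) [TopologicalSpace M]
    [ChartedSpace (EuclideanSpace ℝ (Fin n)) M] :=
  ∀ x : M, TangentSpace (𝓡 n) x →L[ℝ] TangentSpace (𝓡 n) x

/-- The smooth coordinate charts of `M`. -/
abbrev smoothCharts (n : ℕ) (M : Type*) [TopologicalSpace M]
    [ChartedSpace (EuclideanSpace ℝ (Fin n)) M] :
    Set (OpenPartialHomeomorph M (EuclideanSpace ℝ (Fin n))) :=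
  IsManifold.maximalAtlas (𝓡 n) ∞ M

variable {n : ℕ} {M : Type*} [TopologicalSpace M] [ChartedSpace (EuclideanSpace ℝ (Fin n)) M]

/-- The isomorphism `ℝⁿ → T_x M` given by the chart `e` at the point `x` with coordinates `y`;
it maps the `i`-th basis vector to `∂ᵢ`. -/
def coordFrame (e : OpenPartialHomeomorph M (EuclideanSpace ℝ (Fin n)))
    (y : EuclideanSpace ℝ (Fin n)) :
    EuclideanSpace ℝ (Fin n) →L[ℝ] TangentSpace (𝓡 n) (e.symm y) :=
  mfderiv 𝓘(ℝ, EuclideanSpace ℝ (Fin n)) (𝓡 n) e.symm y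

/-- The inverse isomorphism `T_x M → ℝⁿ`, i.e. the differential of the chart. -/
def coordCoframe (e : OpenPartialHomeomorph M (EuclideanSpace ℝ (Fin n)))
    (y : EuclideanSpace ℝ (Fin n)) :
    TangentSpace (𝓡 n) (e.symm y) →L[ℝ] EuclideanSpace ℝ (Fin n) :=
  mfderiv (𝓡 n) 𝓘(ℝ, EuclideanSpace ℝ (Fin n)) e (e.symm y)

/-- The matrix of a field of bilinear forms in the chart `e`. -/
def coordMatrix (B : BilinField n M) (e : OpenPartialHomeomorph M (EuclideanSpace ℝ (Fin n)))
    (y : EuclideanSpace ℝ (Fin n)) : Matrix (Fin n) (Fin n) ℝ :=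
  Matrix.of fun i j => B (e.symm y) (coordFrame e y (EuclideanSpace.single i 1))
    (coordFrame e y (EuclideanSpace.single j 1))

/-- A field of endomorphisms in the chart `e`. -/
def coordEnd (J : EndField n M) (e : OpenPartialHomeomorph M (EuclideanSpace ℝ (Fin n)))
    (y : EuclideanSpace ℝ (Fin n)) :
    EuclideanSpace ℝ (Fin n) →L[ℝ] EuclideanSpace ℝ (Fin n) :=
  (coordCoframe e y).comp ((J (e.symm y)).comp (coordFrame e y))

/-- Smoothness of a field of bilinear forms: its coefficients in every chart are smooth. -/
def SmoothBilin (B : BilinField n M) : Prop :=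
  ∀ e ∈ smoothCharts n M, ∀ i j, ContDiffOn ℝ ∞ (fun y => coordMatrix B e y i j) e.target

/-- Smoothness of a field of endomorphisms: it is smooth in every chart. -/
def SmoothEnd (J : EndField n M) : Prop :=
  ∀ e ∈ smoothCharts n M, ContDiffOn ℝ ∞ (coordEnd J e) e.target

/-! ## Riemannian metrics -/

/-- Smooth Riemannian metrics. -/
structure IsSmoothMetric (g : BilinField n M) : Prop where
  smooth : SmoothBilin g
  symm : ∀ x v w, g x v w = g x w v
  pos : ∀ x v, v ≠ 0 → 0 < g x v v

/-- Two metrics are quasi-isometric if `A⁻¹ g₁(u,u) ≤ g₂(u,u) ≤ A g₁(u,u)` for a constant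
`A ≥ 1`. -/
def QuasiIsometric (g₁ g₂ : BilinField n M) : Prop :=
  ∃ A : ℝ, 1 ≤ A ∧ ∀ x u, A⁻¹ * g₁ x u u ≤ g₂ x u u ∧ g₂ x u u ≤ A * g₁ x u u

/-- The distance of `g`: the infimum of the `g`-lengths of `C¹` paths (infinite between points in
different components). -/
def metricEDist (g : BilinField n M) (x y : M) : ℝ≥0∞ :=
  letI : ∀ z : M, ENorm (TangentSpace (𝓡 n) z) := fun z => ⟨fun v => ENNReal.ofReal √(g z v v)⟩
  Manifold.riemannianEDist (𝓡 n) x y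

/-- `g` is complete: Cauchy sequences for the distance of `g` converge. -/
def IsCompleteMetric (g : BilinField n M) : Prop :=
  ∀ u : ℕ → M,
    (∀ ε : ℝ≥0∞, 0 < ε → ∃ N, ∀ p ≥ N, ∀ q ≥ N, metricEDist g (u p) (u q) < ε) →
    ∃ x, Tendsto (fun p => metricEDist g (u p) x) atTop (𝓝 0)

/-- `γ` is a geodesic of `g` on the open set `s ⊆ ℝ`: it is smooth there and solves the geodesic
equation `c̈ᵏ + ∑ Γᵏᵢⱼ(c) ċⁱ ċʲ = 0` in every chart. -/
def IsGeodesicOn (g : BilinField n M) (γ : ℝ → M) (s : Set ℝ) : Prop :=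
  ContMDiffOn 𝓘(ℝ, ℝ) (𝓡 n) ∞ γ s ∧
  ∀ e ∈ smoothCharts n M, ∀ t ∈ s, γ t ∈ e.source → ∀ k : Fin n,
    iteratedDeriv 2 (e ∘ γ) t k
      + ∑ i, ∑ j, christoffel (coordMatrix g e) k i j (e (γ t)) *
          deriv (e ∘ γ) t i * deriv (e ∘ γ) t j = 0

/-- The open ball of radius `r` about the origin of `T_x M`. -/
def tangentBall (g : BilinField n M) (x : M) (r : ℝ) : Set (TangentSpace (𝓡 n) x) :=
  {v | √(g x v v) < r}

/-- `E : T_x M → M` is, on the ball of radius `r`, the exponential map of `g` at `x`: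
`t ↦ E (t v)` is the geodesic with initial point `x` and initial velocity `v`. -/
def IsExpOn (g : BilinField n M) (x : M) (r : ℝ) (E : EuclideanSpace ℝ (Fin n) → M) : Prop :=
  E 0 = x ∧
  ∀ v ∈ tangentBall g x r,
    IsGeodesicOn g (fun t : ℝ => E (t • v)) {t : ℝ | t • v ∈ tangentBall g x r} ∧
    (mfderiv 𝓘(ℝ, ℝ) (𝓡 n) (fun t : ℝ => E (t • v)) 0 (1 : ℝ) : EuclideanSpace ℝ (Fin n)) = v

/-- The injectivity radius of `g` at `x`: the supremum of the `r > 0` such that the exponential map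
at `x` is defined on the ball of radius `r` and is a diffeomorphism from it onto its image. -/
def injRadius (g : BilinField n M) (x : M) : ℝ≥0∞ :=
  ⨆ (r : ℝ) (_ : 0 < r ∧ ∃ E : EuclideanSpace ℝ (Fin n) → M, IsExpOn g x r E ∧
      InjOn E (tangentBall g x r) ∧
      IsLocalDiffeomorphOn 𝓘(ℝ, EuclideanSpace ℝ (Fin n)) (𝓡 n) ∞ E (tangentBall g x r)),
    ENNReal.ofReal r

/-- Tame Riemannian metrics: complete, with injectivity radius bounded away from zero and with all
covariant derivatives of the curvature bounded. -/
structure IsTameMetric (g : BilinField n M) : Prop where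
  isMetric : IsSmoothMetric g
  complete : IsCompleteMetric g
  inj : 0 < ⨅ x, injRadius g x
  curv : ∀ l : ℕ, ∃ C : ℝ, ∀ e ∈ smoothCharts n M, ∀ y ∈ e.target,
    tensorNorm (coordMatrix g e y)
      (iterCovDeriv (coordMatrix g e) (curvatureTensor (coordMatrix g e)) l y) ≤ C

/-- The uniform norm `sup_x |∇ᵏ B|_g` of the `k`-th covariant derivative (with respect to the metric
`g`) of a field of bilinear forms. -/
def covDerivSup (g B : BilinField n M) (k : ℕ) : ℝ≥0∞ :=
  ⨆ e ∈ smoothCharts n M, ⨆ y ∈ e.target,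
    ENNReal.ofReal (tensorNorm (coordMatrix g e y)
      (iterCovDeriv (coordMatrix g e)
        (fun z (a : Fin 2 → Fin n) => coordMatrix B e z (a 0) (a 1)) k y))

end Manifolds

/-! ## Area forms and tame almost complex structures on surfaces -/

section Surfaces

variable {M : Type*} [TopologicalSpace M] [ChartedSpace (EuclideanSpace ℝ (Fin 2)) M]

/-- Area forms on a surface: smooth alternating nowhere vanishing `2`-forms. -/
structure IsAreaForm (Ω : BilinField 2 M) : Prop where
  smooth : SmoothBilin Ω
  alt : ∀ x v, Ω x v v = 0
  ne_zero : ∀ x, Ω x ≠ 0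

/-- The `Ω`-area `∫ |Ω(∂₁, ∂₂)| dy₁ dy₂` of a set contained in the domain of the chart `e`. -/
def areaInChart (Ω : BilinField 2 M)
    (e : OpenPartialHomeomorph M (EuclideanSpace ℝ (Fin 2))) (A : Set M) : ℝ≥0∞ :=
  ∫⁻ y in e.target ∩ e.symm ⁻¹' A, ENNReal.ofReal |coordMatrix Ω e y 0 1|

/-- The total `Ω`-area of the surface: the supremum, over all finite families of disjoint Borel sets
each contained in the domain of a chart, of the sums of their areas. -/
def totalArea (Ω : BilinField 2 M) : ℝ≥0∞ :=
  ⨆ (N : ℕ) (e : Fin N → OpenPartialHomeomorph M (EuclideanSpace ℝ (Fin 2)))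
    (A : Fin N → Set M)
    (_ : (∀ i, e i ∈ smoothCharts 2 M ∧ A i ⊆ (e i).source ∧ MeasurableSet[borel M] (A i)) ∧
      Pairwise fun i j => Disjoint (A i) (A j)),
    ∑ i, areaInChart Ω (e i) (A i)

/-- Smooth almost complex structures. -/
structure IsAlmostComplex (J : EndField 2 M) : Prop where
  smooth : SmoothEnd J
  sq : ∀ x v, J x (J x v) = -v

/-- The symmetric bilinear form `g_J(v, w) = ½ (Ω(v, J w) + Ω(w, J v))`. On a surface `Ω(·, J ·)` is
automatically symmetric, so this is just `Ω(·, J ·)`. -/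
def metricOf (Ω : BilinField 2 M) (J : EndField 2 M) : BilinField 2 M := fun x =>
  let B : EuclideanSpace ℝ (Fin 2) →L[ℝ] EuclideanSpace ℝ (Fin 2) →L[ℝ] ℝ := Ω x
  let j : EuclideanSpace ℝ (Fin 2) →L[ℝ] EuclideanSpace ℝ (Fin 2) := J x
  (1 / 2 : ℝ) • (B.flip.comp j + (B.flip.comp j).flip)

theorem metricOf_apply (Ω : BilinField 2 M) (J : EndField 2 M) (x : M)
    (v w : TangentSpace (𝓡 2) x) :
    metricOf Ω J x v w = (Ω x v (J x w) + Ω x w (J x v)) / 2 := by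
  have : metricOf Ω J x v w = (1 / 2 : ℝ) * (Ω x w (J x v) + Ω x v (J x w)) := rfl
  rw [this]; ring

/-- The space `𝓙_Ω` of almost complex structures tame to `Ω`: `Ω(v, J v) > 0` for `v ≠ 0`, the metric
`g_J` is tame, and `J` is uniformly continuous, which means that `g_J` is quasi-isometric to a tame
metric (this last condition follows from the previous one). -/
def tameACS (Ω : BilinField 2 M) : Set (EndField 2 M) :=
  {J | IsAlmostComplex J ∧ (∀ x v, v ≠ 0 → 0 < Ω x v (J x v)) ∧ IsTameMetric (metricOf Ω J) ∧
    ∃ g, IsTameMetric g ∧ QuasiIsometric g (metricOf Ω J)}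

/-- A basic neighbourhood of `J` for the strong (Whitney) `C^∞` topology, given by a locally finite
family of charts `e i`, compact subsets `K i` of their domains, numbers `ε i > 0` and an order `r`:
in the chart `e i`, the derivatives of order at most `r` are `ε i`-close on `K i`. -/
def strongNhd (Ω : BilinField 2 M) {ι : Type}
    (e : ι → OpenPartialHomeomorph M (EuclideanSpace ℝ (Fin 2))) (K : ι → Set M) (ε : ι → ℝ)
    (r : ℕ) (J : tameACS Ω) : Set (tameACS Ω) :=
  {J' | ∀ i, ∀ y ∈ e i '' K i, ∀ k ≤ r,
    ‖iteratedFDeriv ℝ k (coordEnd J'.1 (e i)) y - iteratedFDeriv ℝ k (coordEnd J.1 (e i)) y‖ < ε i}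

/-- The strong (Whitney) `C^∞` topology on `𝓙_Ω`. -/
abbrev strongTopology (Ω : BilinField 2 M) : TopologicalSpace (tameACS Ω) :=
  TopologicalSpace.generateFrom
    {U | ∃ (ι : Type) (e : ι → OpenPartialHomeomorph M (EuclideanSpace ℝ (Fin 2)))
        (K : ι → Set M) (ε : ι → ℝ) (r : ℕ) (J : tameACS Ω),
      (∀ i, e i ∈ smoothCharts 2 M ∧ IsCompact (K i) ∧ K i ⊆ (e i).source ∧ 0 < ε i) ∧
      (LocallyFinite fun i => (e i).source) ∧
      U = strongNhd Ω e K ε r J}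

/-- The uniform version of the strong `C^∞` topology on `𝓙_Ω`, generated by the sets
`{J' | sup_M |∇ᵏ (g_{J'} - g_J)| < δ k for all k}`, for `J` in `𝓙_Ω` and sequences `δ k > 0`, where
the covariant derivative and the norm are those of `g_J`. -/
abbrev uniformTopology (Ω : BilinField 2 M) : TopologicalSpace (tameACS Ω) :=
  TopologicalSpace.generateFrom
    {U | ∃ (J : tameACS Ω) (δ : ℕ → ℝ), (∀ k, 0 < δ k) ∧
      U = {J' : tameACS Ω | ∀ k, covDerivSup (metricOf Ω J.1)
        (metricOf Ω J'.1 - metricOf Ω J.1) k < ENNReal.ofReal (δ k)}}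

end Surfaces

end

/-! ## Smoothness of the coordinate expressions -/

section Coordinates

variable {n : ℕ}

theorem contDiffOn_partialDeriv {U : Set (EuclideanSpace ℝ (Fin n))} (hU : IsOpen U)
    {f : EuclideanSpace ℝ (Fin n) → ℝ} (hf : ContDiffOn ℝ ∞ f U) (i : Fin n) :
    ContDiffOn ℝ ∞ (partialDeriv i f) U := by
  have h : ContDiffOn ℝ ∞ (fderiv ℝ f) U := hf.fderiv_of_isOpen hU (by simp)
  exact h.clm_apply contDiffOn_const

theorem contDiffOn_det {U : Set (EuclideanSpace ℝ (Fin n))}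
    {A : EuclideanSpace ℝ (Fin n) → Matrix (Fin n) (Fin n) ℝ}
    (hA : ∀ i j, ContDiffOn ℝ ∞ (fun y => A y i j) U) :
    ContDiffOn ℝ ∞ (fun y => (A y).det) U := by
  simp only [Matrix.det_apply']
  exact ContDiffOn.sum fun σ _ => contDiffOn_const.mul (contDiffOn_prod fun i _ => hA _ _)

/-- Cramer's rule: the entries of the adjugate are determinants of matrices with one row replaced.
-/
theorem contDiffOn_matrix_inv {U : Set (EuclideanSpace ℝ (Fin n))}
    {A : EuclideanSpace ℝ (Fin n) → Matrix (Fin n) (Fin n) ℝ}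
    (hA : ∀ i j, ContDiffOn ℝ ∞ (fun y => A y i j) U) (h0 : ∀ y ∈ U, (A y).det ≠ 0) (i j : Fin n) :
    ContDiffOn ℝ ∞ (fun y => (A y)⁻¹ i j) U := by
  simp only [Matrix.inv_def, Ring.inverse_eq_inv, Matrix.smul_apply, smul_eq_mul,
    Matrix.adjugate_apply]
  refine ((contDiffOn_det hA).inv h0).mul (contDiffOn_det fun k l => ?_)
  by_cases hk : k = j
  · subst hk
    simpa using contDiffOn_const
  · simpa [Matrix.updateRow_ne hk] using hA k l

theorem contDiffOn_christoffel {U : Set (EuclideanSpace ℝ (Fin n))} (hU : IsOpen U)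
    {G : EuclideanSpace ℝ (Fin n) → Matrix (Fin n) (Fin n) ℝ}
    (hG : ∀ i j, ContDiffOn ℝ ∞ (fun y => G y i j) U) (h0 : ∀ y ∈ U, (G y).det ≠ 0)
    (k i j : Fin n) : ContDiffOn ℝ ∞ (christoffel G k i j) U := by
  unfold christoffel
  exact contDiffOn_const.mul (ContDiffOn.sum fun l _ => (contDiffOn_matrix_inv hG h0 k l).mul
    (((contDiffOn_partialDeriv hU (hG j l) i).add (contDiffOn_partialDeriv hU (hG i l) j)).sub
      (contDiffOn_partialDeriv hU (hG i j) l)))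

theorem contDiffOn_covDeriv {U : Set (EuclideanSpace ℝ (Fin n))} (hU : IsOpen U)
    {G : EuclideanSpace ℝ (Fin n) → Matrix (Fin n) (Fin n) ℝ}
    (hG : ∀ i j, ContDiffOn ℝ ∞ (fun y => G y i j) U) (h0 : ∀ y ∈ U, (G y).det ≠ 0) {m : ℕ}
    {T : EuclideanSpace ℝ (Fin n) → (Fin m → Fin n) → ℝ}
    (hT : ∀ a, ContDiffOn ℝ ∞ (fun y => T y a) U) (a : Fin (m + 1) → Fin n) :
    ContDiffOn ℝ ∞ (fun y => covDeriv G T y a) U := by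
  unfold covDeriv
  exact (contDiffOn_partialDeriv hU (hT _) _).sub (ContDiffOn.sum fun s _ =>
    ContDiffOn.sum fun k _ => (contDiffOn_christoffel hU hG h0 _ _ _).mul (hT _))

theorem contDiffOn_iterCovDeriv {U : Set (EuclideanSpace ℝ (Fin n))} (hU : IsOpen U)
    {G : EuclideanSpace ℝ (Fin n) → Matrix (Fin n) (Fin n) ℝ}
    (hG : ∀ i j, ContDiffOn ℝ ∞ (fun y => G y i j) U) (h0 : ∀ y ∈ U, (G y).det ≠ 0) {m : ℕ}
    {T : EuclideanSpace ℝ (Fin n) → (Fin m → Fin n) → ℝ}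
    (hT : ∀ a, ContDiffOn ℝ ∞ (fun y => T y a) U) (k : ℕ) :
    ∀ a : Fin (m + k) → Fin n, ContDiffOn ℝ ∞ (fun y => iterCovDeriv G T k y a) U := by
  induction k with
  | zero => exact hT
  | succ k ih => exact fun a => contDiffOn_covDeriv hU hG h0 ih a

/-! ## The Levi-Civita connection -/

theorem partialDeriv_congr {f f' : EuclideanSpace ℝ (Fin n) → ℝ} {y : EuclideanSpace ℝ (Fin n)}
    (h : f =ᶠ[𝓝 y] f') (i : Fin n) : partialDeriv i f y = partialDeriv i f' y := by
  rw [partialDeriv, partialDeriv, h.fderiv_eq]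

theorem partialDeriv_symm_of_eventually {G : EuclideanSpace ℝ (Fin n) → Matrix (Fin n) (Fin n) ℝ}
    {y : EuclideanSpace ℝ (Fin n)} (hs : ∀ᶠ z in 𝓝 y, (G z).IsSymm) (i j l : Fin n) :
    partialDeriv i (fun z => G z j l) y = partialDeriv i (fun z => G z l j) y :=
  partialDeriv_congr (hs.mono fun _ hz => hz.apply l j) i

theorem christoffel_symm {G : EuclideanSpace ℝ (Fin n) → Matrix (Fin n) (Fin n) ℝ}
    {y : EuclideanSpace ℝ (Fin n)} (hs : ∀ᶠ z in 𝓝 y, (G z).IsSymm) (k i j : Fin n) :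
    christoffel G k i j y = christoffel G k j i y := by
  unfold christoffel
  congr 1
  refine Finset.sum_congr rfl fun l _ => ?_
  rw [partialDeriv_symm_of_eventually hs l i j]
  ring

/-- Multiplying by `G y` cancels the inverse matrix in the definition. This is the Koszul formula,
the form in which compatibility and uniqueness are proved. -/
theorem sum_mul_christoffel {G : EuclideanSpace ℝ (Fin n) → Matrix (Fin n) (Fin n) ℝ}
    {y : EuclideanSpace ℝ (Fin n)} (h0 : (G y).det ≠ 0) (p i j : Fin n) :
    ∑ k, G y p k * christoffel G k i j y =
      (1 / 2) * (partialDeriv i (fun z => G z j p) y + partialDeriv j (fun z => G z i p) y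
        - partialDeriv p (fun z => G z i j) y) := by
  set w : Fin n → ℝ := fun l => partialDeriv i (fun z => G z j l) y
    + partialDeriv j (fun z => G z i l) y - partialDeriv l (fun z => G z i j) y with hw
  have h1 : ∀ k, christoffel G k i j y = (1 / 2) * ((G y)⁻¹.mulVec w) k := fun k => rfl
  have h2 : (G y).mulVec ((G y)⁻¹.mulVec w) = w := by
    rw [Matrix.mulVec_mulVec, Matrix.mul_nonsing_inv _ (isUnit_iff_ne_zero.2 h0), Matrix.one_mulVec]
  have h3 := congrFun h2 p
  simp only [h1]
  change _ = 1 / 2 * w p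
  rw [← h3]
  simp only [Matrix.mulVec, dotProduct, Finset.mul_sum]
  exact Finset.sum_congr rfl fun k _ => Finset.sum_congr rfl fun l _ => by ring

/-- The Levi-Civita connection is compatible with the metric. -/
theorem partialDeriv_metric {G : EuclideanSpace ℝ (Fin n) → Matrix (Fin n) (Fin n) ℝ}
    {y : EuclideanSpace ℝ (Fin n)} (hs : ∀ᶠ z in 𝓝 y, (G z).IsSymm) (h0 : (G y).det ≠ 0)
    (i j l : Fin n) :
    partialDeriv i (fun z => G z j l) y =
      ∑ k, christoffel G k i j y * G y k l + ∑ k, christoffel G k i l y * G y j k := by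
  have e1 : ∑ k, christoffel G k i j y * G y k l = ∑ k, G y l k * christoffel G k i j y :=
    Finset.sum_congr rfl fun k _ => by rw [hs.self_of_nhds.apply l k, mul_comm]
  have e2 : ∑ k, christoffel G k i l y * G y j k = ∑ k, G y j k * christoffel G k i l y :=
    Finset.sum_congr rfl fun k _ => mul_comm _ _
  rw [e1, e2, sum_mul_christoffel h0, sum_mul_christoffel h0,
    partialDeriv_symm_of_eventually hs i l j, partialDeriv_symm_of_eventually hs j i l,
    partialDeriv_symm_of_eventually hs l i j]
  ring

theorem partialDeriv_eq_of_covDeriv_eq_zero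
    {G H : EuclideanSpace ℝ (Fin n) → Matrix (Fin n) (Fin n) ℝ} {y : EuclideanSpace ℝ (Fin n)}
    (h : ∀ a : Fin 3 → Fin n, covDeriv G (fun z (a : Fin 2 → Fin n) => H z (a 0) (a 1)) y a = 0)
    (i j l : Fin n) :
    partialDeriv i (fun z => H z j l) y =
      ∑ k, christoffel G k i j y * H y k l + ∑ k, christoffel G k i l y * H y j k := by
  have := h ![i, j, l]
  simp only [covDeriv, Fin.sum_univ_two, sub_eq_zero] at this
  simpa [Fin.tail, Function.update] using this

/-- The Levi-Civita connection is the only symmetric connection compatible with the metric. -/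
theorem christoffel_eq_of_compatible {G H : EuclideanSpace ℝ (Fin n) → Matrix (Fin n) (Fin n) ℝ}
    {y : EuclideanSpace ℝ (Fin n)} (hs : ∀ᶠ z in 𝓝 y, (G z).IsSymm)
    (hs' : ∀ᶠ z in 𝓝 y, (H z).IsSymm) (h0 : (H y).det ≠ 0)
    (h : ∀ i j l, partialDeriv i (fun z => H z j l) y =
      ∑ k, christoffel G k i j y * H y k l + ∑ k, christoffel G k i l y * H y j k)
    (k i j : Fin n) : christoffel H k i j y = christoffel G k i j y := by
  -- The Koszul formula for `H` has three derivatives of `H`; compatibility turns them into six sums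
  -- with the symbols of `G`, of which four cancel in pairs by symmetry in the lower indices.
  have key : (H y).mulVec (fun k => christoffel H k i j y) =
      (H y).mulVec (fun k => christoffel G k i j y) := by
    funext p
    change ∑ k, H y p k * christoffel H k i j y = ∑ k, H y p k * christoffel G k i j y
    rw [sum_mul_christoffel h0, h, h, h]
    have c1 : ∀ k i j, H y k j * christoffel G k i p y = H y j k * christoffel G k i p y :=
      fun k i j => by rw [hs'.self_of_nhds.apply j k]
    have e1 : ∀ a b c : Fin n, ∑ k, christoffel G k a b y * H y k c =
        ∑ k, H y c k * christoffel G k a b y :=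
      fun a b c => Finset.sum_congr rfl fun k _ => by rw [hs'.self_of_nhds.apply c k, mul_comm]
    have e2 : ∀ a b c : Fin n, ∑ k, christoffel G k a b y * H y c k =
        ∑ k, H y c k * christoffel G k a b y :=
      fun a b c => Finset.sum_congr rfl fun k _ => mul_comm _ _
    have e3 : ∀ a b c : Fin n, ∑ k, H y c k * christoffel G k a b y =
        ∑ k, H y c k * christoffel G k b a y :=
      fun a b c => Finset.sum_congr rfl fun k _ => by rw [christoffel_symm hs]
    simp only [e1, e2]
    rw [e3 p i j, e3 p j i, e3 j i p]
    ring
  have := congrArg ((H y)⁻¹.mulVec) key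
  rw [Matrix.mulVec_mulVec, Matrix.mulVec_mulVec,
    Matrix.nonsing_inv_mul _ (isUnit_iff_ne_zero.2 h0), Matrix.one_mulVec, Matrix.one_mulVec] at this
  exact congrFun this k

theorem fderiv_eq_sum_partialDeriv (f : EuclideanSpace ℝ (Fin n) → ℝ)
    (y v : EuclideanSpace ℝ (Fin n)) : fderiv ℝ f y v = ∑ i, v i * partialDeriv i f y := by
  conv_lhs => rw [← (EuclideanSpace.basisFun (Fin n) ℝ).sum_repr v]
  simp [partialDeriv]

/-- A tensor field of rank two that is parallel on a convex open set and vanishes at one point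
vanishes identically. -/
theorem parallel_eq_zero_of_eq_zero {U : Set (EuclideanSpace ℝ (Fin n))} (hU : IsOpen U)
    (hc : Convex ℝ U) {Γ : Fin n → Fin n → Fin n → EuclideanSpace ℝ (Fin n) → ℝ}
    (hΓ : ∀ k i j, ContinuousOn (Γ k i j) U)
    {H : EuclideanSpace ℝ (Fin n) → Matrix (Fin n) (Fin n) ℝ}
    (hH : ∀ i j, DifferentiableOn ℝ (fun y => H y i j) U)
    (h : ∀ y ∈ U, ∀ i j l, partialDeriv i (fun z => H z j l) y =
      ∑ k, Γ k i j y * H y k l + ∑ k, Γ k i l y * H y j k)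
    {y₀ y₁ : EuclideanSpace ℝ (Fin n)} (hy₀ : y₀ ∈ U) (hy₁ : y₁ ∈ U) (h0 : H y₀ = 0) :
    H y₁ = 0 := by
  set c : ℝ → EuclideanSpace ℝ (Fin n) := fun t => y₀ + t • (y₁ - y₀) with hcdef
  set d := y₁ - y₀ with hd
  have hcU : ∀ t ∈ Icc (0 : ℝ) 1, c t ∈ U := fun t ht => hc.add_smul_sub_mem hy₀ hy₁ ht
  have hcc : Continuous c := by fun_prop
  have hcd : ∀ t, HasDerivAt c d t := fun t => by
    simpa [hcdef] using ((hasDerivAt_id t).smul_const d).const_add y₀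
  obtain ⟨B, hB⟩ := (isCompact_Icc (a := (0 : ℝ)) (b := 1)).exists_bound_of_continuousOn
    (f := fun t k i j => Γ k i j (c t)) (by
      refine continuousOn_pi.2 fun k => continuousOn_pi.2 fun i => continuousOn_pi.2 fun j => ?_
      exact (hΓ k i j).comp hcc.continuousOn hcU)
  have hB' : ∀ t ∈ Icc (0 : ℝ) 1, ∀ k i j, |Γ k i j (c t)| ≤ B := fun t ht k i j =>
    ((norm_le_pi_norm (fun j => Γ k i j (c t)) j).trans
      ((norm_le_pi_norm (fun i j => Γ k i j (c t)) i).trans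
      (norm_le_pi_norm (fun k i j => Γ k i j (c t)) k))).trans (hB t ht)
  set f : ℝ → Fin n → Fin n → ℝ := fun t i j => H (c t) i j with hf
  set f' : ℝ → Fin n → Fin n → ℝ := fun t j l =>
    ∑ i, d i * (∑ k, Γ k i j (c t) * H (c t) k l + ∑ k, Γ k i l (c t) * H (c t) j k) with hf'
  have hder : ∀ t ∈ Icc (0 : ℝ) 1, HasDerivAt f (f' t) t := by
    intro t ht
    refine hasDerivAt_pi.2 fun j => hasDerivAt_pi.2 fun l => ?_
    have h1 : HasFDerivAt (fun y => H y j l) (fderiv ℝ (fun y => H y j l) (c t)) (c t) :=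
      ((hH j l).differentiableAt (hU.mem_nhds (hcU t ht))).hasFDerivAt
    have h2 := h1.comp_hasDerivAt t (hcd t)
    rw [fderiv_eq_sum_partialDeriv] at h2
    simp only [h _ (hcU t ht)] at h2
    exact h2
  have hfn : ∀ t i j, |H (c t) i j| ≤ ‖f t‖ := fun t i j =>
    (norm_le_pi_norm (f t i) j).trans (norm_le_pi_norm (f t) i)
  -- On the segment the components of `H` solve a linear system of ordinary differential equations
  -- with bounded coefficients, so Grönwall's inequality applies with zero initial value.
  have hz := eq_zero_of_abs_deriv_le_mul_abs_self_of_eq_zero_right (f := f) (f' := f')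
    (K := ∑ i, |d i| * (∑ _k : Fin n, B + ∑ _k : Fin n, B)) (a := 0) (b := 1)
    (fun t ht => (hder t ht).continuousAt.continuousWithinAt)
    (fun t ht => (hder t ⟨ht.1, ht.2.le⟩).hasDerivWithinAt)
    (by funext i j; simp [hf, hcdef, h0]) (by
      intro t ht
      have hB0 : ∀ k i j, |Γ k i j (c t)| ≤ B := hB' t ⟨ht.1, ht.2.le⟩
      have hsum : ∀ (i j : Fin n) (g : Fin n → ℝ), (∀ k, |g k| ≤ ‖f t‖) →
          |∑ k, Γ k i j (c t) * g k| ≤ (∑ _k : Fin n, B) * ‖f t‖ := by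
        intro i j g hg
        rw [Finset.sum_mul]
        refine (Finset.abs_sum_le_sum_abs _ _).trans (Finset.sum_le_sum fun k _ => ?_)
        rw [abs_mul]
        exact mul_le_mul (hB0 k i j) (hg k) (abs_nonneg _) ((abs_nonneg _).trans (hB0 k i j))
      have hK : 0 ≤ (∑ i, |d i| * (∑ _k : Fin n, B + ∑ _k : Fin n, B)) * ‖f t‖ := by
        refine mul_nonneg (Finset.sum_nonneg fun i _ => mul_nonneg (abs_nonneg _) ?_)
          (norm_nonneg _)
        have : 0 ≤ B := (abs_nonneg _).trans (hB0 i i i)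
        positivity
      refine (pi_norm_le_iff_of_nonneg hK).2 fun j => (pi_norm_le_iff_of_nonneg hK).2 fun l => ?_
      rw [Finset.sum_mul, Real.norm_eq_abs]
      refine (Finset.abs_sum_le_sum_abs _ _).trans (Finset.sum_le_sum fun i _ => ?_)
      rw [abs_mul, mul_assoc, add_mul]
      gcongr
      exact (abs_add_le _ _).trans (add_le_add (hsum i j _ fun k => hfn t k l)
        (hsum i l _ fun k => hfn t j k)))
  have h1 := hz 1 (by simp)
  ext i j
  have := congrFun (congrFun h1 i) j
  simpa [hf, hcdef, hd] using this

/-! ## Contractions of tensors with vectors -/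

/-- The value `T(u₀, …, u_{m-1})` of a tensor with components `T` on vectors. -/
noncomputable def contract {m : ℕ} (T : (Fin m → Fin n) → ℝ) (u : Fin m → EuclideanSpace ℝ (Fin n)) : ℝ :=
  ∑ a, T a * ∏ s, u s (a s)

theorem contract_single {m : ℕ} (T : (Fin m → Fin n) → ℝ) (b : Fin m → Fin n) :
    contract T (fun s => EuclideanSpace.single (b s) 1) = T b := by
  unfold contract
  rw [Finset.sum_eq_single b]
  · simp
  · intro a _ hab
    obtain ⟨s, hs⟩ := Function.ne_iff.1 hab
    rw [Finset.prod_eq_zero (Finset.mem_univ s), mul_zero]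
    simp [hs]
  · simp

/-- The vector `-Γ(v, w)`, the derivative of a parallel field `w` along a curve of velocity `v`. -/
noncomputable def parallelDeriv (G : EuclideanSpace ℝ (Fin n) → Matrix (Fin n) (Fin n) ℝ)
    (y v w : EuclideanSpace ℝ (Fin n)) : EuclideanSpace ℝ (Fin n) :=
  WithLp.toLp 2 fun k => -∑ i, ∑ j, christoffel G k i j y * v i * w j

/-- Exchanging the `s`-th entry of the multi-index with the extra index is an involution on pairs.
It carries a Christoffel symbol from a slot of the tensor to the vector in that slot. -/
theorem sum_update_comm {m : ℕ} (s : Fin m) (F : (Fin m → Fin n) → Fin n → ℝ) :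
    ∑ a : Fin m → Fin n, ∑ k, F a k = ∑ a, ∑ k, F (Function.update a s k) (a s) := by
  rw [← Fintype.sum_prod_type', ← Fintype.sum_prod_type']
  refine Fintype.sum_bijective (fun p => (Function.update p.1 s p.2, p.1 s))
    (Function.Involutive.bijective fun p => by simp) _ _ fun p => by simp

theorem sum_fin_cons {m : ℕ} (F : (Fin (m + 1) → Fin n) → ℝ) :
    ∑ a, F a = ∑ b : Fin m → Fin n, ∑ i, F (Fin.cons i b : Fin (m + 1) → Fin n) := by
  rw [← (Fin.consEquiv fun _ : Fin (m + 1) => Fin n).sum_comp, Fintype.sum_prod_type_right]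
  rfl

/-- The derivative of `T(u₀, …, u_{m-1})` along a curve with velocity `v`, for parallel fields
`u₀, …, u_{m-1}`, is `(∇T)(v, u₀, …, u_{m-1})`. -/
theorem hasDerivAt_contract {G : EuclideanSpace ℝ (Fin n) → Matrix (Fin n) (Fin n) ℝ} {m : ℕ}
    {T : EuclideanSpace ℝ (Fin n) → (Fin m → Fin n) → ℝ} {c : ℝ → EuclideanSpace ℝ (Fin n)}
    {v : EuclideanSpace ℝ (Fin n)} {t : ℝ} (hc : HasDerivAt c v t)
    (hT : ∀ a, DifferentiableAt ℝ (fun y => T y a) (c t))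
    {u : ℝ → Fin m → EuclideanSpace ℝ (Fin n)}
    (hu : ∀ s, HasDerivAt (fun r => u r s) (parallelDeriv G (c t) v (u t s)) t) :
    HasDerivAt (fun r => contract (T (c r)) (u r))
      (contract (covDeriv G T (c t)) (Fin.cons v (u t))) t := by
  have hTd : ∀ a, HasDerivAt (fun r => T (c r) a)
      (∑ i, v i * partialDeriv i (fun y => T y a) (c t)) t := fun a => by
    rw [← fderiv_eq_sum_partialDeriv]
    exact (hT a).hasFDerivAt.comp_hasDerivAt t hc
  have hud : ∀ s k, HasDerivAt (fun r => u r s k) (parallelDeriv G (c t) v (u t s) k) t :=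
    fun s k => ((EuclideanSpace.proj (𝕜 := ℝ) k).hasFDerivAt.comp_hasDerivAt t (hu s) :)
  have hP : ∀ a : Fin m → Fin n, HasDerivAt (fun r => ∏ s, u r s (a s))
      (∑ s, (∏ s' ∈ Finset.univ.erase s, u t s' (a s')) *
        parallelDeriv G (c t) v (u t s) (a s)) t := fun a => by
    simpa using HasDerivAt.fun_finsetProd (u := Finset.univ) fun s _ => hud s (a s)
  have hsum := HasDerivAt.fun_sum (u := Finset.univ) fun a _ => (hTd a).mul (hP a)
  refine hsum.congr_deriv ?_
  simp only [contract]
  rw [sum_fin_cons]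
  simp only [Fin.prod_univ_succ, Fin.cons_zero, Fin.cons_succ, covDeriv,
    Fin.tail_cons, Finset.sum_add_distrib, sub_mul, Finset.sum_sub_distrib, Finset.sum_mul]
  rw [sub_eq_add_neg]
  congr 1
  · refine Finset.sum_congr rfl fun a _ => Finset.sum_congr rfl fun i _ => by ring
  · simp only [Finset.mul_sum]
    rw [Finset.sum_comm]
    conv_rhs => 
      enter [1, 2, a]
      rw [Finset.sum_comm]
    conv_rhs => rw [Finset.sum_comm]
    rw [← Finset.sum_neg_distrib]
    -- The match is slot by slot: the derivative of the `s`-th parallel field is the Christoffel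
    -- term of ∇T for slot `s`, after exchanging the summation indices.
    refine Finset.sum_congr rfl fun s _ => ?_
    have hprod : ∀ a : Fin m → Fin n, ∏ s', u t s' (a s') =
        u t s (a s) * ∏ s' ∈ Finset.univ.erase s, u t s' (a s') := fun a =>
      (Finset.mul_prod_erase _ _ (Finset.mem_univ s)).symm
    have hrhs : ∑ a : Fin m → Fin n, ∑ i, ∑ k, christoffel G k i (a s) (c t) *
          T (c t) (Function.update a s k) * (v i * ∏ s', u t s' (a s')) =
        ∑ a : Fin m → Fin n, ∑ k, ∑ i, christoffel G k i (a s) (c t) *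
          T (c t) (Function.update a s k) * (v i * ∏ s', u t s' (a s')) :=
      Finset.sum_congr rfl fun a _ => Finset.sum_comm
    rw [hrhs, sum_update_comm s, ← Finset.sum_neg_distrib]
    refine Finset.sum_congr rfl fun a _ => ?_
    simp only [parallelDeriv, Function.update_idem, Function.update_self, Function.update_eq_self]
    rw [mul_neg, mul_neg, Finset.mul_sum, Finset.mul_sum, Finset.sum_comm, neg_inj]
    refine Finset.sum_congr rfl fun k _ => ?_
    rw [Finset.mul_sum, Finset.mul_sum]
    refine Finset.sum_congr rfl fun i _ => ?_
    rw [hprod, Function.update_self]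
    have : ∏ s' ∈ Finset.univ.erase s, u t s' (Function.update a s i s') =
        ∏ s' ∈ Finset.univ.erase s, u t s' (a s') :=
      Finset.prod_congr rfl fun s' hs' => by
        rw [Function.update_of_ne (Finset.ne_of_mem_erase hs')]
    rw [this]
    ring

/-! ## Bilinear forms given by matrices -/

/-- The bilinear form with matrix `A`. -/
noncomputable def matrixForm (A : Matrix (Fin n) (Fin n) ℝ) (x y : EuclideanSpace ℝ (Fin n)) : ℝ :=
  ∑ i, ∑ j, A i j * x i * y j

theorem matrixForm_comm {A : Matrix (Fin n) (Fin n) ℝ} (hA : A.IsSymm)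
    (x y : EuclideanSpace ℝ (Fin n)) : matrixForm A x y = matrixForm A y x := by
  unfold matrixForm
  rw [Finset.sum_comm]
  refine Finset.sum_congr rfl fun i _ => Finset.sum_congr rfl fun j _ => ?_
  rw [hA.apply i j]
  ring

theorem det_ne_zero_of_matrixForm_pos {A : Matrix (Fin n) (Fin n) ℝ}
    (hA : ∀ x, x ≠ 0 → 0 < matrixForm A x x) : A.det ≠ 0 := by
  intro h
  obtain ⟨v, hv, hv0⟩ := Matrix.exists_mulVec_eq_zero_iff.2 h
  have := hA (WithLp.toLp 2 v) (by simpa using hv)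
  refine this.ne' ?_
  unfold matrixForm
  refine Finset.sum_eq_zero fun i _ => ?_
  have h1 : ∑ j, A i j * v j = 0 := congrFun hv0 i
  calc ∑ j, A i j * v i * v j = v i * ∑ j, A i j * v j := by
        rw [Finset.mul_sum]; exact Finset.sum_congr rfl fun j _ => by ring
    _ = 0 := by rw [h1, mul_zero]

/-- The metric itself is parallel, so the product rule involves only the covariant derivatives of
the two fields, here written as ordinary derivative minus `parallelDeriv`. -/
theorem hasDerivAt_matrixForm {G : EuclideanSpace ℝ (Fin 2) → Matrix (Fin 2) (Fin 2) ℝ}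
    {c x y : ℝ → EuclideanSpace ℝ (Fin 2)} {v x' y' : EuclideanSpace ℝ (Fin 2)} {t : ℝ}
    (hs : ∀ᶠ z in 𝓝 (c t), (G z).IsSymm) (h0 : (G (c t)).det ≠ 0)
    (hG : ∀ i j, DifferentiableAt ℝ (fun z => G z i j) (c t)) (hc : HasDerivAt c v t)
    (hx : HasDerivAt x x' t) (hy : HasDerivAt y y' t) :
    HasDerivAt (fun r => matrixForm (G (c r)) (x r) (y r))
      (matrixForm (G (c t)) (x' - parallelDeriv G (c t) v (x t)) (y t)
        + matrixForm (G (c t)) (x t) (y' - parallelDeriv G (c t) v (y t))) t := by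
  have hGd : ∀ i j, HasDerivAt (fun r => G (c r) i j)
      (∑ k, v k * partialDeriv k (fun y => G y i j) (c t)) t := fun i j => by
    rw [← fderiv_eq_sum_partialDeriv]
    exact (hG i j).hasFDerivAt.comp_hasDerivAt t hc
  have hxd : ∀ k, HasDerivAt (fun r => x r k) (x' k) t :=
    fun k => ((EuclideanSpace.proj (𝕜 := ℝ) k).hasFDerivAt.comp_hasDerivAt t hx :)
  have hyd : ∀ k, HasDerivAt (fun r => y r k) (y' k) t :=
    fun k => ((EuclideanSpace.proj (𝕜 := ℝ) k).hasFDerivAt.comp_hasDerivAt t hy :)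
  have := HasDerivAt.fun_sum (u := Finset.univ) fun i _ => HasDerivAt.fun_sum (u := Finset.univ)
    fun j _ => ((hGd i j).mul (hxd i)).mul (hyd j)
  refine this.congr_deriv ?_
  simp only [matrixForm, partialDeriv_metric hs h0, parallelDeriv, Fin.sum_univ_two,
    PiLp.sub_apply]
  simp only [Pi.mul_apply]
  ring

/-- A field along a geodesic of a surface that is orthogonal to the velocity and has the same length
is parallel. -/
theorem hasDerivAt_parallel_of_orthogonal
    {G : EuclideanSpace ℝ (Fin 2) → Matrix (Fin 2) (Fin 2) ℝ}
    {c u w : ℝ → EuclideanSpace ℝ (Fin 2)} {w' : EuclideanSpace ℝ (Fin 2)} {t : ℝ}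
    (hs : ∀ᶠ z in 𝓝 (c t), (G z).IsSymm) (hpos : ∀ x, x ≠ 0 → 0 < matrixForm (G (c t)) x x)
    (hG : ∀ i j, DifferentiableAt ℝ (fun z => G z i j) (c t)) (hc : HasDerivAt c (u t) t)
    (hu : HasDerivAt u (parallelDeriv G (c t) (u t) (u t)) t) (hw : HasDerivAt w w' t)
    (huw : ∀ᶠ r in 𝓝 t, matrixForm (G (c r)) (u r) (w r) = 0)
    (hww : ∀ᶠ r in 𝓝 t, matrixForm (G (c r)) (w r) (w r) = matrixForm (G (c r)) (u r) (u r))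
    (hu0 : u t ≠ 0) :
    HasDerivAt w (parallelDeriv G (c t) (u t) (w t)) t := by
  have h0 := det_ne_zero_of_matrixForm_pos hpos
  set A := G (c t) with hA
  -- The covariant derivative of `w`. Differentiating the two identities, with `u` parallel, shows
  -- that it is orthogonal to both `u` and `w`; these form a basis, so it vanishes.
  set D := w' - parallelDeriv G (c t) (u t) (w t) with hD
  have hz : ∀ x, matrixForm A x 0 = 0 := fun x => by simp [matrixForm]
  have hz' : ∀ x, matrixForm A 0 x = 0 := fun x => by simp [matrixForm]
  have d1 := hasDerivAt_matrixForm hs h0 hG hc hu hu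
  have d2 := hasDerivAt_matrixForm hs h0 hG hc hw hw
  have d3 := hasDerivAt_matrixForm hs h0 hG hc hu hw
  rw [sub_self, ← hA, hz, hz', add_zero] at d1
  rw [sub_self, ← hA, ← hD, hz', zero_add] at d3
  rw [← hA, ← hD] at d2
  have e3 : matrixForm A (u t) D = 0 :=
    d3.unique ((hasDerivAt_const t (0 : ℝ)).congr_of_eventuallyEq huw)
  have e2 := d2.unique (d1.congr_of_eventuallyEq hww)
  rw [matrixForm_comm hs.self_of_nhds D (w t)] at e2
  have e2' : matrixForm A (w t) D = 0 := by linarith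
  have o1 := huw.self_of_nhds
  have o2 := hww.self_of_nhds
  have hup := hpos _ hu0
  have hsym : A 1 0 = A 0 1 := hs.self_of_nhds.apply 0 1
  simp only [← hA] at o1 o2 hup
  -- By the Gram identity, the square of this determinant times `det A` is the square of the
  -- positive number g(u,u).
  have hdet : (u t 0 * w t 1 - u t 1 * w t 0) ≠ 0 := by
    intro hd
    have gram : matrixForm A (u t) (u t) * matrixForm A (w t) (w t)
        - matrixForm A (u t) (w t) ^ 2
        = (A 0 0 * A 1 1 - A 0 1 ^ 2) * (u t 0 * w t 1 - u t 1 * w t 0) ^ 2 := by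
      simp only [matrixForm, Fin.sum_univ_two, hsym]
      ring
    rw [o1, o2, hd] at gram
    nlinarith
  set p : Fin 2 → ℝ := fun i => ∑ j, A i j * D j with hp
  have f1 : u t 0 * p 0 + u t 1 * p 1 = 0 := by
    rw [← e3]; simp only [matrixForm, hp, Fin.sum_univ_two]; ring
  have f2 : w t 0 * p 0 + w t 1 * p 1 = 0 := by
    rw [← e2']; simp only [matrixForm, hp, Fin.sum_univ_two]; ring
  have p0 : p 0 = 0 := by
    have : (u t 0 * w t 1 - u t 1 * w t 0) * p 0 = 0 := by
      linear_combination w t 1 * f1 - u t 1 * f2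
    exact (mul_eq_zero.1 this).resolve_left hdet
  have p1 : p 1 = 0 := by
    have : (u t 0 * w t 1 - u t 1 * w t 0) * p 1 = 0 := by
      linear_combination u t 0 * f2 - w t 0 * f1
    exact (mul_eq_zero.1 this).resolve_left hdet
  have hDD : matrixForm A D D = 0 := by
    have : matrixForm A D D = D 0 * p 0 + D 1 * p 1 := by
      simp only [matrixForm, hp, Fin.sum_univ_two]; ring
    rw [this, p0, p1]; ring
  have hD0 : D = 0 := by
    by_contra h
    exact (hpos D h).ne' hDD
  rw [← sub_eq_zero.1 hD0]
  exact hw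

end Coordinates

/-! ### Frames, tensor coefficients and curves in smooth charts -/

section Charts

variable {n : ℕ} {M : Type*} [TopologicalSpace M] [ChartedSpace (EuclideanSpace ℝ (Fin n)) M]
  {e : OpenPartialHomeomorph M (EuclideanSpace ℝ (Fin n))} {y : EuclideanSpace ℝ (Fin n)}

theorem mdifferentiableAt_chart (he : e ∈ smoothCharts n M) {x : M} (hx : x ∈ e.source) :
    MDifferentiableAt (𝓡 n) 𝓘(ℝ, EuclideanSpace ℝ (Fin n)) e x :=
  (contMDiffAt_of_mem_maximalAtlas he hx).mdifferentiableAt (by simp)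

theorem mdifferentiableAt_chart_symm (he : e ∈ smoothCharts n M) (hy : y ∈ e.target) :
    MDifferentiableAt 𝓘(ℝ, EuclideanSpace ℝ (Fin n)) (𝓡 n) e.symm y :=
  (contMDiffAt_symm_of_mem_maximalAtlas he hy).mdifferentiableAt (by simp)

/-- The differential of a chart, as a linear map of the model space. -/
noncomputable def chartDeriv (e : OpenPartialHomeomorph M (EuclideanSpace ℝ (Fin n))) (x : M) :
    EuclideanSpace ℝ (Fin n) →L[ℝ] EuclideanSpace ℝ (Fin n) :=
  mfderiv (𝓡 n) 𝓘(ℝ, EuclideanSpace ℝ (Fin n)) e x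

/-- The differential of an inverse chart, as a linear map of the model space. -/
noncomputable def chartSymmDeriv (e : OpenPartialHomeomorph M (EuclideanSpace ℝ (Fin n)))
    (y : EuclideanSpace ℝ (Fin n)) : EuclideanSpace ℝ (Fin n) →L[ℝ] EuclideanSpace ℝ (Fin n) :=
  coordFrame e y

theorem coordCoframe_coordFrame (he : e ∈ smoothCharts n M) (hy : y ∈ e.target)
    (v : EuclideanSpace ℝ (Fin n)) : coordCoframe e y (coordFrame e y v) = v := by
  have h1 := mfderiv_comp y (mdifferentiableAt_chart he (e.map_target hy))
    (mdifferentiableAt_chart_symm he hy)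
  have h2 : (e ∘ e.symm : EuclideanSpace ℝ (Fin n) → EuclideanSpace ℝ (Fin n)) =ᶠ[𝓝 y] id := by
    filter_upwards [e.open_target.mem_nhds hy] with z hz using e.right_inv hz
  rw [h2.mfderiv_eq, mfderiv_id] at h1
  exact (congrArg (fun L : EuclideanSpace ℝ (Fin n) →L[ℝ] EuclideanSpace ℝ (Fin n) => L v) h1).symm

theorem coordFrame_coordCoframe (he : e ∈ smoothCharts n M) (hy : y ∈ e.target)
    (v : EuclideanSpace ℝ (Fin n)) : coordFrame e y (coordCoframe e y v) = v := by
  have h0 : e (e.symm y) = y := e.right_inv hy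
  have h1 := mfderiv_comp (e.symm y) (g := e.symm) (by
      rw [h0]; exact mdifferentiableAt_chart_symm he hy)
    (mdifferentiableAt_chart he (e.map_target hy))
  have h2 : (e.symm ∘ e : M → M) =ᶠ[𝓝 (e.symm y)] id := by
    filter_upwards [e.open_source.mem_nhds (e.map_target hy)] with z hz using e.left_inv hz
  rw [h2.mfderiv_eq, mfderiv_id] at h1
  have h3 := congrArg (fun L : EuclideanSpace ℝ (Fin n) →L[ℝ] EuclideanSpace ℝ (Fin n) => L v) h1
  have h4 : (coordFrame e (e (e.symm y)) :
      EuclideanSpace ℝ (Fin n) →L[ℝ] EuclideanSpace ℝ (Fin n)) = coordFrame e y :=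
    congrArg (chartSymmDeriv e) h0
  exact ((congrArg (fun L : EuclideanSpace ℝ (Fin n) →L[ℝ] EuclideanSpace ℝ (Fin n) =>
    L (coordCoframe e y v)) h4).symm.trans h3.symm)

theorem coordFrame_coordEnd (he : e ∈ smoothCharts n M) (hy : y ∈ e.target) (J : EndField n M)
    (v : EuclideanSpace ℝ (Fin n)) :
    coordFrame e y (coordEnd J e y v) = J (e.symm y) (coordFrame e y v) :=
  coordFrame_coordCoframe he hy _

theorem coordFrame_injective (he : e ∈ smoothCharts n M) (hy : y ∈ e.target)
    {v : EuclideanSpace ℝ (Fin n)} (hv : v ≠ 0) : coordFrame e y v ≠ 0 := by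
  intro h
  apply hv
  rw [← coordCoframe_coordFrame he hy v, h]
  exact map_zero (coordCoframe e y)

theorem matrixForm_coordMatrix (B : BilinField n M)
    (e : OpenPartialHomeomorph M (EuclideanSpace ℝ (Fin n))) (y v w : EuclideanSpace ℝ (Fin n)) :
    matrixForm (coordMatrix B e y) v w =
      B (e.symm y) (coordFrame e y v) (coordFrame e y w) := by
  set b : EuclideanSpace ℝ (Fin n) →L[ℝ] EuclideanSpace ℝ (Fin n) →L[ℝ] ℝ := B (e.symm y)
  set F : EuclideanSpace ℝ (Fin n) →L[ℝ] EuclideanSpace ℝ (Fin n) := coordFrame e y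
  change ∑ i, ∑ j, b (F (EuclideanSpace.single i 1)) (F (EuclideanSpace.single j 1)) * v i * w j
    = b (F v) (F w)
  conv_rhs => rw [← (EuclideanSpace.basisFun (Fin n) ℝ).sum_repr v,
    ← (EuclideanSpace.basisFun (Fin n) ℝ).sum_repr w]
  simp only [map_sum, map_smul, EuclideanSpace.basisFun_repr, EuclideanSpace.basisFun_apply,
    sum_apply, smul_apply, smul_eq_mul, Finset.mul_sum]
  rw [Finset.sum_comm]
  exact Finset.sum_congr rfl fun i _ => Finset.sum_congr rfl fun j _ => by ring

theorem isSymm_coordMatrix {g : BilinField n M} (hg : ∀ x v w, g x v w = g x w v)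
    (e : OpenPartialHomeomorph M (EuclideanSpace ℝ (Fin n))) (y : EuclideanSpace ℝ (Fin n)) :
    (coordMatrix g e y).IsSymm :=
  Matrix.IsSymm.ext fun _ _ => hg _ _ _

theorem IsSmoothMetric.matrixForm_pos {g : BilinField n M} (hg : IsSmoothMetric g)
    (he : e ∈ smoothCharts n M) (hy : y ∈ e.target) (v : EuclideanSpace ℝ (Fin n)) (hv : v ≠ 0) :
    0 < matrixForm (coordMatrix g e y) v v := by
  rw [matrixForm_coordMatrix]
  exact hg.pos _ _ (coordFrame_injective he hy hv)

theorem IsSmoothMetric.det_ne_zero {g : BilinField n M} (hg : IsSmoothMetric g)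
    (he : e ∈ smoothCharts n M) (hy : y ∈ e.target) : (coordMatrix g e y).det ≠ 0 :=
  det_ne_zero_of_matrixForm_pos fun v hv => hg.matrixForm_pos he hy v hv

theorem SmoothBilin.contDiffOn_iterCovDeriv {g h : BilinField n M} (hg : IsSmoothMetric g)
    (hh : SmoothBilin h) (he : e ∈ smoothCharts n M) (k : ℕ) (a : Fin (2 + k) → Fin n) :
    ContDiffOn ℝ ∞ (fun y => iterCovDeriv (coordMatrix g e)
      (fun z (a : Fin 2 → Fin n) => coordMatrix h e z (a 0) (a 1)) k y a) e.target :=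
  _root_.contDiffOn_iterCovDeriv e.open_target (hg.smooth e he)
    (fun _ hy => hg.det_ne_zero he hy) (fun a => hh e he (a 0) (a 1)) k a

/-- The chart obtained from `e` by a linear change of coordinates. -/
noncomputable def linearChart (e : OpenPartialHomeomorph M (EuclideanSpace ℝ (Fin n)))
    (L : EuclideanSpace ℝ (Fin n) ≃L[ℝ] EuclideanSpace ℝ (Fin n)) :
    OpenPartialHomeomorph M (EuclideanSpace ℝ (Fin n)) :=
  e.trans L.toHomeomorph.toOpenPartialHomeomorph

omit [ChartedSpace (EuclideanSpace ℝ (Fin n)) M] in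
theorem linearChart_source (L : EuclideanSpace ℝ (Fin n) ≃L[ℝ] EuclideanSpace ℝ (Fin n)) :
    (linearChart e L).source = e.source := by
  simp [linearChart]

theorem linearChart_mem [IsManifold (𝓡 n) ∞ M] (he : e ∈ smoothCharts n M)
    (L : EuclideanSpace ℝ (Fin n) ≃L[ℝ] EuclideanSpace ℝ (Fin n)) :
    linearChart e L ∈ smoothCharts n M := by
  refine OpenPartialHomeomorph.mem_maximalAtlas_of_contMDiffOn _ ?_ ?_
  · rw [linearChart_source]
    exact L.contDiff.contMDiff.comp_contMDiffOn (contMDiffOn_of_mem_maximalAtlas he)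
  · refine (contMDiffOn_symm_of_mem_maximalAtlas he).comp
      (L.symm.contDiff.contMDiff.contMDiffOn (s := (linearChart e L).target)) fun z hz => ?_
    simpa [linearChart] using hz

theorem coordFrame_linearChart (he : e ∈ smoothCharts n M) (hy : y ∈ e.target)
    (L : EuclideanSpace ℝ (Fin n) ≃L[ℝ] EuclideanSpace ℝ (Fin n)) (v : EuclideanSpace ℝ (Fin n)) :
    (coordFrame (linearChart e L) (L y) v : EuclideanSpace ℝ (Fin n)) =
      coordFrame e y (L.symm v) := by
  have h0 : L.symm (L y) = y := L.symm_apply_apply y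
  have h1 := mfderiv_comp (L y) (g := e.symm) (f := L.symm)
    (by rw [h0]; exact mdifferentiableAt_chart_symm he hy)
    (L.symm.differentiableAt.mdifferentiableAt)
  have h2 : (mfderiv 𝓘(ℝ, EuclideanSpace ℝ (Fin n)) 𝓘(ℝ, EuclideanSpace ℝ (Fin n)) L.symm (L y) :
      EuclideanSpace ℝ (Fin n) →L[ℝ] EuclideanSpace ℝ (Fin n)) =
      (L.symm : EuclideanSpace ℝ (Fin n) →L[ℝ] EuclideanSpace ℝ (Fin n)) := by
    rw [mfderiv_eq_fderiv]; exact L.symm.fderiv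
  have h3 := congrArg (fun A : EuclideanSpace ℝ (Fin n) →L[ℝ] EuclideanSpace ℝ (Fin n) => A v) h1
  refine h3.trans ?_
  change (coordFrame e (L.symm (L y)) : EuclideanSpace ℝ (Fin n) →L[ℝ] EuclideanSpace ℝ (Fin n))
    ((mfderiv 𝓘(ℝ, EuclideanSpace ℝ (Fin n)) 𝓘(ℝ, EuclideanSpace ℝ (Fin n)) L.symm (L y) :
      EuclideanSpace ℝ (Fin n) →L[ℝ] EuclideanSpace ℝ (Fin n)) v) = _
  rw [h2]
  exact congrArg (fun z => chartSymmDeriv e z (L.symm v)) h0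

/-! ## Curves -/

/-- The velocity of a curve. -/
noncomputable def velocity (γ : ℝ → M) (t : ℝ) : EuclideanSpace ℝ (Fin n) :=
  mfderiv 𝓘(ℝ, ℝ) (𝓡 n) γ t (1 : ℝ)

theorem hasDerivAt_chart_comp (he : e ∈ smoothCharts n M) {γ : ℝ → M} {t : ℝ}
    (hγ : MDifferentiableAt 𝓘(ℝ, ℝ) (𝓡 n) γ t) (ht : γ t ∈ e.source) :
    HasDerivAt (e ∘ γ) (coordCoframe e (e (γ t)) (velocity γ t)) t := by
  have h1 := mfderiv_comp t (mdifferentiableAt_chart he ht) hγ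
  have hd : DifferentiableAt ℝ (e ∘ γ) t :=
    ((mdifferentiableAt_chart he ht).comp t hγ).differentiableAt
  rw [mfderiv_eq_fderiv] at h1
  have h2 : deriv (e ∘ γ) t = (mfderiv (𝓡 n) 𝓘(ℝ, EuclideanSpace ℝ (Fin n)) e (γ t) :
      EuclideanSpace ℝ (Fin n) →L[ℝ] EuclideanSpace ℝ (Fin n)) (velocity γ t) := by
    exact congrArg (fun A : ℝ →L[ℝ] EuclideanSpace ℝ (Fin n) => A 1) h1
  have h3 : (mfderiv (𝓡 n) 𝓘(ℝ, EuclideanSpace ℝ (Fin n)) e (γ t) :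
      EuclideanSpace ℝ (Fin n) →L[ℝ] EuclideanSpace ℝ (Fin n)) = coordCoframe e (e (γ t)) :=
    (congrArg (chartDeriv e) (e.left_inv ht)).symm
  rw [h3] at h2
  exact hd.hasDerivAt.congr_deriv h2

theorem coordFrame_deriv (he : e ∈ smoothCharts n M) {γ : ℝ → M} {t : ℝ}
    (hγ : MDifferentiableAt 𝓘(ℝ, ℝ) (𝓡 n) γ t) (ht : γ t ∈ e.source) :
    coordFrame e (e (γ t)) (deriv (e ∘ γ) t) = velocity γ t := by
  rw [(hasDerivAt_chart_comp he hγ ht).deriv]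
  exact coordFrame_coordCoframe he (e.map_source ht) _

/-- Tangent spaces at different points are formally different types. With the vectors typed in the
model space, an equality of base points can be used by substitution. -/
theorem bilin_congr (B : BilinField n M) {x x' : M} (h : x = x') (v w : EuclideanSpace ℝ (Fin n)) :
    (B x : EuclideanSpace ℝ (Fin n) →L[ℝ] EuclideanSpace ℝ (Fin n) →L[ℝ] ℝ) v w = B x' v w := by
  subst h; rfl

theorem end_congr (J : EndField n M) {x x' : M} (h : x = x') (v : EuclideanSpace ℝ (Fin n)) :
    (J x : EuclideanSpace ℝ (Fin n) →L[ℝ] EuclideanSpace ℝ (Fin n)) v =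
      (J x' : EuclideanSpace ℝ (Fin n) →L[ℝ] EuclideanSpace ℝ (Fin n)) v := by
  subst h; rfl

end Charts

/-! ### Geodesics in coordinates -/

section Geodesics

variable {n : ℕ} {M : Type*} [TopologicalSpace M] [ChartedSpace (EuclideanSpace ℝ (Fin n)) M]
  {e : OpenPartialHomeomorph M (EuclideanSpace ℝ (Fin n))} {g : BilinField n M} {γ : ℝ → M}
  {s : Set ℝ} {t : ℝ}

theorem IsGeodesicOn.mono (hγ : IsGeodesicOn g γ s) {s' : Set ℝ} (h : s' ⊆ s) :
    IsGeodesicOn g γ s' :=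
  ⟨hγ.1.mono h, fun e he t ht => hγ.2 e he t (h ht)⟩

theorem IsGeodesicOn.mdifferentiableAt (hγ : IsGeodesicOn g γ s) (hs : IsOpen s) (ht : t ∈ s) :
    MDifferentiableAt 𝓘(ℝ, ℝ) (𝓡 n) γ t :=
  (hγ.1.contMDiffAt (hs.mem_nhds ht)).mdifferentiableAt (by simp)

theorem IsGeodesicOn.isOpen_preimage (hγ : IsGeodesicOn g γ s) (hs : IsOpen s)
    (e : OpenPartialHomeomorph M (EuclideanSpace ℝ (Fin n))) : IsOpen (s ∩ γ ⁻¹' e.source) :=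
  hγ.1.continuousOn.isOpen_inter_preimage hs e.open_source

theorem IsGeodesicOn.contDiffOn (hγ : IsGeodesicOn g γ s) (he : e ∈ smoothCharts n M) :
    ContDiffOn ℝ ∞ (e ∘ γ) (s ∩ γ ⁻¹' e.source) := by
  rw [← contMDiffOn_iff_contDiffOn]
  exact (contMDiffOn_of_mem_maximalAtlas he).comp (hγ.1.mono inter_subset_left) fun r hr => hr.2

theorem IsGeodesicOn.hasDerivAt (hγ : IsGeodesicOn g γ s) (hs : IsOpen s)
    (he : e ∈ smoothCharts n M) (ht : t ∈ s) (hte : γ t ∈ e.source) :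
    HasDerivAt (e ∘ γ) (deriv (e ∘ γ) t) t :=
  (((hγ.contDiffOn he).contDiffAt ((hγ.isOpen_preimage hs e).mem_nhds ⟨ht, hte⟩)).differentiableAt
    (by simp)).hasDerivAt

/-- The geodesic equation, read as the parallelism of the velocity along the curve. -/
theorem IsGeodesicOn.hasDerivAt_deriv (hγ : IsGeodesicOn g γ s) (hs : IsOpen s)
    (he : e ∈ smoothCharts n M) (ht : t ∈ s) (hte : γ t ∈ e.source) :
    HasDerivAt (deriv (e ∘ γ)) (parallelDeriv (coordMatrix g e) (e (γ t)) (deriv (e ∘ γ) t)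
      (deriv (e ∘ γ) t)) t := by
  have h1 : ContDiffOn ℝ ∞ (deriv (e ∘ γ)) (s ∩ γ ⁻¹' e.source) :=
    (hγ.contDiffOn he).deriv_of_isOpen (hγ.isOpen_preimage hs e) (by simp)
  have h2 := ((h1.contDiffAt ((hγ.isOpen_preimage hs e).mem_nhds ⟨ht, hte⟩)).differentiableAt
    (by simp)).hasDerivAt
  refine h2.congr_deriv ?_
  ext k
  have h3 := hγ.2 e he t ht hte k
  rw [iteratedDeriv_succ, iteratedDeriv_one] at h3
  exact eq_neg_of_add_eq_zero_left h3

end Geodesics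

/-! ### The parallel frame γ', Jγ' and jets of bilinear forms along geodesics -/

section Frames

variable {M : Type*} [TopologicalSpace M] [ChartedSpace (EuclideanSpace ℝ (Fin 2)) M]
  {e : OpenPartialHomeomorph M (EuclideanSpace ℝ (Fin 2))} {g h : BilinField 2 M}
  {J : EndField 2 M} {γ : ℝ → M} {s : Set ℝ} {t : ℝ}

/-- `J` is the rotation by a right angle for the metric `g`. -/
structure IsRightRotation (g : BilinField 2 M) (J : EndField 2 M) : Prop where
  smooth : SmoothEnd J
  norm_eq : ∀ x v, g x (J x v) (J x v) = g x v v
  orth : ∀ x v, g x v (J x v) = 0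

/-- The frame `u, J u` in a chart. -/
noncomputable def rotFrame (J : EndField 2 M)
    (e : OpenPartialHomeomorph M (EuclideanSpace ℝ (Fin 2))) (y u : EuclideanSpace ℝ (Fin 2)) :
    Fin 2 → EuclideanSpace ℝ (Fin 2) :=
  ![u, coordEnd J e y u]

/-- The family of vectors `u, …, u, v, w`. -/
def slots (u v w : EuclideanSpace ℝ (Fin 2)) : (m : ℕ) → Fin (2 + m) → EuclideanSpace ℝ (Fin 2)
  | 0 => ![v, w]
  | m + 1 => Fin.cons u (slots u v w m)

/-- The value `(∇ᵐ h)(u, …, u, Fᵢ, Fⱼ)` with `F₀ = u`, `F₁ = J u`. -/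
noncomputable def frameJet (g h : BilinField 2 M) (J : EndField 2 M)
    (e : OpenPartialHomeomorph M (EuclideanSpace ℝ (Fin 2))) (i j : Fin 2) (m : ℕ)
    (y u : EuclideanSpace ℝ (Fin 2)) : ℝ :=
  contract (iterCovDeriv (coordMatrix g e)
    (fun z (a : Fin 2 → Fin 2) => coordMatrix h e z (a 0) (a 1)) m y)
    (slots u (rotFrame J e y u i) (rotFrame J e y u j) m)

/-- The frame `γ', J γ'` along a curve. -/
noncomputable def curveFrame (J : EndField 2 M) (γ : ℝ → M) (t : ℝ) :
    Fin 2 → EuclideanSpace ℝ (Fin 2) :=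
  ![velocity γ t, J (γ t) (velocity γ t)]

/-- The component `h(Fᵢ, Fⱼ)` along a curve, in the frame `F₀ = γ'`, `F₁ = J γ'`. -/
noncomputable def curveComponent (h : BilinField 2 M) (J : EndField 2 M) (γ : ℝ → M) (i j : Fin 2)
    (t : ℝ) : ℝ :=
  h (γ t) (curveFrame J γ t i) (curveFrame J γ t j)

theorem contract_two (A : Matrix (Fin 2) (Fin 2) ℝ) (v w : EuclideanSpace ℝ (Fin 2)) :
    contract (fun a : Fin 2 → Fin 2 => A (a 0) (a 1)) ![v, w] = matrixForm A v w := by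
  unfold contract matrixForm
  rw [sum_fin_cons]
  rw [← (Equiv.funUnique (Fin 1) (Fin 2)).symm.sum_comp, Finset.sum_comm]
  refine Finset.sum_congr rfl fun i _ => Finset.sum_congr rfl fun j _ => ?_
  simp [Fin.prod_univ_two, mul_assoc]

theorem coordFrame_rotFrame (he : e ∈ smoothCharts 2 M)
    (hγ : MDifferentiableAt 𝓘(ℝ, ℝ) (𝓡 2) γ t) (ht : γ t ∈ e.source) (i : Fin 2) :
    coordFrame e (e (γ t)) (rotFrame J e (e (γ t)) (deriv (e ∘ γ) t) i) = curveFrame J γ t i := by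
  have h0 := coordFrame_deriv he hγ ht
  fin_cases i
  · exact h0
  · change coordFrame e (e (γ t)) (coordEnd J e (e (γ t)) (deriv (e ∘ γ) t)) = _
    rw [coordFrame_coordEnd he (e.map_source ht), h0]
    exact end_congr J (e.left_inv ht) _

theorem matrixForm_rotFrame (he : e ∈ smoothCharts 2 M)
    (hγ : MDifferentiableAt 𝓘(ℝ, ℝ) (𝓡 2) γ t) (ht : γ t ∈ e.source) (h : BilinField 2 M)
    (i j : Fin 2) :
    matrixForm (coordMatrix h e (e (γ t))) (rotFrame J e (e (γ t)) (deriv (e ∘ γ) t) i)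
      (rotFrame J e (e (γ t)) (deriv (e ∘ γ) t) j) = curveComponent h J γ i j t := by
  rw [matrixForm_coordMatrix, coordFrame_rotFrame he hγ ht, coordFrame_rotFrame he hγ ht]
  exact bilin_congr h (e.left_inv ht) _ _

theorem frameJet_zero (y u : EuclideanSpace ℝ (Fin 2)) (i j : Fin 2) :
    frameJet g h J e i j 0 y u =
      matrixForm (coordMatrix h e y) (rotFrame J e y u i) (rotFrame J e y u j) :=
  contract_two _ _ _

/-- Along a geodesic, the frame `γ', J γ'` is parallel. -/
theorem hasDerivAt_rotFrame (hg : IsSmoothMetric g) (hJ : IsRightRotation g J)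
    (hγ : IsGeodesicOn g γ s) (hs : IsOpen s) (he : e ∈ smoothCharts 2 M) (ht : t ∈ s)
    (hte : γ t ∈ e.source) (hv : velocity (n := 2) γ t ≠ 0) (i : Fin 2) :
    HasDerivAt (fun r => rotFrame J e (e (γ r)) (deriv (e ∘ γ) r) i)
      (parallelDeriv (coordMatrix g e) (e (γ t)) (deriv (e ∘ γ) t)
        (rotFrame J e (e (γ t)) (deriv (e ∘ γ) t) i)) t := by
  have hc := hγ.hasDerivAt hs he ht hte
  have hu := hγ.hasDerivAt_deriv hs he ht hte
  have hV := (hγ.isOpen_preimage hs e).mem_nhds ⟨ht, hte⟩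
  have hJd : DifferentiableAt ℝ (coordEnd J e) (e (γ t)) :=
    ((hJ.smooth e he).contDiffAt (e.open_target.mem_nhds (e.map_source hte))).differentiableAt
      (by simp)
  have hJc : HasDerivAt (fun r => coordEnd J e (e (γ r)))
      (fderiv ℝ (coordEnd J e) (e (γ t)) (deriv (e ∘ γ) t)) t :=
    HasFDerivAt.comp_hasDerivAt (f := e ∘ γ) t hJd.hasFDerivAt hc
  have hw := HasDerivAt.clm_apply hJc hu
  have main : HasDerivAt (fun r => coordEnd J e (e (γ r)) (deriv (e ∘ γ) r))
      (parallelDeriv (coordMatrix g e) (e (γ t)) (deriv (e ∘ γ) t)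
        (coordEnd J e (e (γ t)) (deriv (e ∘ γ) t))) t := by
    refine hasDerivAt_parallel_of_orthogonal (c := e ∘ γ) (u := deriv (e ∘ γ))
      (w := fun r => coordEnd J e (e (γ r)) (deriv (e ∘ γ) r)) 
      (.of_forall (isSymm_coordMatrix hg.symm e)) (hg.matrixForm_pos he (e.map_source hte))
      (fun i j => ((hg.smooth e he i j).contDiffAt
        (e.open_target.mem_nhds (e.map_source hte))).differentiableAt (by simp)) hc hu hw ?_ ?_ ?_
    · filter_upwards [hV] with r hr
      exact (matrixForm_rotFrame (J := J) he (hγ.mdifferentiableAt hs hr.1) hr.2 g 0 1).trans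
        (hJ.orth _ _)
    · filter_upwards [hV] with r hr
      exact ((matrixForm_rotFrame (J := J) he (hγ.mdifferentiableAt hs hr.1) hr.2 g 1 1).trans
        (hJ.norm_eq _ _)).trans
        (matrixForm_rotFrame (J := J) he (hγ.mdifferentiableAt hs hr.1) hr.2 g 0 0).symm
    · intro h0
      have := coordFrame_deriv he (hγ.mdifferentiableAt hs ht) hte
      rw [h0] at this
      exact hv (this.symm.trans (map_zero (coordFrame e (e (γ t)))))
  fin_cases i
  · exact hu
  · exact main

/-- Every slot of the jet holds a parallel field, so the derivative falls on the tensor alone, and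
the direction of differentiation γ' becomes the new first slot. -/
theorem hasDerivAt_frameJet (hg : IsSmoothMetric g) (hJ : IsRightRotation g J)
    (hh : SmoothBilin h) (hγ : IsGeodesicOn g γ s) (hs : IsOpen s) (he : e ∈ smoothCharts 2 M)
    (ht : t ∈ s) (hte : γ t ∈ e.source) (hv : velocity (n := 2) γ t ≠ 0) (i j : Fin 2) (m : ℕ) :
    HasDerivAt (fun r => frameJet g h J e i j m (e (γ r)) (deriv (e ∘ γ) r))
      (frameJet g h J e i j (m + 1) (e (γ t)) (deriv (e ∘ γ) t)) t := by
  have hfr := hasDerivAt_rotFrame hg hJ hγ hs he ht hte hv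
  have hslots : ∀ k (s : Fin (2 + k)), HasDerivAt
      (fun r => slots (deriv (e ∘ γ) r) (rotFrame J e (e (γ r)) (deriv (e ∘ γ) r) i)
        (rotFrame J e (e (γ r)) (deriv (e ∘ γ) r) j) k s)
      (parallelDeriv (coordMatrix g e) (e (γ t)) (deriv (e ∘ γ) t)
        (slots (deriv (e ∘ γ) t) (rotFrame J e (e (γ t)) (deriv (e ∘ γ) t) i)
        (rotFrame J e (e (γ t)) (deriv (e ∘ γ) t) j) k s)) t := by
    intro k
    induction k with
    | zero =>
      intro s
      fin_cases s
      · exact hfr i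
      · exact hfr j
    | succ k ih =>
      intro s
      refine Fin.cases ?_ (fun s => ?_) s
      · exact hfr 0
      · exact ih s
  exact hasDerivAt_contract (c := e ∘ γ) (hγ.hasDerivAt hs he ht hte)
    (fun a => ((hh.contDiffOn_iterCovDeriv hg he m a).contDiffAt
      (e.open_target.mem_nhds (e.map_source hte))).differentiableAt (by simp)) (hslots m)

/-- Only the right side refers to a chart. The formula therefore also shows that the jet is
independent of the chart, and replaces any transformation law for ∇ᵐh. -/
theorem iteratedDeriv_curveComponent (hg : IsSmoothMetric g) (hJ : IsRightRotation g J)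
    (hh : SmoothBilin h) (hγ : IsGeodesicOn g γ s) (hs : IsOpen s)
    (hv : ∀ t ∈ s, velocity (n := 2) γ t ≠ 0) (he : e ∈ smoothCharts 2 M) (i j : Fin 2) (m : ℕ) :
    ∀ t ∈ s, γ t ∈ e.source → iteratedDeriv m (curveComponent h J γ i j) t =
      frameJet g h J e i j m (e (γ t)) (deriv (e ∘ γ) t) := by
  induction m with
  | zero =>
    intro t ht hte
    rw [iteratedDeriv_zero, frameJet_zero, matrixForm_rotFrame he (hγ.mdifferentiableAt hs ht) hte]
  | succ m ih =>
    intro t ht hte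
    rw [iteratedDeriv_succ]
    refine HasDerivAt.deriv ((hasDerivAt_frameJet hg hJ hh hγ hs he ht hte (hv t ht)
      i j m).congr_of_eventuallyEq ?_)
    filter_upwards [(hγ.isOpen_preimage hs e).mem_nhds ⟨ht, hte⟩] with r hr using ih r hr.1 hr.2

end Frames

/-! ### Jets at tangent vectors of fixed length, followed along geodesics -/

section UnitJets

theorem bilin_smul_smul {n : ℕ} {M : Type*} [TopologicalSpace M]
    [ChartedSpace (EuclideanSpace ℝ (Fin n)) M] (B : BilinField n M) (x : M) (t : ℝ)
    (v : EuclideanSpace ℝ (Fin n)) : B x (t • v) (t • v) = t ^ 2 * B x v v := by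
  let b : EuclideanSpace ℝ (Fin n) →L[ℝ] EuclideanSpace ℝ (Fin n) →L[ℝ] ℝ := B x
  change b (t • v) (t • v) = t ^ 2 * b v v
  simp only [map_smul, smul_apply, smul_eq_mul]
  ring

/-- If the injectivity radius is bounded away from zero, then there are geodesics of a definite
speed defined for a definite time from every point in every direction. -/
theorem exists_geodesic_of_injRadius {n : ℕ} {M : Type*} [TopologicalSpace M]
    [ChartedSpace (EuclideanSpace ℝ (Fin n)) M] {g : BilinField n M}
    (hinj : 0 < ⨅ x, injRadius g x) :
    ∃ c : ℝ, 0 < c ∧ ∀ (x : M) (v : EuclideanSpace ℝ (Fin n)), g x v v = c →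
      ∃ γ : ℝ → M, IsGeodesicOn g γ (Ioo (-1) 1) ∧ γ 0 = x ∧ velocity γ 0 = v := by
  obtain ⟨c, hc0, hc⟩ := exists_between hinj
  have hct : c ≠ ⊤ := (hc.trans_le le_top).ne
  have ha0 : 0 < c.toReal := ENNReal.toReal_pos hc0.ne' hct
  -- The constant is a squared length. Its root lies below every injectivity radius, so `t • v`
  -- stays in a ball where an exponential map exists for all |t| ≤ 1.
  refine ⟨c.toReal ^ 2, by positivity, fun x v hv => ?_⟩
  have hx : c < injRadius g x := hc.trans_le (iInf_le _ x)
  simp only [injRadius, lt_iSup_iff] at hx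
  obtain ⟨r, ⟨hr, E, hE, -, -⟩, hcr⟩ := hx
  have hcr' : c.toReal < r := (ENNReal.lt_ofReal_iff_toReal_lt hct).1 hcr
  have hball : ∀ t : ℝ, |t| ≤ 1 → t • v ∈ tangentBall g x r := fun t ht => by
    change √(g x (t • v) (t • v)) < r
    have := bilin_smul_smul g x t v
    rw [hv, ← mul_pow] at this
    rw [this, Real.sqrt_sq_eq_abs, abs_mul, abs_of_pos ha0]
    nlinarith
  have hv1 : v ∈ tangentBall g x r := by
    have := hball 1 (by simp)
    rwa [one_smul] at this
  obtain ⟨h1, h2⟩ := hE.2 v hv1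
  refine ⟨fun t => E (t • v), h1.mono fun t ht => hball t (abs_le.2 ⟨ht.1.le, ht.2.le⟩), ?_, h2⟩
  change E ((0 : ℝ) • v) = x
  rw [zero_smul]
  exact hE.1

variable {M : Type*} [TopologicalSpace M] [ChartedSpace (EuclideanSpace ℝ (Fin 2)) M]
  {e : OpenPartialHomeomorph M (EuclideanSpace ℝ (Fin 2))} {g h : BilinField 2 M}
  {J : EndField 2 M} {γ : ℝ → M} {s : Set ℝ} {t : ℝ}

/-- Geodesics have constant speed. -/
theorem IsGeodesicOn.speed_eq [IsManifold (𝓡 2) ∞ M] (hg : IsSmoothMetric g)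
    (hγ : IsGeodesicOn g γ s) (hs : IsOpen s) (hs' : IsPreconnected s) {t₀ : ℝ} (ht₀ : t₀ ∈ s)
    (ht : t ∈ s) : g (γ t) (velocity γ t) (velocity γ t) =
      g (γ t₀) (velocity γ t₀) (velocity γ t₀) := by
  set f : ℝ → ℝ := fun t => g (γ t) (velocity γ t) (velocity γ t) with hf
  have hder : ∀ t ∈ s, HasDerivAt f 0 t := by
    intro t ht
    set e := chartAt (EuclideanSpace ℝ (Fin 2)) (γ t) with he'
    have he : e ∈ smoothCharts 2 M := IsManifold.chart_mem_maximalAtlas _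
    have hte : γ t ∈ e.source := mem_chart_source _ _
    have hu := hγ.hasDerivAt_deriv hs he ht hte
    have h1 := hasDerivAt_matrixForm (G := coordMatrix g e) (c := e ∘ γ)
      (.of_forall (isSymm_coordMatrix hg.symm e)) (hg.det_ne_zero he (e.map_source hte))
      (fun i j => ((hg.smooth e he i j).contDiffAt
        (e.open_target.mem_nhds (e.map_source hte))).differentiableAt (by simp))
      (hγ.hasDerivAt hs he ht hte) hu hu
    have h2 := h1.congr_deriv (g' := 0) (by
      change matrixForm _ (parallelDeriv (coordMatrix g e) (e (γ t)) _ _ -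
        parallelDeriv (coordMatrix g e) (e (γ t)) _ _) _ + matrixForm _ _
        (parallelDeriv (coordMatrix g e) (e (γ t)) _ _ -
        parallelDeriv (coordMatrix g e) (e (γ t)) _ _) = 0
      rw [sub_self]
      simp [matrixForm])
    refine h2.congr_of_eventuallyEq ?_
    filter_upwards [(hγ.isOpen_preimage hs e).mem_nhds ⟨ht, hte⟩] with r hr
    -- Only the first vector of the frame occurs, so any endomorphism field may stand for `J`.
    exact (matrixForm_rotFrame (J := fun _ => 0) he (hγ.mdifferentiableAt hs hr.1) hr.2 g 0 0).symm
  exact hs.is_const_of_deriv_eq_zero hs' (fun t ht => (hder t ht).differentiableAt.differentiableWithinAt)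
    (fun t ht => (hder t ht).deriv) ht ht₀

/-- The value `(∇ᵐ h)(v, …, v, Fᵢ, Fⱼ)` with `F₀ = v`, `F₁ = J v`, for a tangent vector `v`. -/
noncomputable def tangentJet (g h : BilinField 2 M) (J : EndField 2 M) (i j : Fin 2) (m : ℕ)
    (x : M) (v : EuclideanSpace ℝ (Fin 2)) : ℝ :=
  frameJet g h J (chartAt _ x) i j m (chartAt _ x x)
    (coordCoframe (chartAt _ x) (chartAt _ x x) v)

variable [IsManifold (𝓡 2) ∞ M]

theorem tangentJet_eq_iteratedDeriv (hg : IsSmoothMetric g) (hJ : IsRightRotation g J)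
    (hh : SmoothBilin h) (hγ : IsGeodesicOn g γ s) (hs : IsOpen s)
    (hv : ∀ t ∈ s, velocity (n := 2) γ t ≠ 0) (i j : Fin 2) (m : ℕ) (ht : t ∈ s) :
    tangentJet g h J i j m (γ t) (velocity γ t) =
      iteratedDeriv m (curveComponent h J γ i j) t := by
  have he : chartAt _ (γ t) ∈ smoothCharts 2 M := IsManifold.chart_mem_maximalAtlas _
  rw [iteratedDeriv_curveComponent hg hJ hh hγ hs hv he i j m t ht (mem_chart_source _ _),
    (hasDerivAt_chart_comp he (hγ.mdifferentiableAt hs ht) (mem_chart_source _ _)).deriv]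
  rfl

/-- The preferred chart in `tangentJet` may jump as the point moves. The jets at nearby times are
first carried to the one chart at `γ t` by means of their chart-free description. -/
theorem hasDerivAt_tangentJet (hg : IsSmoothMetric g) (hJ : IsRightRotation g J)
    (hh : SmoothBilin h) (hγ : IsGeodesicOn g γ s) (hs : IsOpen s)
    (hv : ∀ t ∈ s, velocity (n := 2) γ t ≠ 0) (i j : Fin 2) (m : ℕ) (ht : t ∈ s) :
    HasDerivAt (fun r => tangentJet g h J i j m (γ r) (velocity γ r))
      (tangentJet g h J i j (m + 1) (γ t) (velocity γ t)) t := by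
  have he : chartAt _ (γ t) ∈ smoothCharts 2 M := IsManifold.chart_mem_maximalAtlas _
  have hte : γ t ∈ (chartAt (EuclideanSpace ℝ (Fin 2)) (γ t)).source := mem_chart_source _ _
  rw [tangentJet_eq_iteratedDeriv hg hJ hh hγ hs hv i j (m + 1) ht,
    iteratedDeriv_curveComponent hg hJ hh hγ hs hv he i j (m + 1) t ht hte]
  refine (hasDerivAt_frameJet hg hJ hh hγ hs he ht hte (hv t ht) i j m).congr_of_eventuallyEq ?_
  filter_upwards [(hγ.isOpen_preimage hs _).mem_nhds ⟨ht, hte⟩] with r hr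
  rw [tangentJet_eq_iteratedDeriv hg hJ hh hγ hs hv i j m hr.1,
    iteratedDeriv_curveComponent hg hJ hh hγ hs hv he i j m r hr.1 hr.2]

theorem velocity_ne_zero (hg : IsSmoothMetric g) (hγ : IsGeodesicOn g γ s) (hs : IsOpen s)
    (hs' : IsPreconnected s) {t₀ : ℝ} (ht₀ : t₀ ∈ s)
    (h0 : 0 < g (γ t₀) (velocity γ t₀) (velocity γ t₀)) (ht : t ∈ s) :
    velocity (n := 2) γ t ≠ 0 := by
  intro hv
  rw [← hγ.speed_eq hg hs hs' ht₀ ht, hv] at h0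
  have := bilin_smul_smul g (γ t) 0 0
  rw [zero_smul] at this
  exact h0.ne' (this.trans (by simp))

/-- A component `∇ᵐ h` that grows linearly along geodesics and is bounded is constant. -/
theorem tangentJet_eq_zero_of_bounded (hg : IsSmoothMetric g) (hJ : IsRightRotation g J)
    (hh : SmoothBilin h) {c : ℝ} (hc : 0 < c)
    (hgeo : ∀ (x : M) (v : EuclideanSpace ℝ (Fin 2)), g x v v = c →
      ∃ γ : ℝ → M, IsGeodesicOn g γ (Ioo (-1) 1) ∧ γ 0 = x ∧ velocity γ 0 = v)
    (i j : Fin 2) (m : ℕ) {C : ℝ}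
    (hbdd : ∀ (x : M) (v : EuclideanSpace ℝ (Fin 2)), g x v v = c →
      |tangentJet g h J i j m x v| ≤ C)
    (hzero : ∀ (x : M) (v : EuclideanSpace ℝ (Fin 2)), g x v v = c →
      tangentJet g h J i j (m + 2) x v = 0)
    (x : M) (v : EuclideanSpace ℝ (Fin 2)) (hv : g x v v = c) :
    tangentJet g h J i j (m + 1) x v = 0 := by
  -- Follow the geodesic for time 1/2: the jet of order `m + 1` has zero derivative and stays
  -- constant, and the jet of order `m` is affine with that slope. The length of the velocity is
  -- still `c`, so the step can be repeated from the end point; this takes the place of extending a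
  -- single geodesic.
  have step : ∀ (x : M) (v : EuclideanSpace ℝ (Fin 2)), g x v v = c →
      ∃ (x' : M) (v' : EuclideanSpace ℝ (Fin 2)), g x' v' v' = c ∧
        tangentJet g h J i j (m + 1) x' v' = tangentJet g h J i j (m + 1) x v ∧
        tangentJet g h J i j m x' v' =
          tangentJet g h J i j m x v + 1 / 2 * tangentJet g h J i j (m + 1) x v := by
    intro x v hv
    obtain ⟨γ, hγ, rfl, rfl⟩ := hgeo x v hv
    have hs : IsOpen (Ioo (-1 : ℝ) 1) := isOpen_Ioo
    have hs' : IsPreconnected (Ioo (-1 : ℝ) 1) := isPreconnected_Ioo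
    have h0 : (0 : ℝ) ∈ Ioo (-1 : ℝ) 1 := by norm_num
    have h12 : (1 / 2 : ℝ) ∈ Ioo (-1 : ℝ) 1 := by norm_num
    have hsp : ∀ t ∈ Ioo (-1 : ℝ) 1, g (γ t) (velocity γ t) (velocity γ t) = c := fun t ht =>
      (hγ.speed_eq hg hs hs' h0 ht).trans hv
    have hne : ∀ t ∈ Ioo (-1 : ℝ) 1, velocity (n := 2) γ t ≠ 0 := fun t ht =>
      velocity_ne_zero hg hγ hs hs' h0 (by rw [hv]; exact hc) ht
    have d0 := fun t ht => hasDerivAt_tangentJet hg hJ hh hγ hs hne i j m (t := t) ht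
    have d1 := fun t ht => hasDerivAt_tangentJet hg hJ hh hγ hs hne i j (m + 1) (t := t) ht
    have e1 : ∀ t ∈ Ioo (-1 : ℝ) 1, tangentJet g h J i j (m + 1) (γ t) (velocity γ t) =
        tangentJet g h J i j (m + 1) (γ 0) (velocity γ 0) := fun t ht =>
      hs.is_const_of_deriv_eq_zero hs'
        (f := fun r => tangentJet g h J i j (m + 1) (γ r) (velocity γ r))
        (fun t ht => (d1 t ht).differentiableAt.differentiableWithinAt)
        (fun t ht => (d1 t ht).deriv.trans (hzero _ _ (hsp t ht))) ht h0
    set b := tangentJet g h J i j (m + 1) (γ 0) (velocity γ 0) with hb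
    have d2 : ∀ t ∈ Ioo (-1 : ℝ) 1, HasDerivAt
        (fun r => tangentJet g h J i j m (γ r) (velocity γ r) - r * b) 0 t := fun t ht => by
      have := (d0 t ht).sub ((hasDerivAt_id t).mul_const b)
      rw [e1 t ht, one_mul, sub_self] at this
      exact this
    have e2 := hs.is_const_of_deriv_eq_zero hs'
        (f := fun r => tangentJet g h J i j m (γ r) (velocity γ r) - r * b)
        (fun t ht => (d2 t ht).differentiableAt.differentiableWithinAt)
        (fun t ht => (d2 t ht).deriv) h12 h0
    refine ⟨γ (1 / 2), velocity γ (1 / 2), hsp _ h12, e1 _ h12, ?_⟩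
    simp only [zero_mul, sub_zero] at e2
    linarith
  have iter : ∀ N : ℕ, ∃ (x' : M) (v' : EuclideanSpace ℝ (Fin 2)), g x' v' v' = c ∧
      tangentJet g h J i j (m + 1) x' v' = tangentJet g h J i j (m + 1) x v ∧
      tangentJet g h J i j m x' v' =
        tangentJet g h J i j m x v + N * (1 / 2 * tangentJet g h J i j (m + 1) x v) := by
    intro N
    induction N with
    | zero => exact ⟨x, v, hv, rfl, by simp⟩
    | succ N ih =>
      obtain ⟨x', v', h1, h2, h3⟩ := ih
      obtain ⟨x'', v'', k1, k2, k3⟩ := step x' v' h1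
      refine ⟨x'', v'', k1, k2.trans h2, ?_⟩
      rw [k3, h3, h2]
      push_cast
      ring
  by_contra hb
  set b := tangentJet g h J i j (m + 1) x v with hbdef
  have hb0 : 0 < |b| := abs_pos.2 hb
  -- After `N` steps the jet of order `m` has moved by N|b|/2, which the bound limits to 2C.
  obtain ⟨N, hN⟩ := exists_nat_gt (4 * C / |b|)
  rw [div_lt_iff₀ hb0] at hN
  obtain ⟨x', v', h1, -, h3⟩ := iter N
  have b1 := hbdd x' v' h1
  have b0 := hbdd x v hv
  have : |(N : ℝ) * (1 / 2 * b)| ≤ C + C := by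
    have h4 : (N : ℝ) * (1 / 2 * b) =
        tangentJet g h J i j m x' v' - tangentJet g h J i j m x v := by rw [h3]; ring
    rw [h4]
    exact (abs_sub _ _).trans (add_le_add b1 b0)
  rw [abs_mul, abs_mul, Nat.abs_cast] at this
  norm_num at this
  linarith

end UnitJets

/-! ### From bounds on covariant derivatives to equality of connections -/

section Bounds

/-- For a scalar metric matrix the tensor norm is the Euclidean norm of the components up to a power
of √c. -/
theorem abs_le_tensorNorm {n m : ℕ} {c : ℝ} (hc : 0 < c) (T : (Fin m → Fin n) → ℝ)
    (b : Fin m → Fin n) :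
    |T b| ≤ √(c ^ m) * tensorNorm (c • (1 : Matrix (Fin n) (Fin n) ℝ)) T := by
  have hinv : (c • (1 : Matrix (Fin n) (Fin n) ℝ))⁻¹ = c⁻¹ • (1 : Matrix (Fin n) (Fin n) ℝ) := by
    refine Matrix.inv_eq_right_inv ?_
    rw [smul_mul_smul_comm, mul_inv_cancel₀ hc.ne', one_mul, one_smul]
  have hsum : ∑ a, ∑ b, (∏ s, (c • (1 : Matrix (Fin n) (Fin n) ℝ))⁻¹ (a s) (b s)) * T a * T b =
      (c ^ m)⁻¹ * ∑ a, T a ^ 2 := by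
    rw [hinv, Finset.mul_sum]
    refine Finset.sum_congr rfl fun a _ => ?_
    rw [Finset.sum_eq_single a]
    · simp [sq, mul_assoc]
    · intro b _ hba
      obtain ⟨s, hs⟩ := Function.ne_iff.1 hba
      rw [Finset.prod_eq_zero (Finset.mem_univ s), zero_mul, zero_mul]
      simp [Matrix.one_apply_ne hs.symm]
    · simp
  rw [tensorNorm, hsum, ← Real.sqrt_mul (by positivity), mul_inv_cancel_left₀ (by positivity)]
  refine Real.abs_le_sqrt ?_
  exact Finset.single_le_sum (f := fun a => T a ^ 2) (fun a _ => sq_nonneg _) (Finset.mem_univ b)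

variable {M : Type*} [TopologicalSpace M] [ChartedSpace (EuclideanSpace ℝ (Fin 2)) M]
  {e : OpenPartialHomeomorph M (EuclideanSpace ℝ (Fin 2))} {g h : BilinField 2 M}
  {J : EndField 2 M}

theorem tensorNorm_le_covDerivSup {k : ℕ} (hk : covDerivSup g h k ≠ ⊤) (he : e ∈ smoothCharts 2 M)
    {y : EuclideanSpace ℝ (Fin 2)} (hy : y ∈ e.target) :
    tensorNorm (coordMatrix g e y) (iterCovDeriv (coordMatrix g e)
        (fun z (a : Fin 2 → Fin 2) => coordMatrix h e z (a 0) (a 1)) k y) ≤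
      (covDerivSup g h k).toReal := by
  rw [← ENNReal.ofReal_le_iff_le_toReal hk]
  exact le_iSup₂_of_le e he (le_iSup₂_of_le y hy le_rfl)

theorem matrixForm_add_smul (A : Matrix (Fin 2) (Fin 2) ℝ) (a b a' b' : ℝ)
    (u v u' v' : EuclideanSpace ℝ (Fin 2)) :
    matrixForm A (a • u + b • v) (a' • u' + b' • v') =
      a * a' * matrixForm A u u' + a * b' * matrixForm A u v' + b * a' * matrixForm A v u'
        + b * b' * matrixForm A v v' := by
  simp only [matrixForm, Fin.sum_univ_two, PiLp.add_apply, PiLp.smul_apply, smul_eq_mul]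
  ring

/-- The linear isomorphism taking a basis `u, w` to the standard basis. -/
theorem exists_linearEquiv_symm_apply {A : Matrix (Fin 2) (Fin 2) ℝ}
    {u w : EuclideanSpace ℝ (Fin 2)} {c : ℝ} (hc : 0 < c) (huu : matrixForm A u u = c)
    (huw : matrixForm A u w = 0) (hwu : matrixForm A w u = 0) (hww : matrixForm A w w = c) :
    ∃ L : EuclideanSpace ℝ (Fin 2) ≃L[ℝ] EuclideanSpace ℝ (Fin 2),
      ∀ a, L.symm a = a 0 • u + a 1 • w := by
  let F : EuclideanSpace ℝ (Fin 2) →ₗ[ℝ] EuclideanSpace ℝ (Fin 2) :=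
    { toFun := fun a => a 0 • u + a 1 • w
      map_add' := fun a b => by simp only [PiLp.add_apply]; module
      map_smul' := fun r a => by
        simp only [PiLp.smul_apply, smul_eq_mul, RingHom.id_apply]; module }
  have hF : Function.Injective F := by
    rw [injective_iff_map_eq_zero]
    intro a ha
    have h1 : matrixForm A (a 0 • u + a 1 • w) (a 0 • u + a 1 • w) = 0 := by
      change matrixForm A (F a) (F a) = 0
      rw [ha]
      simp [matrixForm]
    rw [matrixForm_add_smul, huu, huw, hwu, hww] at h1
    have h2 : c * (a 0 ^ 2 + a 1 ^ 2) = 0 := by linear_combination h1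
    have h3 := (mul_eq_zero.1 h2).resolve_left hc.ne'
    have h4 : a 0 = 0 := by nlinarith [sq_nonneg (a 0), sq_nonneg (a 1)]
    have h5 : a 1 = 0 := by nlinarith [sq_nonneg (a 0), sq_nonneg (a 1)]
    ext i
    fin_cases i
    · exact h4
    · exact h5
  exact ⟨(LinearEquiv.ofInjectiveEndo F hF).toContinuousLinearEquiv.symm, fun a => rfl⟩

theorem coordMatrix_linearChart (B : BilinField 2 M) (he : e ∈ smoothCharts 2 M)
    {y : EuclideanSpace ℝ (Fin 2)} (hy : y ∈ e.target)
    (L : EuclideanSpace ℝ (Fin 2) ≃L[ℝ] EuclideanSpace ℝ (Fin 2)) (i j : Fin 2) :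
    coordMatrix B (linearChart e L) (L y) i j = matrixForm (coordMatrix B e y)
      (L.symm (EuclideanSpace.single i 1)) (L.symm (EuclideanSpace.single j 1)) := by
  rw [matrixForm_coordMatrix]
  have hx : (linearChart e L).symm (L y) = e.symm y := by simp [linearChart]
  change (B ((linearChart e L).symm (L y)) : EuclideanSpace ℝ (Fin 2) →L[ℝ] _ →L[ℝ] ℝ) _ _ = _
  rw [coordFrame_linearChart he hy, coordFrame_linearChart he hy]
  exact bilin_congr B hx _ _

variable [IsManifold (𝓡 2) ∞ M]

/-- The chart is adapted to the vector. When `v` and `J v` are the coordinate vectors at `x`, the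
metric matrix there is `c • 1` and the jet is a single component of ∇ᵐh. -/
theorem abs_tangentJet_le (hg : IsSmoothMetric g) (hJ : IsRightRotation g J)
    (hh : SmoothBilin h) {c : ℝ} (hc : 0 < c)
    (hgeo : ∀ (x : M) (v : EuclideanSpace ℝ (Fin 2)), g x v v = c →
      ∃ γ : ℝ → M, IsGeodesicOn g γ (Ioo (-1) 1) ∧ γ 0 = x ∧ velocity γ 0 = v)
    (i j : Fin 2) {m : ℕ} (hm : covDerivSup g h m ≠ ⊤)
    (x : M) (v : EuclideanSpace ℝ (Fin 2)) (hv : g x v v = c) :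
    |tangentJet g h J i j m x v| ≤ √(c ^ (2 + m)) * (covDerivSup g h m).toReal := by
  obtain ⟨γ, hγ, rfl, rfl⟩ := hgeo x v hv
  have hs : IsOpen (Ioo (-1 : ℝ) 1) := isOpen_Ioo
  have h0 : (0 : ℝ) ∈ Ioo (-1 : ℝ) 1 := by norm_num
  have hne : ∀ t ∈ Ioo (-1 : ℝ) 1, velocity (n := 2) γ t ≠ 0 := fun t ht =>
    velocity_ne_zero hg hγ hs isPreconnected_Ioo h0 (by rw [hv]; exact hc) ht
  set e := chartAt (EuclideanSpace ℝ (Fin 2)) (γ 0) with he'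
  have he : e ∈ smoothCharts 2 M := IsManifold.chart_mem_maximalAtlas _
  have hx : γ 0 ∈ e.source := mem_chart_source _ _
  set y := e (γ 0) with hy'
  have hy : y ∈ e.target := e.map_source hx
  set u := deriv (e ∘ γ) 0 with hu
  have hmd := hγ.mdifferentiableAt hs h0
  have hform := fun i j => matrixForm_rotFrame (J := J) he hmd hx g i j
  have c00 : curveComponent g J γ 0 0 0 = c := hv
  have c01 : curveComponent g J γ 0 1 0 = 0 := hJ.orth _ _
  have c10 : curveComponent g J γ 1 0 0 = 0 := (hg.symm _ _ _).trans c01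
  have c11 : curveComponent g J γ 1 1 0 = c := (hJ.norm_eq _ _).trans hv
  obtain ⟨L, hL⟩ := exists_linearEquiv_symm_apply (A := coordMatrix g e y)
    (u := rotFrame J e y u 0) (w := rotFrame J e y u 1) hc ((hform 0 0).trans c00)
    ((hform 0 1).trans c01) ((hform 1 0).trans c10) ((hform 1 1).trans c11)
  have hL' : ∀ i, L.symm (EuclideanSpace.single i 1) = rotFrame J e y u i := fun i => by
    rw [hL]
    fin_cases i <;> simp
  set e' := linearChart e L with hee
  have he'' : e' ∈ smoothCharts 2 M := linearChart_mem he L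
  have hx' : γ 0 ∈ e'.source := by rw [linearChart_source]; exact hx
  have hey : e' (γ 0) = L y := rfl
  have hmat : coordMatrix g e' (L y) = c • (1 : Matrix (Fin 2) (Fin 2) ℝ) := by
    ext i j
    rw [coordMatrix_linearChart g he hy, hL', hL']
    refine (hform i j).trans ?_
    fin_cases i <;> fin_cases j
    · simpa using c00
    · simpa using c01
    · simpa using c10
    · simpa using c11
  have hframe : ∀ i, rotFrame J e' (e' (γ 0)) (deriv (e' ∘ γ) 0) i = EuclideanSpace.single i 1 := by
    intro i
    have h1 := coordFrame_rotFrame (J := J) he'' hmd hx' i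
    have h2 := coordFrame_rotFrame (J := J) he hmd hx i
    have h3 := coordFrame_linearChart he hy L (EuclideanSpace.single i 1)
    rw [hL'] at h3
    have h4 := (h3.trans h2).trans h1.symm
    have h5 := congrArg (coordCoframe e' (e' (γ 0))) h4
    rw [coordCoframe_coordFrame he'' (e'.map_source hx')] at h5
    refine h5.symm.trans ?_
    exact coordCoframe_coordFrame he'' (e'.map_source hx') _
  -- The passage to the adapted chart: both jets are the same iterated derivative of a component
  -- along `γ`.
  have key : tangentJet g h J i j m (γ 0) (velocity γ 0) =
      frameJet g h J e' i j m (e' (γ 0)) (deriv (e' ∘ γ) 0) := by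
    rw [tangentJet_eq_iteratedDeriv hg hJ hh hγ hs hne i j m h0,
      iteratedDeriv_curveComponent hg hJ hh hγ hs hne he'' i j m 0 h0 hx']
  have hslots : ∀ k, ∃ b : Fin (2 + k) → Fin 2,
      slots (deriv (e' ∘ γ) 0) (rotFrame J e' (e' (γ 0)) (deriv (e' ∘ γ) 0) i)
        (rotFrame J e' (e' (γ 0)) (deriv (e' ∘ γ) 0) j) k =
      fun s => EuclideanSpace.single (b s) 1 := by
    intro k
    rw [hframe, hframe]
    induction k with
    | zero =>
      refine ⟨![i, j], ?_⟩
      funext s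
      fin_cases s <;> rfl
    | succ k ih =>
      obtain ⟨b, hb⟩ := ih
      refine ⟨(Fin.cons 0 b : Fin (2 + k + 1) → Fin 2), ?_⟩
      funext s
      refine Fin.cases ?_ (fun s => ?_) s
      · exact hframe 0
      · exact congrFun hb s
  obtain ⟨b, hb⟩ := hslots m
  rw [key, frameJet, hb, contract_single]
  refine (abs_le_tensorNorm hc _ b).trans (mul_le_mul_of_nonneg_left ?_ (Real.sqrt_nonneg _))
  rw [← hmat]
  exact tensorNorm_le_covDerivSup hm he'' (e'.map_source hx')

/-- Descending induction on the order, each step being `tangentJet_eq_zero_of_bounded`. It ends at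
order one: the bound at order zero rules out a nonzero constant slope. -/
theorem tangentJet_one_eq_zero (hg : IsSmoothMetric g) (hJ : IsRightRotation g J)
    (hh : SmoothBilin h) {c : ℝ} (hc : 0 < c)
    (hgeo : ∀ (x : M) (v : EuclideanSpace ℝ (Fin 2)), g x v v = c →
      ∃ γ : ℝ → M, IsGeodesicOn g γ (Ioo (-1) 1) ∧ γ 0 = x ∧ velocity γ 0 = v)
    (hfin : ∀ k, covDerivSup g h k ≠ ⊤) {N : ℕ} (hN : ∀ k ≥ N, covDerivSup g h k = 0)
    (i j : Fin 2) (x : M) (v : EuclideanSpace ℝ (Fin 2)) (hv : g x v v = c) :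
    tangentJet g h J i j 1 x v = 0 := by
  have hlarge : ∀ m ≥ N, ∀ (x : M) (v : EuclideanSpace ℝ (Fin 2)), g x v v = c →
      tangentJet g h J i j m x v = 0 := fun m hm x v hv => by
    have := abs_tangentJet_le hg hJ hh hc hgeo i j (hfin m) x v hv
    rw [hN m hm, ENNReal.toReal_zero, mul_zero] at this
    exact abs_nonpos_iff.1 this
  -- `k` counts the steps down from order `N + 1`; the bound `k ≤ N` keeps the truncated subtraction
  -- exact, and `k = N` is order one.
  have hdesc : ∀ k ≤ N, ∀ (x : M) (v : EuclideanSpace ℝ (Fin 2)), g x v v = c →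
      tangentJet g h J i j (N - k + 1) x v = 0 := by
    intro k
    induction k with
    | zero => exact fun _ => hlarge _ (by simp)
    | succ k ih =>
      intro hk
      have h1 : N - (k + 1) + 2 = N - k + 1 := by omega
      refine tangentJet_eq_zero_of_bounded hg hJ hh hc hgeo i j (N - (k + 1))
        (fun x v hv => abs_tangentJet_le hg hJ hh hc hgeo i j (hfin _) x v hv) ?_
      rw [h1]
      exact ih (by omega)
  have := hdesc N le_rfl x v hv
  rwa [Nat.sub_self] at this

theorem contract_cons_two (T : (Fin 3 → Fin 2) → ℝ) (u v w : EuclideanSpace ℝ (Fin 2)) :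
    contract T (Fin.cons u ![v, w] : Fin 3 → EuclideanSpace ℝ (Fin 2)) =
      matrixForm (Matrix.of fun i j => ∑ k, T ![k, i, j] * u k) v w := by
  rw [← contract_two]
  unfold contract
  rw [sum_fin_cons]
  refine Finset.sum_congr rfl fun b _ => ?_
  change _ = (∑ k, T ![k, b 0, b 1] * u k) * ∏ s, (![v, w] : Fin 2 → _) s (b s)
  rw [Finset.sum_mul]
  refine Finset.sum_congr rfl fun k _ => ?_
  have hb : (Fin.cons k b : Fin 3 → Fin 2) = ![k, b 0, b 1] := by
    funext s; fin_cases s <;> rfl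
  rw [hb, Fin.prod_univ_succ, mul_assoc]
  congr 2

/-- The jets determine ∇h(u, ·, ·) only on the frame u, Ju and only for g(u,u) = c. A coordinate
vector is rescaled to have this length; its frame is a basis, so the whole bilinear form ∇h(u, ·, ·)
vanishes. -/
theorem covDeriv_eq_zero (hg : IsSmoothMetric g) (hJ : IsRightRotation g J)
    (hh : SmoothBilin h) (hinj : 0 < ⨅ x, injRadius g x)
    (hfin : ∀ k, covDerivSup g h k ≠ ⊤) {N : ℕ} (hN : ∀ k ≥ N, covDerivSup g h k = 0)
    (he : e ∈ smoothCharts 2 M) {y : EuclideanSpace ℝ (Fin 2)} (hy : y ∈ e.target)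
    (a : Fin 3 → Fin 2) :
    covDeriv (coordMatrix g e) (fun z (a : Fin 2 → Fin 2) => coordMatrix h e z (a 0) (a 1)) y a
      = 0 := by
  obtain ⟨c, hc, hgeo⟩ := exists_geodesic_of_injRadius hinj
  set T := covDeriv (coordMatrix g e)
    (fun z (a : Fin 2 → Fin 2) => coordMatrix h e z (a 0) (a 1)) y with hT
  have hpos := hg.matrixForm_pos he hy (EuclideanSpace.single (a 0) 1) (by simp)
  set ν := matrixForm (coordMatrix g e y) (EuclideanSpace.single (a 0) 1)
    (EuclideanSpace.single (a 0) 1) with hν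
  set ρ : ℝ := √(c / ν) with hρ
  have hρ0 : 0 < ρ := Real.sqrt_pos.2 (by positivity)
  set u₀ : EuclideanSpace ℝ (Fin 2) := ρ • EuclideanSpace.single (a 0) 1 with hu₀
  have hnorm : g (e.symm y) (coordFrame e y u₀) (coordFrame e y u₀) = c := by
    rw [← matrixForm_coordMatrix]
    have := matrixForm_add_smul (coordMatrix g e y) ρ 0 ρ 0 (EuclideanSpace.single (a 0) 1) 0
      (EuclideanSpace.single (a 0) 1) 0
    simp only [smul_zero, add_zero, zero_mul, mul_zero] at this
    rw [hu₀, this, ← hν, Real.mul_self_sqrt (by positivity), div_mul_cancel₀ _ hpos.ne']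
  obtain ⟨γ, hγ, hγ0, hγv⟩ := hgeo _ _ hnorm
  have hs : IsOpen (Ioo (-1 : ℝ) 1) := isOpen_Ioo
  have h0 : (0 : ℝ) ∈ Ioo (-1 : ℝ) 1 := by norm_num
  have hnorm' : g (γ 0) (velocity γ 0) (velocity γ 0) = c := by
    rw [hγv]
    exact (bilin_congr g hγ0 _ _).trans hnorm
  have hne : ∀ t ∈ Ioo (-1 : ℝ) 1, velocity (n := 2) γ t ≠ 0 := fun t ht =>
    velocity_ne_zero hg hγ hs isPreconnected_Ioo h0 (by rw [hnorm']; exact hc) ht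
  have hx : γ 0 ∈ e.source := by rw [hγ0]; exact e.map_target hy
  have hyγ : e (γ 0) = y := by rw [hγ0]; exact e.right_inv hy
  have hmd := hγ.mdifferentiableAt hs h0
  have hu : deriv (e ∘ γ) 0 = u₀ := by
    rw [(hasDerivAt_chart_comp he hmd hx).deriv, hγv, hyγ]
    exact coordCoframe_coordFrame he hy _
  have hjet : ∀ i j, frameJet g h J e i j 1 y u₀ = 0 := fun i j => by
    rw [← hu, ← hyγ, ← iteratedDeriv_curveComponent hg hJ hh hγ hs hne he i j 1 0 h0 hx,
      ← tangentJet_eq_iteratedDeriv hg hJ hh hγ hs hne i j 1 h0]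
    exact tangentJet_one_eq_zero hg hJ hh hc hgeo hfin hN i j _ _ hnorm'
  have hform := fun i j => matrixForm_rotFrame (J := J) he hmd hx g i j
  rw [hyγ, hu] at hform
  have c01 : curveComponent g J γ 0 1 0 = 0 := hJ.orth _ _
  obtain ⟨L, hL⟩ := exists_linearEquiv_symm_apply (A := coordMatrix g e y)
    (u := rotFrame J e y u₀ 0) (w := rotFrame J e y u₀ 1) hc ((hform 0 0).trans hnorm')
    ((hform 0 1).trans c01) ((hform 1 0).trans ((hg.symm _ _ _).trans c01))
    ((hform 1 1).trans ((hJ.norm_eq _ _).trans hnorm'))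
  set A : Matrix (Fin 2) (Fin 2) ℝ := Matrix.of fun i j => ∑ k, T ![k, i, j] * u₀ k with hA
  have hAF : ∀ i j, matrixForm A (rotFrame J e y u₀ i) (rotFrame J e y u₀ j) = 0 := fun i j => by
    rw [← hjet i j, hA, ← contract_cons_two]
    rfl
  have hAv : ∀ v w, matrixForm A v w = 0 := fun v w => by
    rw [← L.symm_apply_apply v, ← L.symm_apply_apply w, hL, hL, matrixForm_add_smul]
    simp only [hAF, mul_zero, add_zero]
  have hA0 : A (a 1) (a 2) = 0 := by
    rw [← hAv (EuclideanSpace.single (a 1) 1) (EuclideanSpace.single (a 2) 1)]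
    simp [matrixForm]
  have ha : ![a 0, a 1, a 2] = a := by
    funext s; fin_cases s <;> rfl
  simp only [hA, Matrix.of_apply, hu₀, PiLp.smul_apply, smul_eq_mul] at hA0
  rw [Finset.sum_eq_single (a 0) (fun k _ hk => by simp [hk]) (by simp), ha] at hA0
  simpa [hρ0.ne'] using hA0

/-- Two metrics whose difference has uniformly bounded covariant derivatives that vanish from some
order on have the same Levi-Civita connection, provided that the injectivity radius is bounded away
from zero. -/
theorem christoffel_eq_of_covDerivSup {g' : BilinField 2 M} (hg : IsSmoothMetric g)
    (hJ : IsRightRotation g J) (hg' : IsSmoothMetric g') (hinj : 0 < ⨅ x, injRadius g x)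
    (hfin : ∀ k, covDerivSup g (g' - g) k ≠ ⊤) {N : ℕ}
    (hN : ∀ k ≥ N, covDerivSup g (g' - g) k = 0)
    (he : e ∈ smoothCharts 2 M) {y : EuclideanSpace ℝ (Fin 2)} (hy : y ∈ e.target)
    (k i j : Fin 2) :
    christoffel (coordMatrix g' e) k i j y = christoffel (coordMatrix g e) k i j y := by
  have hsub : ∀ e y i j, coordMatrix (g' - g) e y i j =
    coordMatrix g' e y i j - coordMatrix g e y i j := fun _ _ _ _ => rfl
  have hh : SmoothBilin (g' - g) := fun e he i j => (hg'.smooth e he i j).sub (hg.smooth e he i j)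
  have hd : ∀ {B : BilinField 2 M}, SmoothBilin B → ∀ i j,
      DifferentiableAt ℝ (fun z => coordMatrix B e z i j) y := fun hB i j =>
    ((hB e he i j).contDiffAt (e.open_target.mem_nhds hy)).differentiableAt (by simp)
  have hpar := partialDeriv_eq_of_covDeriv_eq_zero (G := coordMatrix g e)
    (H := coordMatrix (g' - g) e) (y := y) (covDeriv_eq_zero hg hJ hh hinj hfin hN he hy)
  refine christoffel_eq_of_compatible (.of_forall (isSymm_coordMatrix hg.symm e))
    (.of_forall (isSymm_coordMatrix hg'.symm e)) (hg'.det_ne_zero he hy) (fun i j l => ?_) k i j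
  -- Both `g' - g` and `g` are parallel for the connection of `g`, hence so is `g'`, and uniqueness
  -- of the compatible symmetric connection applies.
  have h1 := hpar i j l
  have h2 := partialDeriv_metric (.of_forall (isSymm_coordMatrix hg.symm e))
    (hg.det_ne_zero he hy) i j l
  have h3 : partialDeriv i (fun z => coordMatrix (g' - g) e z j l) y =
      partialDeriv i (fun z => coordMatrix g' e z j l) y -
        partialDeriv i (fun z => coordMatrix g e z j l) y := by
    simp only [partialDeriv, hsub]
    rw [fderiv_fun_sub (hd hg'.smooth j l) (hd hg.smooth j l)]
    rfl
  rw [h3] at h1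
  simp only [hsub, mul_sub, Finset.sum_sub_distrib] at h1
  linarith

end Bounds

/-! ### Pullbacks of tensor fields by diffeomorphisms -/

section Pullback

variable {n : ℕ} {M : Type*} [TopologicalSpace M] [ChartedSpace (EuclideanSpace ℝ (Fin n)) M]

/-- The differential of a diffeomorphism, as a linear map of the model space. -/
noncomputable def diffeoDeriv (φ : M ≃ₘ⟮𝓡 n, 𝓡 n⟯ M) (x : M) :
    EuclideanSpace ℝ (Fin n) →L[ℝ] EuclideanSpace ℝ (Fin n) :=
  mfderiv (𝓡 n) (𝓡 n) φ x

theorem Diffeomorph.mdifferentiableAt_top (φ : M ≃ₘ⟮𝓡 n, 𝓡 n⟯ M) (x : M) :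
    MDifferentiableAt (𝓡 n) (𝓡 n) φ x :=
  φ.mdifferentiable (by simp) x

theorem diffeoDeriv_symm_apply (φ : M ≃ₘ⟮𝓡 n, 𝓡 n⟯ M) (x : M) (v : EuclideanSpace ℝ (Fin n)) :
    diffeoDeriv φ.symm (φ x) (diffeoDeriv φ x v) = v := by
  have h1 := mfderiv_comp x (φ.symm.mdifferentiableAt_top (φ x)) (φ.mdifferentiableAt_top x)
  have h2 : (φ.symm ∘ φ : M → M) = id := funext φ.symm_apply_apply
  rw [h2, mfderiv_id] at h1
  exact (congrArg (fun L : EuclideanSpace ℝ (Fin n) →L[ℝ] EuclideanSpace ℝ (Fin n) => L v) h1).symm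

theorem diffeoDeriv_apply_symm (φ : M ≃ₘ⟮𝓡 n, 𝓡 n⟯ M) (x : M) (v : EuclideanSpace ℝ (Fin n)) :
    diffeoDeriv φ x (diffeoDeriv φ.symm (φ x) v) = v := by
  have h := diffeoDeriv_symm_apply φ.symm (φ x) v
  have h' : φ.symm (φ x) = x := φ.symm_apply_apply x
  rw [h'] at h
  exact h

theorem diffeoDeriv_ne_zero (φ : M ≃ₘ⟮𝓡 n, 𝓡 n⟯ M) (x : M) {v : EuclideanSpace ℝ (Fin n)}
    (hv : v ≠ 0) : diffeoDeriv φ x v ≠ 0 := fun h => hv <| by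
  rw [← diffeoDeriv_symm_apply φ x v, h, map_zero]

/-- The value of a field of bilinear forms, on the model space. -/
def bilinAt (B : BilinField n M) (x : M) :
    EuclideanSpace ℝ (Fin n) →L[ℝ] EuclideanSpace ℝ (Fin n) →L[ℝ] ℝ := B x

/-- The value of a field of endomorphisms, on the model space. -/
def endAt (J : EndField n M) (x : M) : EuclideanSpace ℝ (Fin n) →L[ℝ] EuclideanSpace ℝ (Fin n) :=
  J x

/-- The pullback of a field of bilinear forms by a diffeomorphism. -/
noncomputable def pullBilin (φ : M ≃ₘ⟮𝓡 n, 𝓡 n⟯ M) (B : BilinField n M) : BilinField n M := fun x =>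
  (bilinAt B (φ x)).bilinearComp (diffeoDeriv φ x) (diffeoDeriv φ x)

/-- The pullback of a field of endomorphisms by a diffeomorphism. -/
noncomputable def pullEnd (φ : M ≃ₘ⟮𝓡 n, 𝓡 n⟯ M) (J : EndField n M) : EndField n M := fun x =>
  (diffeoDeriv φ.symm (φ x)).comp ((endAt J (φ x)).comp (diffeoDeriv φ x))

theorem bilinAt_pullBilin (φ : M ≃ₘ⟮𝓡 n, 𝓡 n⟯ M) (B : BilinField n M) (x : M)
    (v w : EuclideanSpace ℝ (Fin n)) :
    bilinAt (pullBilin φ B) x v w = bilinAt B (φ x) (diffeoDeriv φ x v) (diffeoDeriv φ x w) := rfl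

theorem endAt_pullEnd (φ : M ≃ₘ⟮𝓡 n, 𝓡 n⟯ M) (J : EndField n M) (x : M)
    (v : EuclideanSpace ℝ (Fin n)) :
    endAt (pullEnd φ J) x v = diffeoDeriv φ.symm (φ x) (endAt J (φ x) (diffeoDeriv φ x v)) := rfl

theorem bilinField_ext {B B' : BilinField n M}
    (h : ∀ x v w, bilinAt B x v w = bilinAt B' x v w) : B = B' :=
  funext fun x => ContinuousLinearMap.ext fun v => ContinuousLinearMap.ext fun w => h x v w

theorem pullBilin_symm_pullBilin (φ : M ≃ₘ⟮𝓡 n, 𝓡 n⟯ M) (B : BilinField n M) :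
    pullBilin φ.symm (pullBilin φ B) = B := by
  refine bilinField_ext fun x v w => ?_
  have e1 : ∀ v, diffeoDeriv φ (φ.symm x) (diffeoDeriv φ.symm x v) = v :=
    diffeoDeriv_symm_apply φ.symm x
  rw [bilinAt_pullBilin, bilinAt_pullBilin, e1, e1, φ.apply_symm_apply]

/-- The chart `e ∘ φ⁻¹`. -/
noncomputable def pushChart (φ : M ≃ₘ⟮𝓡 n, 𝓡 n⟯ M)
    (e : OpenPartialHomeomorph M (EuclideanSpace ℝ (Fin n))) :
    OpenPartialHomeomorph M (EuclideanSpace ℝ (Fin n)) :=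
  φ.symm.toHomeomorph.toOpenPartialHomeomorph.trans e

variable {e : OpenPartialHomeomorph M (EuclideanSpace ℝ (Fin n))} (φ : M ≃ₘ⟮𝓡 n, 𝓡 n⟯ M)

theorem pushChart_target : (pushChart φ e).target = e.target := by
  simp [pushChart]

theorem pushChart_mem [IsManifold (𝓡 n) ∞ M] (he : e ∈ smoothCharts n M) :
    pushChart φ e ∈ smoothCharts n M := by
  refine OpenPartialHomeomorph.mem_maximalAtlas_of_contMDiffOn _ ?_ ?_
  · refine (contMDiffOn_of_mem_maximalAtlas he).comp (φ.symm.contMDiff.contMDiffOn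
      (s := (pushChart φ e).source)) fun x hx => ?_
    simpa [pushChart] using hx
  · rw [pushChart_target]
    exact φ.contMDiff.comp_contMDiffOn (contMDiffOn_symm_of_mem_maximalAtlas he)

/-- The chain rule where `e.symm` is differentiable. Elsewhere both sides are zero by the default
value of `mfderiv`, so no condition on `y` is needed. -/
theorem coordFrame_pushChart (e : OpenPartialHomeomorph M (EuclideanSpace ℝ (Fin n)))
    (y v : EuclideanSpace ℝ (Fin n)) :
    (coordFrame (pushChart φ e) y v : EuclideanSpace ℝ (Fin n)) =
      diffeoDeriv φ (e.symm y) (coordFrame e y v) := by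
  by_cases h : MDifferentiableAt 𝓘(ℝ, EuclideanSpace ℝ (Fin n)) (𝓡 n) e.symm y
  · have h1 := mfderiv_comp y (φ.mdifferentiableAt_top (e.symm y)) h
    exact congrArg (fun L : EuclideanSpace ℝ (Fin n) →L[ℝ] EuclideanSpace ℝ (Fin n) => L v) h1
  · have h' : ¬ MDifferentiableAt 𝓘(ℝ, EuclideanSpace ℝ (Fin n)) (𝓡 n) (φ ∘ e.symm) y := by
      intro h2
      apply h
      have h3 := (φ.symm.mdifferentiableAt_top (φ (e.symm y))).comp y h2
      have h4 : (φ.symm ∘ φ ∘ e.symm : EuclideanSpace ℝ (Fin n) → M) = e.symm :=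
        funext fun z => φ.symm_apply_apply _
      rwa [h4] at h3
    have h1 : (coordFrame (pushChart φ e) y :
        EuclideanSpace ℝ (Fin n) →L[ℝ] EuclideanSpace ℝ (Fin n)) = 0 :=
      mfderiv_zero_of_not_mdifferentiableAt h'
    have h2 : (coordFrame e y : EuclideanSpace ℝ (Fin n) →L[ℝ] EuclideanSpace ℝ (Fin n)) = 0 :=
      mfderiv_zero_of_not_mdifferentiableAt h
    refine (congrArg (fun L : EuclideanSpace ℝ (Fin n) →L[ℝ] EuclideanSpace ℝ (Fin n) => L v)
      h1).trans ?_
    have h3 := congrArg (fun L : EuclideanSpace ℝ (Fin n) →L[ℝ] EuclideanSpace ℝ (Fin n) =>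
      diffeoDeriv φ (e.symm y) (L v)) h2
    refine Eq.trans ?_ h3.symm
    change (0 : EuclideanSpace ℝ (Fin n)) = diffeoDeriv φ (e.symm y) 0
    rw [map_zero]

/-- Pulling back the field amounts to pushing the chart forward. As an equality of functions on all
of ℝⁿ, this transfers everything computed from the coefficients (Christoffel symbols, curvature and
its covariant derivatives) by mere rewriting. -/
theorem coordMatrix_pullBilin (B : BilinField n M)
    (e : OpenPartialHomeomorph M (EuclideanSpace ℝ (Fin n))) :
    coordMatrix (pullBilin φ B) e = coordMatrix B (pushChart φ e) := by
  funext y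
  ext i j
  change B (φ (e.symm y)) (diffeoDeriv φ (e.symm y) (coordFrame e y _))
    (diffeoDeriv φ (e.symm y) (coordFrame e y _)) =
    B (φ (e.symm y)) (coordFrame (pushChart φ e) y _) (coordFrame (pushChart φ e) y _)
  rw [← coordFrame_pushChart, ← coordFrame_pushChart]

theorem coordEnd_pullEnd (he : e ∈ smoothCharts n M) {y : EuclideanSpace ℝ (Fin n)}
    (hy : y ∈ e.target) (J : EndField n M) :
    coordEnd (pullEnd φ J) e y = coordEnd J (pushChart φ e) y := by
  refine ContinuousLinearMap.ext fun v => ?_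
  have h0 : φ.symm (φ (e.symm y)) = e.symm y := φ.symm_apply_apply _
  have h1 := mfderiv_comp (φ (e.symm y)) (g := e) (f := φ.symm)
    (by rw [h0]; exact mdifferentiableAt_chart he (e.map_target hy))
    (φ.symm.mdifferentiableAt_top _)
  have h2 : ∀ w, (coordCoframe (pushChart φ e) y w : EuclideanSpace ℝ (Fin n)) =
      coordCoframe e y (diffeoDeriv φ.symm (φ (e.symm y)) w) := fun w => by
    refine (congrArg (fun L : EuclideanSpace ℝ (Fin n) →L[ℝ] EuclideanSpace ℝ (Fin n) => L w)
      h1).trans ?_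
    exact congrArg (fun x => chartDeriv e x (diffeoDeriv φ.symm (φ (e.symm y)) w)) h0
  change coordCoframe e y (diffeoDeriv φ.symm (φ (e.symm y)) (J (φ (e.symm y))
    (diffeoDeriv φ (e.symm y) (coordFrame e y v)))) =
    coordCoframe (pushChart φ e) y (J (φ (e.symm y)) (coordFrame (pushChart φ e) y v))
  rw [← coordFrame_pushChart]
  exact (h2 _).symm

/-! ## Isometries preserve tameness -/

theorem IsSmoothMetric.pull [IsManifold (𝓡 n) ∞ M] {g : BilinField n M}
    (hg : IsSmoothMetric g) : IsSmoothMetric (pullBilin φ g) where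
  smooth e he i j := by
    rw [coordMatrix_pullBilin, ← pushChart_target φ]
    exact hg.smooth _ (pushChart_mem φ he) i j
  symm x v w := hg.symm (φ x) (diffeoDeriv φ x v) (diffeoDeriv φ x w)
  pos x v hv := hg.pos (φ x) (diffeoDeriv φ x v) (diffeoDeriv_ne_zero φ x hv)

/-- The image of a path under φ has the `g`-length that the path has for the pulled-back metric. The
reverse inequality is the same statement for `φ.symm`. -/
theorem metricEDist_map_le (g : BilinField n M) (x y : M) :
    metricEDist g (φ x) (φ y) ≤ metricEDist (pullBilin φ g) x y := by
  unfold metricEDist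
  rw [Manifold.riemannianEDist, Manifold.riemannianEDist]
  refine le_iInf₂ fun γ hγ => ?_
  refine iInf₂_le_of_le (γ.map φ.continuous) ((φ.contMDiff.of_le (by simp)).comp hγ) (le_of_eq ?_)
  refine lintegral_congr fun t => ?_
  have h1 := mfderiv_comp t (φ.mdifferentiableAt_top (γ t))
    (hγ.mdifferentiableAt (x := t) one_ne_zero)
  change ENNReal.ofReal √(g (φ (γ t)) (mfderiv (𝓡∂ 1) (𝓡 n) (φ ∘ γ) t 1)
    (mfderiv (𝓡∂ 1) (𝓡 n) (φ ∘ γ) t 1)) = _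
  rw [h1]
  rfl

theorem metricEDist_pullBilin (g : BilinField n M) (x y : M) :
    metricEDist (pullBilin φ g) x y = metricEDist g (φ x) (φ y) := by
  refine le_antisymm ?_ (metricEDist_map_le φ g x y)
  have h := metricEDist_map_le φ.symm (pullBilin φ g) (φ x) (φ y)
  rwa [pullBilin_symm_pullBilin, φ.symm_apply_apply, φ.symm_apply_apply] at h

theorem IsCompleteMetric.pull {g : BilinField n M} (hg : IsCompleteMetric g) :
    IsCompleteMetric (pullBilin φ g) := by
  intro u hu
  simp only [metricEDist_pullBilin] at hu ⊢
  obtain ⟨x, hx⟩ := hg (φ ∘ u) hu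
  refine ⟨φ.symm x, ?_⟩
  rw [φ.apply_symm_apply]
  exact hx

theorem IsGeodesicOn.pull [IsManifold (𝓡 n) ∞ M] {g : BilinField n M} {γ : ℝ → M} {s : Set ℝ}
    (hγ : IsGeodesicOn g γ s) : IsGeodesicOn (pullBilin φ g) (φ.symm ∘ γ) s := by
  refine ⟨φ.symm.contMDiff.comp_contMDiffOn hγ.1, fun e he t ht hte k => ?_⟩
  rw [coordMatrix_pullBilin]
  exact hγ.2 (pushChart φ e) (pushChart_mem φ he) t ht (by simpa [pushChart] using hte) k

theorem isOpen_smul_mem_tangentBall (g : BilinField n M) (x : M) (r : ℝ)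
    (v : EuclideanSpace ℝ (Fin n)) : IsOpen {t : ℝ | t • v ∈ tangentBall g x r} := by
  have : {t : ℝ | t • v ∈ tangentBall g x r} = {t : ℝ | √(t ^ 2 * g x v v) < r} := by
    ext t
    change √(g x (t • v) (t • v)) < r ↔ _
    rw [bilin_smul_smul]
    rfl
  rw [this]
  exact isOpen_lt (by fun_prop) continuous_const

/-- If `E` is the exponential map of `g` at `φ x`, then φ⁻¹ ∘ E ∘ dφ is that of the pulled-back
metric at `x`, on a ball of the same radius. -/
theorem injRadius_le_pullBilin [IsManifold (𝓡 n) ∞ M] (g : BilinField n M) (x : M) :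
    injRadius g (φ x) ≤ injRadius (pullBilin φ g) x := by
  refine iSup₂_le fun r ⟨hr, E, hE, hinj, hloc⟩ => ?_
  set d := diffeoDeriv φ x with hd
  have hd' : ∀ v, diffeoDeriv φ.symm (φ x) (d v) = v := diffeoDeriv_symm_apply φ x
  refine le_iSup₂_of_le r ⟨hr, fun v => φ.symm (E (d v)), ⟨?_, fun v hv => ⟨?_, ?_⟩⟩, ?_, ?_⟩ le_rfl
  · change φ.symm (E (d 0)) = x
    rw [map_zero, hE.1, φ.symm_apply_apply]
  · have h1 := (hE.2 (d v) hv).1.pull φ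
    have h2 : (fun t : ℝ => φ.symm (E (d (t • v)))) = φ.symm ∘ fun t : ℝ => E (t • d v) :=
      funext fun t => congrArg (fun w => φ.symm (E w)) (map_smul d t _)
    have h3 : {t : ℝ | t • v ∈ tangentBall (pullBilin φ g) x r} =
        {t : ℝ | t • d v ∈ tangentBall g (φ x) r} := by
      ext t
      exact iff_of_eq (congrArg (fun w : EuclideanSpace ℝ (Fin n) => w ∈ tangentBall g (φ x) r)
        (map_smul d t _))
    exact (congrArg₂ (fun f s => IsGeodesicOn (pullBilin φ g) f s) h2 h3).mpr h1
  · have h1 := hE.2 (d v) hv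
    have h2 : (fun t : ℝ => φ.symm (E (d (t • v)))) = φ.symm ∘ fun t : ℝ => E (t • d v) :=
      funext fun t => congrArg (fun w => φ.symm (E w)) (map_smul d t _)
    have hopen := isOpen_smul_mem_tangentBall g (φ x) r (d v)
    have h00 : (0 : ℝ) ∈ {t : ℝ | t • d v ∈ tangentBall g (φ x) r} := by
      change √(g (φ x) ((0 : ℝ) • d v) ((0 : ℝ) • d v)) < r
      rw [bilin_smul_smul]
      simpa using hr
    have h3 := h1.1.mdifferentiableAt hopen h00
    have h4 := mfderiv_comp (0 : ℝ) (φ.symm.mdifferentiableAt_top (E ((0 : ℝ) • d v))) h3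
    have h5 : E ((0 : ℝ) • d v) = φ x := by rw [zero_smul]; exact hE.1
    change velocity (fun t : ℝ => φ.symm (E (d (t • v)))) 0 = v
    rw [h2]
    refine (congrArg (fun L : ℝ →L[ℝ] EuclideanSpace ℝ (Fin n) => L 1) h4).trans ?_
    change diffeoDeriv φ.symm (E ((0 : ℝ) • d v)) (velocity (fun t : ℝ => E (t • d v)) 0) = v
    rw [h5]
    exact (congrArg (diffeoDeriv φ.symm (φ x)) h1.2).trans (hd' v)
  · intro v hv w hw hvw
    have h1 : d v = d w := hinj hv hw (φ.symm.injective hvw)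
    rw [← hd' v, h1, hd']
  · intro v
    let D : EuclideanSpace ℝ (Fin n) ≃L[ℝ] EuclideanSpace ℝ (Fin n) :=
      ContinuousLinearEquiv.equivOfInverse d (diffeoDeriv φ.symm (φ x)) hd'
        (diffeoDeriv_apply_symm φ x)
    have h1 : IsLocalDiffeomorphAt 𝓘(ℝ, EuclideanSpace ℝ (Fin n)) 𝓘(ℝ, EuclideanSpace ℝ (Fin n)) ∞
        d v.1 := D.toDiffeomorph.isLocalDiffeomorph v.1
    have h2 := hloc ⟨d v.1, v.2⟩
    have h3 := φ.symm.isLocalDiffeomorph (E (d v.1))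
    exact (h1.comp (𝓡 n) M h2).comp (𝓡 n) M h3

theorem IsTameMetric.pull [IsManifold (𝓡 n) ∞ M] {g : BilinField n M} (hg : IsTameMetric g) :
    IsTameMetric (pullBilin φ g) where
  isMetric := hg.isMetric.pull φ
  complete := hg.complete.pull φ
  inj := hg.inj.trans_le (le_iInf fun x => (iInf_le _ (φ x)).trans (injRadius_le_pullBilin φ g x))
  curv l := by
    obtain ⟨C, hC⟩ := hg.curv l
    refine ⟨C, fun e he y hy => ?_⟩
    rw [coordMatrix_pullBilin]
    exact hC _ (pushChart_mem φ he) y (by rwa [pushChart_target])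

end Pullback

/-! ### Tame almost complex structures under area-preserving diffeomorphisms -/

section PullbackACS

variable {M : Type*} [TopologicalSpace M] [ChartedSpace (EuclideanSpace ℝ (Fin 2)) M]
  (φ : M ≃ₘ⟮𝓡 2, 𝓡 2⟯ M) {Ω : BilinField 2 M} {J : EndField 2 M}

theorem bilinAt_metricOf (Ω : BilinField 2 M) (J : EndField 2 M) (x : M)
    (v w : EuclideanSpace ℝ (Fin 2)) :
    bilinAt (metricOf Ω J) x v w = (bilinAt Ω x v (endAt J x w) + bilinAt Ω x w (endAt J x v)) / 2 :=
  metricOf_apply Ω J x v w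

theorem bilinAt_pullEnd (hφ : pullBilin φ Ω = Ω) (x : M) (v w : EuclideanSpace ℝ (Fin 2)) :
    bilinAt Ω x v (endAt (pullEnd φ J) x w) =
      bilinAt Ω (φ x) (diffeoDeriv φ x v) (endAt J (φ x) (diffeoDeriv φ x w)) := by
  conv_lhs => rw [← hφ]
  rw [bilinAt_pullBilin, endAt_pullEnd, diffeoDeriv_apply_symm]

theorem metricOf_pullEnd (hφ : pullBilin φ Ω = Ω) :
    metricOf Ω (pullEnd φ J) = pullBilin φ (metricOf Ω J) := by
  refine bilinField_ext fun x v w => ?_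
  rw [bilinAt_metricOf, bilinAt_pullEnd φ hφ, bilinAt_pullEnd φ hφ, bilinAt_pullBilin,
    bilinAt_metricOf]

/-- Since φ preserves `Ω`, the new metric is the pullback of the old one and so is tame. It serves
as its own comparison metric, with constant 1. -/
theorem pullEnd_mem_tameACS [IsManifold (𝓡 2) ∞ M] (hφ : pullBilin φ Ω = Ω) (hJ : J ∈ tameACS Ω) :
    pullEnd φ J ∈ tameACS Ω := by
  obtain ⟨hac, hpos, htame, -⟩ := hJ
  have htame' : IsTameMetric (metricOf Ω (pullEnd φ J)) := by
    rw [metricOf_pullEnd φ hφ]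
    exact htame.pull φ
  refine ⟨⟨fun e he => ?_, fun x v => ?_⟩, fun x v hv => ?_, htame', _, htame', 1, le_rfl,
    fun x u => by simp⟩
  · have h1 := hac.smooth _ (pushChart_mem φ he)
    rw [pushChart_target] at h1
    exact h1.congr fun y hy => coordEnd_pullEnd φ he hy J
  · have h1 : ∀ w, endAt J (φ x) (endAt J (φ x) w) = -w := hac.sq (φ x)
    have h2 : ∀ v : EuclideanSpace ℝ (Fin 2),
        endAt (pullEnd φ J) x (endAt (pullEnd φ J) x v) = -v := fun v => by
      rw [endAt_pullEnd, endAt_pullEnd, diffeoDeriv_apply_symm, h1, map_neg, diffeoDeriv_symm_apply]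
    exact h2 v
  · exact (hpos (φ x) _ (diffeoDeriv_ne_zero φ x hv)).trans_eq (bilinAt_pullEnd φ hφ x _ _).symm

end PullbackACS

/-! ## Smooth dependence of integrals on parameters -/

section ParametricIntegral

/-- Differentiation under the integral sign; the dominating constant comes from compactness of the
closed unit ball about `x` times [0, 1]. -/
theorem hasFDerivAt_parametric_integral {H E : Type} [NormedAddCommGroup H] [NormedSpace ℝ H]
    [ProperSpace H] [NormedAddCommGroup E] [NormedSpace ℝ E] {F : H × ℝ → E} (hF : ContDiff ℝ ∞ F)
    (x : H) :
    HasFDerivAt (fun x => ∫ t in (0 : ℝ)..1, F (x, t))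
      (∫ t in (0 : ℝ)..1, (fderiv ℝ F (x, t)).comp (ContinuousLinearMap.inl ℝ H ℝ)) x := by
  have hF' : Continuous fun p : H × ℝ => (fderiv ℝ F p).comp (ContinuousLinearMap.inl ℝ H ℝ) :=
    (hF.continuous_fderiv (by simp)).clm_comp continuous_const
  obtain ⟨C, hC⟩ := ((isCompact_closedBall x 1).prod
    (isCompact_Icc (a := (0 : ℝ)) (b := 1))).exists_bound_of_continuousOn hF'.continuousOn
  refine intervalIntegral.hasFDerivAt_integral_of_dominated_of_fderiv_le
    (F' := fun x t => (fderiv ℝ F (x, t)).comp (ContinuousLinearMap.inl ℝ H ℝ))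
    (bound := fun _ => C) (Metric.closedBall_mem_nhds x one_pos) ?_ ?_ ?_ ?_ ?_ ?_
  · exact .of_forall fun y => (hF.continuous.comp (by fun_prop)).aestronglyMeasurable
  · exact (hF.continuous.comp (by fun_prop)).intervalIntegrable _ _
  · exact (hF'.comp (g := fun p : H × ℝ => (fderiv ℝ F p).comp (ContinuousLinearMap.inl ℝ H ℝ))
      (f := fun t : ℝ => (x, t)) (by fun_prop)).aestronglyMeasurable
  · refine .of_forall fun t ht y hy => hC (y, t) ⟨hy, ?_⟩
    rw [uIoc_of_le zero_le_one] at ht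
    exact ⟨ht.1.le, ht.2⟩
  · exact intervalIntegrable_const
  · refine .of_forall fun t _ y _ => ?_
    have h1 : HasFDerivAt F (fderiv ℝ F (y, t)) (y, t) :=
      (hF.differentiable (by simp) (y, t)).hasFDerivAt
    exact h1.comp y (hasFDerivAt_prodMk_left y t)

/-- The derivative is again a parametric integral, with values in a space of linear maps; hence the
induction on the order lets `E` vary. -/
theorem contDiff_parametric_integral {H E : Type} [NormedAddCommGroup H] [NormedSpace ℝ H]
    [ProperSpace H] [NormedAddCommGroup E] [NormedSpace ℝ E] {F : H × ℝ → E}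
    (hF : ContDiff ℝ ∞ F) : ContDiff ℝ ∞ fun x => ∫ t in (0 : ℝ)..1, F (x, t) := by
  rw [contDiff_infty]
  intro n
  induction n generalizing E with
  | zero =>
    rw [Nat.cast_zero, contDiff_zero]
    exact (Differentiable.continuous fun x => (hasFDerivAt_parametric_integral hF x).differentiableAt)
  | succ n ih =>
    rw [Nat.cast_succ, contDiff_succ_iff_fderiv]
    refine ⟨fun x => (hasFDerivAt_parametric_integral hF x).differentiableAt, by simp, ?_⟩
    have h1 : (fderiv ℝ fun x => ∫ t in (0 : ℝ)..1, F (x, t)) = fun x =>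
        ∫ t in (0 : ℝ)..1, (fderiv ℝ F (x, t)).comp (ContinuousLinearMap.inl ℝ H ℝ) :=
      funext fun x => (hasFDerivAt_parametric_integral hF x).fderiv
    rw [h1]
    exact ih (F := fun p => (fderiv ℝ F p).comp (ContinuousLinearMap.inl ℝ H ℝ))
      ((hF.fderiv_right (by simp)).clm_comp contDiff_const)

/-- A smooth function on the plane has a smooth primitive in the first variable. -/
theorem exists_primitive {f : EuclideanSpace ℝ (Fin 2) → ℝ} (hf : ContDiff ℝ ∞ f) :
    ∃ F : EuclideanSpace ℝ (Fin 2) → ℝ, ContDiff ℝ ∞ F ∧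
      ∀ y, fderiv ℝ F y (EuclideanSpace.single 0 1) = f y := by
  have hpt : ContDiff ℝ ∞ fun p : EuclideanSpace ℝ (Fin 2) × ℝ =>
      (!₂[p.2 * p.1 0, p.1 1] : EuclideanSpace ℝ (Fin 2)) := by
    rw [contDiff_euclidean]
    intro i
    fin_cases i
    · change ContDiff ℝ ∞ fun p : EuclideanSpace ℝ (Fin 2) × ℝ => p.2 * p.1 0
      fun_prop
    · change ContDiff ℝ ∞ fun p : EuclideanSpace ℝ (Fin 2) × ℝ => p.1 1
      fun_prop
  have hG := contDiff_parametric_integral (hf.comp hpt)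
  -- This is the integral of `f` from 0 to `y 0` in the first variable, rescaled to fixed limits so
  -- that its smoothness follows from the parametric integral; `hline` undoes the rescaling.
  set F : EuclideanSpace ℝ (Fin 2) → ℝ :=
    fun y => y 0 * ∫ t in (0 : ℝ)..1, f !₂[t * y 0, y 1] with hFdef
  have hF : ContDiff ℝ ∞ F := by
    refine ContDiff.mul (by fun_prop) hG
  refine ⟨F, hF, fun y => ?_⟩
  have hline : ∀ r : ℝ, F (y + r • EuclideanSpace.single 0 1) =
      ∫ s in (0 : ℝ)..(y 0 + r), f !₂[s, y 1] := fun r => by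
    have := intervalIntegral.smul_integral_comp_mul_right (a := 0) (b := 1)
      (fun s => f !₂[s, y 1]) (y 0 + r)
    simp only [hFdef, PiLp.add_apply, PiLp.smul_apply, PiLp.single_apply]
    simpa using this
  have hcont : Continuous fun s : ℝ => f !₂[s, y 1] := by
    refine hf.continuous.comp ?_
    have : ContDiff ℝ ∞ fun s : ℝ => (!₂[s, y 1] : EuclideanSpace ℝ (Fin 2)) := by
      rw [contDiff_euclidean]
      intro i
      fin_cases i
      · exact contDiff_id
      · exact contDiff_const
    exact this.continuous
  have h3 : HasDerivAt (fun r : ℝ => F (y + r • EuclideanSpace.single 0 1)) (f y) 0 := by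
    simp only [hline]
    have h4 := (hcont.integral_hasStrictDerivAt 0 (y 0 + 0)).hasDerivAt
    have h5 := h4.comp (0 : ℝ) ((hasDerivAt_id (0 : ℝ)).const_add (y 0))
    have h6 : (!₂[y 0 + 0, y 1] : EuclideanSpace ℝ (Fin 2)) = y := by
      ext i; fin_cases i <;> simp
    rw [h6, mul_one] at h5
    exact h5
  have h7 : HasDerivAt (fun r : ℝ => y + r • (EuclideanSpace.single 0 1 : EuclideanSpace ℝ (Fin 2)))
      (EuclideanSpace.single 0 1) 0 := by
    simpa using ((hasDerivAt_id (0 : ℝ)).smul_const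
      (EuclideanSpace.single 0 1 : EuclideanSpace ℝ (Fin 2))).const_add y
  have h8 : HasFDerivAt F (fderiv ℝ F y) (y + (0 : ℝ) • EuclideanSpace.single 0 1) := by
    rw [zero_smul, add_zero]
    exact (hF.differentiable (by simp) y).hasFDerivAt
  have h9 : HasDerivAt (fun r : ℝ => F (y + r • EuclideanSpace.single 0 1))
      (fderiv ℝ F y (EuclideanSpace.single 0 1)) 0 :=
    HasFDerivAt.comp_hasDerivAt
      (f := fun r : ℝ => y + r • (EuclideanSpace.single 0 1 : EuclideanSpace ℝ (Fin 2)))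
      (0 : ℝ) h8 h7
  exact h9.unique h3

end ParametricIntegral

/-! ## Twist maps of the plane -/

section Twist

/-- The determinant of two vectors of the plane. -/
def planeDet (v w : EuclideanSpace ℝ (Fin 2)) : ℝ := v 0 * w 1 - v 1 * w 0

/-- The map rotating the circle of radius `√s` about `c` by the angle `θ s`. -/
noncomputable def twist (c : EuclideanSpace ℝ (Fin 2)) (θ : ℝ → ℝ) (y : EuclideanSpace ℝ (Fin 2)) :
    EuclideanSpace ℝ (Fin 2) :=
  !₂[c 0 + (Real.cos (θ ((y 0 - c 0) ^ 2 + (y 1 - c 1) ^ 2)) * (y 0 - c 0)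
      - Real.sin (θ ((y 0 - c 0) ^ 2 + (y 1 - c 1) ^ 2)) * (y 1 - c 1)),
    c 1 + (Real.sin (θ ((y 0 - c 0) ^ 2 + (y 1 - c 1) ^ 2)) * (y 0 - c 0)
      + Real.cos (θ ((y 0 - c 0) ^ 2 + (y 1 - c 1) ^ 2)) * (y 1 - c 1))]

variable {c : EuclideanSpace ℝ (Fin 2)} {θ : ℝ → ℝ}

theorem contDiff_twist (hθ : ContDiff ℝ ∞ θ) : ContDiff ℝ ∞ (twist c θ) := by
  have hs : ContDiff ℝ ∞ fun y : EuclideanSpace ℝ (Fin 2) =>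
      θ ((y 0 - c 0) ^ 2 + (y 1 - c 1) ^ 2) := hθ.comp (by fun_prop)
  rw [contDiff_euclidean]
  intro i
  fin_cases i
  · exact contDiff_const.add (((Real.contDiff_cos.comp hs).mul (by fun_prop)).sub
      ((Real.contDiff_sin.comp hs).mul (by fun_prop)))
  · exact contDiff_const.add (((Real.contDiff_sin.comp hs).mul (by fun_prop)).add
      ((Real.contDiff_cos.comp hs).mul (by fun_prop)))

/-- A point and its image lie on the same circle about `c` and so have the same angle; this is why
the twist by `-θ` is the inverse. -/
theorem twist_sq_add_sq (y : EuclideanSpace ℝ (Fin 2)) :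
    (twist c θ y 0 - c 0) ^ 2 + (twist c θ y 1 - c 1) ^ 2 =
      (y 0 - c 0) ^ 2 + (y 1 - c 1) ^ 2 := by
  simp only [twist, PiLp.toLp_apply, Matrix.cons_val_zero, Matrix.cons_val_one]
  linear_combination ((y 0 - c 0) ^ 2 + (y 1 - c 1) ^ 2) *
    Real.sin_sq_add_cos_sq (θ ((y 0 - c 0) ^ 2 + (y 1 - c 1) ^ 2))

theorem twist_neg_twist (y : EuclideanSpace ℝ (Fin 2)) : twist c (-θ) (twist c θ y) = y := by
  have h := twist_sq_add_sq (c := c) (θ := θ) y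
  ext i
  rw [twist, h]
  have hsc := Real.sin_sq_add_cos_sq (θ ((y 0 - c 0) ^ 2 + (y 1 - c 1) ^ 2))
  fin_cases i
  · simp only [twist, Pi.neg_apply, Real.cos_neg, Real.sin_neg, PiLp.toLp_apply,
      Matrix.cons_val_zero, Matrix.cons_val_one, Fin.zero_eta]
    linear_combination (y 0 - c 0) * hsc
  · simp only [twist, Pi.neg_apply, Real.cos_neg, Real.sin_neg, PiLp.toLp_apply,
      Matrix.cons_val_zero, Matrix.cons_val_one, Fin.mk_one]
    linear_combination (y 1 - c 1) * hsc

theorem twist_eq_self {y : EuclideanSpace ℝ (Fin 2)}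
    (h : θ ((y 0 - c 0) ^ 2 + (y 1 - c 1) ^ 2) = 0) : twist c θ y = y := by
  ext i
  fin_cases i <;> simp [twist, h]

/-- The quantities `p`, `q`, `A`, `B`, `k` are variables with defining equations so that their
values at a special point can be inserted directly. -/
theorem fderiv_twist_apply (hθ : ContDiff ℝ ∞ θ) (y v : EuclideanSpace ℝ (Fin 2)) {p q A B k : ℝ}
    (hp : p = y 0 - c 0) (hq : q = y 1 - c 1) (hA : A = Real.cos (θ (p ^ 2 + q ^ 2)))
    (hB : B = Real.sin (θ (p ^ 2 + q ^ 2)))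
    (hk : k = deriv θ (p ^ 2 + q ^ 2) * (2 * (p * v 0 + q * v 1))) :
    fderiv ℝ (twist c θ) y v =
      !₂[A * v 0 - B * v 1 - k * (B * p + A * q), B * v 0 + A * v 1 + k * (A * p - B * q)] := by
  have hline : HasDerivAt (fun r : ℝ => y + r • v) v 0 := by
    simpa using ((hasDerivAt_id (0 : ℝ)).smul_const v).const_add y
  have hfd : HasFDerivAt (twist c θ) (fderiv ℝ (twist c θ) y) (y + (0 : ℝ) • v) := by
    rw [zero_smul, add_zero]
    exact ((contDiff_twist hθ).differentiable (by simp) y).hasFDerivAt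
  have h1 := hfd.comp_hasDerivAt (0 : ℝ) hline
  have hcoord : ∀ i, HasDerivAt (fun r : ℝ => y i + r * v i - c i) (v i) 0 := fun i => by
    simpa using (((hasDerivAt_id (0 : ℝ)).mul_const (v i)).const_add (y i)).sub_const (c i)
  have hs : HasDerivAt (fun r : ℝ => (y 0 + r * v 0 - c 0) ^ 2 + (y 1 + r * v 1 - c 1) ^ 2)
      (2 * (p * v 0 + q * v 1)) 0 := by
    refine (((hcoord 0).pow 2).add ((hcoord 1).pow 2)).congr_deriv ?_
    rw [hp, hq]
    simp
    ring
  have hs0 : (y 0 + (0 : ℝ) * v 0 - c 0) ^ 2 + (y 1 + (0 : ℝ) * v 1 - c 1) ^ 2 = p ^ 2 + q ^ 2 := by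
    rw [hp, hq]; ring
  have ht : HasDerivAt (fun r : ℝ =>
      θ ((y 0 + r * v 0 - c 0) ^ 2 + (y 1 + r * v 1 - c 1) ^ 2)) k 0 := by
    have h2 : HasDerivAt θ (deriv θ (p ^ 2 + q ^ 2))
        ((y 0 + (0 : ℝ) * v 0 - c 0) ^ 2 + (y 1 + (0 : ℝ) * v 1 - c 1) ^ 2) := by
      rw [hs0]
      exact (hθ.differentiable (by simp) _).hasDerivAt
    rw [hk]
    exact h2.comp (0 : ℝ) hs
  have e0 := ((ht.cos.mul (hcoord 0)).sub (ht.sin.mul (hcoord 1))).const_add (c 0)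
  have e1 := ((ht.sin.mul (hcoord 0)).add (ht.cos.mul (hcoord 1))).const_add (c 1)
  rw [hs0, ← hA, ← hB] at e0 e1
  have hp0 : y 0 + (0 : ℝ) * v 0 - c 0 = p := by rw [hp]; ring
  have hq0 : y 1 + (0 : ℝ) * v 1 - c 1 = q := by rw [hq]; ring
  rw [hp0, hq0] at e0 e1
  have hpr : ∀ i, HasDerivAt (fun r : ℝ => twist c θ (y + r • v) i)
      (fderiv ℝ (twist c θ) y v i) 0 := fun i =>
    ((EuclideanSpace.proj (𝕜 := ℝ) i).hasFDerivAt.comp_hasDerivAt (0 : ℝ) h1 :)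
  ext i
  fin_cases i
  · refine ((hpr 0).unique e0).trans ?_
    change _ = A * v 0 - B * v 1 - k * (B * p + A * q)
    ring
  · refine ((hpr 1).unique e1).trans ?_
    change _ = B * v 0 + A * v 1 + k * (A * p - B * q)
    ring

/-- With p = y - c and p⊥ its rotation by a right angle, the differential is a rotation composed
with the shear v ↦ v + 2θ'⟨p, v⟩p⊥. Both have determinant one. -/
theorem planeDet_fderiv_twist (hθ : ContDiff ℝ ∞ θ) (y v w : EuclideanSpace ℝ (Fin 2)) :
    planeDet (fderiv ℝ (twist c θ) y v) (fderiv ℝ (twist c θ) y w) = planeDet v w := by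
  rw [fderiv_twist_apply hθ y v rfl rfl rfl rfl rfl, fderiv_twist_apply hθ y w rfl rfl rfl rfl rfl]
  have hsc := Real.sin_sq_add_cos_sq (θ ((y 0 - c 0) ^ 2 + (y 1 - c 1) ^ 2))
  simp only [planeDet, Matrix.cons_val_zero, Matrix.cons_val_one]
  linear_combination (v 0 * w 1 - v 1 * w 0) * hsc

/-- Angle functions supported in `[a / 2, 2 * a]` that vanish at `a` with derivative `1`. -/
theorem exists_twist_profile {a : ℝ} (ha : 0 < a) :
    ∃ θ : ℝ → ℝ, ContDiff ℝ ∞ θ ∧ (∀ s, s ≤ a / 2 → θ s = 0) ∧ (∀ s, 2 * a ≤ s → θ s = 0) ∧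
      θ a = 0 ∧ deriv θ a = 1 := by
  -- The factor `s - a` below gives a zero at `a`, where its slope is χ(a) = 1; the outer radius a/2
  -- keeps the support within the prescribed interval.
  let χ : ContDiffBump a := ⟨a / 4, a / 2, by positivity, by linarith⟩
  refine ⟨fun s => (s - a) * χ s, (contDiff_id.sub contDiff_const).mul χ.contDiff,
    fun s hs => ?_, fun s hs => ?_, by simp, ?_⟩
  · change (s - a) * χ s = 0
    rw [χ.zero_of_le_dist, mul_zero]
    rw [Real.dist_eq, abs_sub_comm]
    exact le_trans (by change a / 2 ≤ a - s; linarith) (le_abs_self _)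
  · change (s - a) * χ s = 0
    rw [χ.zero_of_le_dist, mul_zero]
    rw [Real.dist_eq]
    exact le_trans (by change a / 2 ≤ s - a; linarith) (le_abs_self _)
  · have h1 : HasDerivAt (fun s => s - a) 1 a := (hasDerivAt_id a).sub_const a
    have h2 : HasDerivAt χ (deriv χ a) a :=
      ((χ.contDiff (n := 1)).differentiable (by simp) a).hasDerivAt
    have h3 := (h1.mul h2).deriv
    have h4 : χ a = 1 := χ.one_of_mem_closedBall (Metric.mem_closedBall_self (by positivity))
    refine h3.trans ?_
    rw [h4]
    ring

end Twist

/-! ## Changes of charts -/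

section ChangeOfChart

variable {n : ℕ} {M : Type*} [TopologicalSpace M] [ChartedSpace (EuclideanSpace ℝ (Fin n)) M]
  {e : OpenPartialHomeomorph M (EuclideanSpace ℝ (Fin n))}
  {ψ : OpenPartialHomeomorph (EuclideanSpace ℝ (Fin n)) (EuclideanSpace ℝ (Fin n))}

theorem trans_mem_smoothCharts [IsManifold (𝓡 n) ∞ M] (he : e ∈ smoothCharts n M)
    (hψ : ContDiffOn ℝ ∞ ψ ψ.source) (hψ' : ContDiffOn ℝ ∞ ψ.symm ψ.target) :
    e.trans ψ ∈ smoothCharts n M := by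
  refine OpenPartialHomeomorph.mem_maximalAtlas_of_contMDiffOn _ ?_ ?_
  · exact hψ.contMDiffOn.comp ((contMDiffOn_of_mem_maximalAtlas he).mono fun x hx => hx.1)
      fun x hx => hx.2
  · exact (contMDiffOn_symm_of_mem_maximalAtlas he).comp
      (hψ'.contMDiffOn.mono fun y hy => hy.1) fun y hy => hy.2

theorem restr_mem_smoothCharts [IsManifold (𝓡 n) ∞ M] (he : e ∈ smoothCharts n M) (s : Set M) :
    e.restr s ∈ smoothCharts n M := by
  refine OpenPartialHomeomorph.mem_maximalAtlas_of_contMDiffOn _ ?_ ?_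
  · exact (contMDiffOn_of_mem_maximalAtlas he).mono fun x hx => hx.1
  · exact (contMDiffOn_symm_of_mem_maximalAtlas he).mono fun y hy => hy.1

theorem coordFrame_trans [IsManifold (𝓡 n) ∞ M] (he : e ∈ smoothCharts n M)
    (hψ : ContDiffOn ℝ ∞ ψ ψ.source) (hψ' : ContDiffOn ℝ ∞ ψ.symm ψ.target)
    {y : EuclideanSpace ℝ (Fin n)} (hy : y ∈ e.target) (hyψ : y ∈ ψ.source)
    (v : EuclideanSpace ℝ (Fin n)) :
    (coordFrame (e.trans ψ) (ψ y) (fderiv ℝ ψ y v) : EuclideanSpace ℝ (Fin n)) =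
      coordFrame e y v := by
  have hz : ψ y ∈ (e.trans ψ).target := ⟨ψ.map_source hyψ, by
    change ψ.symm (ψ y) ∈ e.target
    rwa [ψ.left_inv hyψ]⟩
  have hd : DifferentiableAt ℝ ψ y :=
    (hψ.contDiffAt (ψ.open_source.mem_nhds hyψ)).differentiableAt (by simp)
  have h1 := mfderiv_comp y (g := (e.trans ψ).symm)
    (mdifferentiableAt_chart_symm (trans_mem_smoothCharts he hψ hψ') hz) hd.mdifferentiableAt
  have h2 : ((e.trans ψ).symm ∘ ψ : EuclideanSpace ℝ (Fin n) → M) =ᶠ[𝓝 y] e.symm := by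
    filter_upwards [ψ.open_source.mem_nhds hyψ] with z hz
    exact congrArg e.symm (ψ.left_inv hz)
  rw [h2.mfderiv_eq, mfderiv_eq_fderiv] at h1
  exact (congrArg (fun L : EuclideanSpace ℝ (Fin n) →L[ℝ] EuclideanSpace ℝ (Fin n) => L v) h1).symm

theorem exists_equiv_of_injective
    {A : EuclideanSpace ℝ (Fin n) →L[ℝ] EuclideanSpace ℝ (Fin n)} (hA : Function.Injective A) :
    ∃ L : EuclideanSpace ℝ (Fin n) ≃L[ℝ] EuclideanSpace ℝ (Fin n),
      (L : EuclideanSpace ℝ (Fin n) →L[ℝ] EuclideanSpace ℝ (Fin n)) = A :=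
  ⟨(LinearEquiv.ofInjectiveEndo (A : EuclideanSpace ℝ (Fin n) →ₗ[ℝ] EuclideanSpace ℝ (Fin n))
    hA).toContinuousLinearEquiv, ContinuousLinearMap.ext fun _ => rfl⟩

/-- A smooth map is a smooth change of coordinates on an open set on which its differential is
injective, near every point of that set. -/
theorem exists_openPartialHomeomorph {Φ : EuclideanSpace ℝ (Fin n) → EuclideanSpace ℝ (Fin n)}
    (hΦ : ContDiff ℝ ∞ Φ) {s : Set (EuclideanSpace ℝ (Fin n))} (hs : IsOpen s)
    (hinj : ∀ y ∈ s, Function.Injective (fderiv ℝ Φ y)) {y : EuclideanSpace ℝ (Fin n)}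
    (hy : y ∈ s) :
    ∃ ψ : OpenPartialHomeomorph (EuclideanSpace ℝ (Fin n)) (EuclideanSpace ℝ (Fin n)),
      y ∈ ψ.source ∧ ψ.source ⊆ s ∧ (∀ z, ψ z = Φ z) ∧ ContDiffOn ℝ ∞ ψ ψ.source ∧
      ContDiffOn ℝ ∞ ψ.symm ψ.target := by
  have hfd : ∀ z ∈ s, ∃ L : EuclideanSpace ℝ (Fin n) ≃L[ℝ] EuclideanSpace ℝ (Fin n),
      HasFDerivAt Φ (L : EuclideanSpace ℝ (Fin n) →L[ℝ] EuclideanSpace ℝ (Fin n)) z :=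
    fun z hz => by
      obtain ⟨L, hL⟩ := exists_equiv_of_injective (hinj z hz)
      exact ⟨L, hL ▸ (hΦ.differentiable (by simp) z).hasFDerivAt⟩
  obtain ⟨L, hL⟩ := hfd y hy
  let ψ := (hΦ.contDiffAt.toOpenPartialHomeomorph Φ hL (by simp)).restrOpen s hs
  have hcoe : ∀ z, ψ z = Φ z := fun z => rfl
  have hsub : ψ.source ⊆ s := fun z hz => hz.2
  refine ⟨ψ, ⟨hΦ.contDiffAt.mem_toOpenPartialHomeomorph_source hL (by simp), hy⟩, hsub, hcoe,
    hΦ.contDiffOn, fun z hz => ?_⟩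
  obtain ⟨L', hL'⟩ := hfd (ψ.symm z) (hsub (ψ.map_target hz))
  exact (ψ.contDiffAt_symm hz hL' hΦ.contDiffAt).contDiffWithinAt

end ChangeOfChart

/-! ## Area forms in charts -/

section Darboux

variable {M : Type*} [TopologicalSpace M] [ChartedSpace (EuclideanSpace ℝ (Fin 2)) M]
  {Ω : BilinField 2 M} {e : OpenPartialHomeomorph M (EuclideanSpace ℝ (Fin 2))}

theorem apply_swap_of_alternating
    {B : EuclideanSpace ℝ (Fin 2) →L[ℝ] EuclideanSpace ℝ (Fin 2) →L[ℝ] ℝ} (hB : ∀ v, B v v = 0)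
    (v w : EuclideanSpace ℝ (Fin 2)) : B w v = -B v w := by
  have h := hB (v + w)
  simp only [map_add, add_apply, hB, zero_add, add_zero] at h
  linarith

theorem bilinAt_coordFrame_of_alternating (hΩ : ∀ x v, Ω x v v = 0)
    (e : OpenPartialHomeomorph M (EuclideanSpace ℝ (Fin 2))) (y v w : EuclideanSpace ℝ (Fin 2)) :
    bilinAt Ω (e.symm y) (coordFrame e y v) (coordFrame e y w) =
      coordMatrix Ω e y 0 1 * planeDet v w := by
  have h00 : coordMatrix Ω e y 0 0 = 0 := hΩ _ _
  have h11 : coordMatrix Ω e y 1 1 = 0 := hΩ _ _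
  have h10 : coordMatrix Ω e y 1 0 = -coordMatrix Ω e y 0 1 :=
    apply_swap_of_alternating (B := bilinAt Ω (e.symm y)) (hΩ (e.symm y)) _ _
  refine (matrixForm_coordMatrix Ω e y v w).symm.trans ?_
  simp only [matrixForm, Fin.sum_univ_two, h00, h11, h10, planeDet]
  ring

theorem IsAreaForm.coordMatrix_ne_zero (hΩ : IsAreaForm Ω) (he : e ∈ smoothCharts 2 M)
    {y : EuclideanSpace ℝ (Fin 2)} (hy : y ∈ e.target) : coordMatrix Ω e y 0 1 ≠ 0 := by
  intro h
  refine hΩ.ne_zero (e.symm y)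
    (ContinuousLinearMap.ext fun v => ContinuousLinearMap.ext fun w => ?_)
  have h1 := bilinAt_coordFrame_of_alternating hΩ.alt e y (coordCoframe e y v) (coordCoframe e y w)
  rw [h, zero_mul] at h1
  have h2 := coordFrame_coordCoframe he hy v
  have h3 := coordFrame_coordCoframe he hy w
  refine Eq.trans ?_ h1
  exact congrArg₂ (fun v w => bilinAt Ω (e.symm y) v w) h2.symm h3.symm

/-- Every point of a surface with an area form has a neighbourhood with area-preserving
coordinates. -/
theorem IsAreaForm.exists_darboux_chart [IsManifold (𝓡 2) ∞ M] (hΩ : IsAreaForm Ω) (x : M) :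
    ∃ e ∈ smoothCharts 2 M, x ∈ e.source ∧ ∀ y ∈ e.target, coordMatrix Ω e y 0 1 = 1 := by
  obtain ⟨e, he, hx⟩ : ∃ e ∈ smoothCharts 2 M, x ∈ e.source :=
    ⟨_, IsManifold.chart_mem_maximalAtlas x, mem_chart_source _ x⟩
  obtain ⟨r, hr, hball⟩ := Metric.nhds_basis_closedBall.mem_iff.mp
    (e.open_target.mem_nhds (e.map_source hx))
  -- The cutoff makes the coefficient of `Ω` smooth on the whole plane, so that it has a primitive
  -- `F` in the first variable. On the half-size ball, the map (F, y 1) then has the coefficient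
  -- itself as Jacobian determinant.
  let χ : ContDiffBump (e x) := ⟨r / 2, r, by positivity, by linarith⟩
  have hf : ContDiff ℝ ∞ fun y => χ y * coordMatrix Ω e y 0 1 := by
    refine (contMDiff_of_tsupport fun y hy => ?_).contDiff
    have hy' : y ∈ e.target := by
      apply hball
      rw [← χ.tsupport_eq]
      exact tsupport_mul_subset_left hy
    exact (χ.contDiff.contDiffAt.mul
      ((hΩ.smooth e he 0 1).contDiffAt (e.open_target.mem_nhds hy'))).contMDiffAt
  obtain ⟨F, hF, hF'⟩ := exists_primitive hf
  set Φ : EuclideanSpace ℝ (Fin 2) → EuclideanSpace ℝ (Fin 2) := fun y => !₂[F y, y 1] with hΦdef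
  have hΦ : ContDiff ℝ ∞ Φ := by
    rw [contDiff_euclidean]
    intro i
    fin_cases i
    · exact hF
    · change ContDiff ℝ ∞ fun y : EuclideanSpace ℝ (Fin 2) => y 1
      fun_prop
  have hpr : ∀ (i : Fin 2) y v, fderiv ℝ Φ y v i = fderiv ℝ (fun z => Φ z i) y v := fun i y v => by
    have h1 := (EuclideanSpace.proj (𝕜 := ℝ) i).hasFDerivAt.comp y
      (hΦ.differentiable (by simp) y).hasFDerivAt
    exact (congrArg (fun L : EuclideanSpace ℝ (Fin 2) →L[ℝ] ℝ => L v) h1.fderiv).symm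
  have hΦ0 : ∀ y v, fderiv ℝ Φ y v 0 = fderiv ℝ F y v := hpr 0
  have hΦ1 : ∀ y v, fderiv ℝ Φ y v 1 = v 1 := fun y v => (hpr 1 y v).trans
    (congrArg (fun L : EuclideanSpace ℝ (Fin 2) →L[ℝ] ℝ => L v)
      (EuclideanSpace.proj (𝕜 := ℝ) (1 : Fin 2)).fderiv)
  have hdet : ∀ y, planeDet (fderiv ℝ Φ y (EuclideanSpace.single 0 1))
      (fderiv ℝ Φ y (EuclideanSpace.single 1 1)) = χ y * coordMatrix Ω e y 0 1 := fun y => by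
    simp only [planeDet, hΦ0, hΦ1, hF']
    simp
  set s : Set (EuclideanSpace ℝ (Fin 2)) := Metric.ball (e x) (r / 2) with hs
  have hχ : ∀ y ∈ s, χ y = 1 := fun y hy => χ.one_of_mem_closedBall (Metric.ball_subset_closedBall hy)
  have hst : s ⊆ e.target := (Metric.ball_subset_closedBall.trans
    (Metric.closedBall_subset_closedBall (by linarith))).trans hball
  have hinj : ∀ y ∈ s, Function.Injective (fderiv ℝ Φ y) := fun y hy => by
    rw [injective_iff_map_eq_zero]
    intro v hv
    have h1 : v 1 = 0 := by rw [← hΦ1 y v, hv]; rfl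
    have h2 : v = v 0 • EuclideanSpace.single 0 1 := by
      ext i
      fin_cases i
      · simp
      · simpa using h1
    have h3 : fderiv ℝ F y v = 0 := by rw [← hΦ0 y v, hv]; rfl
    rw [h2, map_smul, hF', hχ y hy, one_mul, smul_eq_mul, mul_eq_zero,
      or_iff_left (hΩ.coordMatrix_ne_zero he (hst hy))] at h3
    rw [h2, h3, zero_smul]
  obtain ⟨ψ, hxψ, hψs, hψΦ, hψ, hψ'⟩ := exists_openPartialHomeomorph hΦ Metric.isOpen_ball hinj
    (Metric.mem_ball_self (by positivity))
  have hψΦ' : (ψ : EuclideanSpace ℝ (Fin 2) → EuclideanSpace ℝ (Fin 2)) = Φ := funext hψΦ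
  refine ⟨e.trans ψ, trans_mem_smoothCharts he hψ hψ', ⟨hx, hxψ⟩, fun z hz => ?_⟩
  obtain ⟨y, hy, hyt, rfl⟩ : ∃ y, y ∈ ψ.source ∧ y ∈ e.target ∧ ψ y = z :=
    ⟨ψ.symm z, ψ.map_target hz.1, hz.2, ψ.right_inv hz.1⟩
  have hfr := coordFrame_trans he hψ hψ' hyt hy
  have hsymm : (e.trans ψ).symm (ψ y) = e.symm y := congrArg e.symm (ψ.left_inv hy)
  -- `Ω` is evaluated on the same pair of tangent vectors in both charts: the new coefficient times
  -- the Jacobian is the old coefficient, which equals the Jacobian and is nonzero.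
  have h1 := bilinAt_coordFrame_of_alternating hΩ.alt (e.trans ψ) (ψ y)
    (fderiv ℝ ψ y (EuclideanSpace.single 0 1)) (fderiv ℝ ψ y (EuclideanSpace.single 1 1))
  rw [hsymm, hψΦ', hdet, ← hψΦ', hχ y (hψs hy), one_mul] at h1
  have h2 := bilinAt_coordFrame_of_alternating hΩ.alt e y (EuclideanSpace.single 0 1)
    (EuclideanSpace.single 1 1)
  have h3 : planeDet (EuclideanSpace.single 0 1) (EuclideanSpace.single 1 1) = 1 := by
    simp [planeDet]
  rw [h3, mul_one] at h2
  have h4 := h1.symm.trans ((congrArg₂ (fun v w => bilinAt Ω (e.symm y) v w) (hfr _) (hfr _)).trans h2)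
  exact mul_right_cancel₀ (hΩ.coordMatrix_ne_zero he hyt) (h4.trans (one_mul _).symm)

end Darboux

/-! ## Diffeomorphisms supported in a chart -/

section ChartConjugate

variable {n : ℕ} {M : Type*} [TopologicalSpace M]
  {e : OpenPartialHomeomorph M (EuclideanSpace ℝ (Fin n))}
  {τ τ' : EuclideanSpace ℝ (Fin n) → EuclideanSpace ℝ (Fin n)}
  {K : Set (EuclideanSpace ℝ (Fin n))}

open Classical in
/-- The map of `M` that is `τ` in the chart `e` and the identity outside it. -/
noncomputable def chartConjugate (e : OpenPartialHomeomorph M (EuclideanSpace ℝ (Fin n)))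
    (τ : EuclideanSpace ℝ (Fin n) → EuclideanSpace ℝ (Fin n)) (x : M) : M :=
  if x ∈ e.source then e.symm (τ (e x)) else x

theorem mem_of_eq_self_off (hinv : ∀ y, τ' (τ y) = y) (hτ' : ∀ y ∉ K, τ' y = y) {y}
    (hy : y ∈ K) : τ y ∈ K := by
  by_contra h
  have h1 := hτ' _ h
  rw [hinv] at h1
  exact h (h1 ▸ hy)

theorem mem_target_of_eq_self_off (hK : K ⊆ e.target) (hinv : ∀ y, τ' (τ y) = y)
    (hτ : ∀ y ∉ K, τ y = y) (hτ' : ∀ y ∉ K, τ' y = y) {y} (hy : y ∈ e.target) :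
    τ y ∈ e.target := by
  by_cases h : y ∈ K
  · exact hK (mem_of_eq_self_off hinv hτ' h)
  · rwa [hτ y h]

theorem chartConjugate_eq_self (hτ : ∀ y ∉ K, τ y = y) {x : M} (hx : x ∉ e.symm '' K) :
    chartConjugate e τ x = x := by
  unfold chartConjugate
  split_ifs with h
  · rw [hτ _ fun h1 => hx ⟨e x, h1, e.left_inv h⟩, e.left_inv h]
  · rfl

theorem chartConjugate_symm {y : EuclideanSpace ℝ (Fin n)} (hy : y ∈ e.target) :
    chartConjugate e τ (e.symm y) = e.symm (τ y) := by
  rw [chartConjugate, if_pos (e.map_target hy), e.right_inv hy]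

theorem chartConjugate_chartConjugate (hK : K ⊆ e.target) (hinv : ∀ y, τ' (τ y) = y)
    (hτ : ∀ y ∉ K, τ y = y) (hτ' : ∀ y ∉ K, τ' y = y) (x : M) :
    chartConjugate e τ' (chartConjugate e τ x) = x := by
  by_cases h : x ∈ e.source
  · rw [← e.left_inv h, chartConjugate_symm (e.map_source h), chartConjugate_symm
      (mem_target_of_eq_self_off hK hinv hτ hτ' (e.map_source h)), hinv]
  · have h1 : ∀ σ, chartConjugate e σ x = x := fun σ => if_neg h
    rw [h1, h1]

theorem isClosed_image_symm [T2Space M] (hKc : IsCompact K) (hK : K ⊆ e.target) :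
    IsClosed (e.symm '' K) :=
  (hKc.image_of_continuousOn (e.continuousOn_symm.mono hK)).isClosed

variable [ChartedSpace (EuclideanSpace ℝ (Fin n)) M]

theorem contMDiff_chartConjugate [IsManifold (𝓡 n) ∞ M] [T2Space M] (he : e ∈ smoothCharts n M)
    (hKc : IsCompact K) (hK : K ⊆ e.target) (hinv : ∀ y, τ' (τ y) = y) (hτs : ContDiff ℝ ∞ τ)
    (hτ : ∀ y ∉ K, τ y = y) (hτ' : ∀ y ∉ K, τ' y = y) :
    ContMDiff (𝓡 n) (𝓡 n) ∞ (chartConjugate e τ) := by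
  intro x
  by_cases hx : x ∈ e.source
  · have h1 : ContMDiffAt (𝓡 n) (𝓡 n) ∞ (fun z => e.symm (τ (e z))) x :=
      (contMDiffAt_symm_of_mem_maximalAtlas he
        (mem_target_of_eq_self_off hK hinv hτ hτ' (e.map_source hx))).comp x
        (hτs.contMDiff.contMDiffAt.comp x (contMDiffAt_of_mem_maximalAtlas he hx))
    refine h1.congr_of_eventuallyEq ?_
    filter_upwards [e.open_source.mem_nhds hx] with z hz using if_pos hz
  -- The image of the compact set `K` is closed in the Hausdorff space `M`, so the map is the
  -- identity near a point outside the chart.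
  · refine contMDiffAt_id.congr_of_eventuallyEq ?_
    have hx' : x ∉ e.symm '' K := fun ⟨y, hy, hyx⟩ => hx (hyx ▸ e.map_target (hK hy))
    filter_upwards [(isClosed_image_symm hKc hK).isOpen_compl.mem_nhds hx'] with z hz
      using chartConjugate_eq_self hτ hz

theorem exists_diffeomorph_chartConjugate [IsManifold (𝓡 n) ∞ M] [T2Space M]
    (he : e ∈ smoothCharts n M) (hKc : IsCompact K) (hK : K ⊆ e.target)
    (hinv : ∀ y, τ' (τ y) = y) (hinv' : ∀ y, τ (τ' y) = y) (hτs : ContDiff ℝ ∞ τ)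
    (hτs' : ContDiff ℝ ∞ τ') (hτ : ∀ y ∉ K, τ y = y) (hτ' : ∀ y ∉ K, τ' y = y) :
    ∃ φ : M ≃ₘ⟮𝓡 n, 𝓡 n⟯ M, ∀ x, φ x = chartConjugate e τ x :=
  ⟨{ toFun := chartConjugate e τ
     invFun := chartConjugate e τ'
     left_inv := chartConjugate_chartConjugate hK hinv hτ hτ'
     right_inv := chartConjugate_chartConjugate hK hinv' hτ' hτ
     contMDiff_toFun := contMDiff_chartConjugate he hKc hK hinv hτs hτ hτ'
     contMDiff_invFun := contMDiff_chartConjugate he hKc hK hinv' hτs' hτ' hτ }, fun _ => rfl⟩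

theorem diffeoDeriv_coordFrame (φ : M ≃ₘ⟮𝓡 n, 𝓡 n⟯ M) (he : e ∈ smoothCharts n M)
    (hτs : ContDiff ℝ ∞ τ) (hφ : ∀ y ∈ e.target, φ (e.symm y) = e.symm (τ y))
    {y : EuclideanSpace ℝ (Fin n)} (hy : y ∈ e.target) (hτy : τ y ∈ e.target)
    (v : EuclideanSpace ℝ (Fin n)) :
    diffeoDeriv φ (e.symm y) (coordFrame e y v) = coordFrame e (τ y) (fderiv ℝ τ y v) := by
  have h1 := mfderiv_comp y (φ.mdifferentiableAt_top (e.symm y))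
    (mdifferentiableAt_chart_symm he hy)
  have h2 := mfderiv_comp y (mdifferentiableAt_chart_symm he hτy)
    (hτs.differentiable (by simp) y).mdifferentiableAt
  have h3 : (φ ∘ e.symm : EuclideanSpace ℝ (Fin n) → M) =ᶠ[𝓝 y] e.symm ∘ τ := by
    filter_upwards [e.open_target.mem_nhds hy] with z hz using hφ z hz
  rw [h3.mfderiv_eq] at h1
  rw [mfderiv_eq_fderiv] at h2
  exact congrArg (fun L : EuclideanSpace ℝ (Fin n) →L[ℝ] EuclideanSpace ℝ (Fin n) => L v)
    (h1.symm.trans h2)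

theorem diffeoDeriv_congr {φ ψ : M ≃ₘ⟮𝓡 n, 𝓡 n⟯ M} {x : M} (h : φ =ᶠ[𝓝 x] ψ) :
    diffeoDeriv φ x = diffeoDeriv ψ x :=
  h.mfderiv_eq

theorem diffeoDeriv_eq_id {φ : M ≃ₘ⟮𝓡 n, 𝓡 n⟯ M} {x : M} (h : φ =ᶠ[𝓝 x] id) :
    diffeoDeriv φ x = ContinuousLinearMap.id ℝ _ :=
  h.mfderiv_eq.trans mfderiv_id

theorem bilinAt_pullBilin_congr {φ ψ : M ≃ₘ⟮𝓡 n, 𝓡 n⟯ M} {x : M} (h : φ =ᶠ[𝓝 x] ψ)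
    (B : BilinField n M) : bilinAt (pullBilin φ B) x = bilinAt (pullBilin ψ B) x := by
  ext v w : 2
  rw [bilinAt_pullBilin, bilinAt_pullBilin, diffeoDeriv_congr h, h.eq_of_nhds]

theorem bilinAt_pullBilin_eq_self {φ : M ≃ₘ⟮𝓡 n, 𝓡 n⟯ M} {x : M} (h : φ =ᶠ[𝓝 x] id)
    (B : BilinField n M) : bilinAt (pullBilin φ B) x = bilinAt B x := by
  ext v w : 2
  rw [bilinAt_pullBilin, diffeoDeriv_eq_id h, h.eq_of_nhds]
  rfl

end ChartConjugate

/-! ## Area-preserving diffeomorphisms with small support -/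

section AreaPreserving

variable {M : Type*} [TopologicalSpace M] [ChartedSpace (EuclideanSpace ℝ (Fin 2)) M]
  {Ω : BilinField 2 M}

theorem pullBilin_areaForm_of_chart {e : OpenPartialHomeomorph M (EuclideanSpace ℝ (Fin 2))}
    (hΩ : IsAreaForm Ω) (he : e ∈ smoothCharts 2 M) (he1 : ∀ y ∈ e.target, coordMatrix Ω e y 0 1 = 1)
    {φ : M ≃ₘ⟮𝓡 2, 𝓡 2⟯ M} {τ : EuclideanSpace ℝ (Fin 2) → EuclideanSpace ℝ (Fin 2)}
    (hτs : ContDiff ℝ ∞ τ) (hφ : ∀ y ∈ e.target, φ (e.symm y) = e.symm (τ y))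
    (hτt : ∀ y ∈ e.target, τ y ∈ e.target)
    (hτdet : ∀ y v w, planeDet (fderiv ℝ τ y v) (fderiv ℝ τ y w) = planeDet v w)
    (hid : ∀ x ∉ e.source, φ =ᶠ[𝓝 x] id) : pullBilin φ Ω = Ω := by
  refine bilinField_ext fun x v w => ?_
  by_cases hx : x ∈ e.source
  · obtain ⟨y, hy, rfl⟩ : ∃ y, y ∈ e.target ∧ e.symm y = x :=
      ⟨e x, e.map_source hx, e.left_inv hx⟩
    obtain ⟨v', rfl⟩ : ∃ v', (coordFrame e y v' : EuclideanSpace ℝ (Fin 2)) = v :=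
      ⟨_, coordFrame_coordCoframe he hy v⟩
    obtain ⟨w', rfl⟩ : ∃ w', (coordFrame e y w' : EuclideanSpace ℝ (Fin 2)) = w :=
      ⟨_, coordFrame_coordCoframe he hy w⟩
    have h1 := diffeoDeriv_coordFrame φ he hτs hφ hy (hτt y hy)
    have h2 : bilinAt Ω (φ (e.symm y)) = bilinAt Ω (e.symm (τ y)) := congrArg _ (hφ y hy)
    refine (congrArg₂ (fun v w => bilinAt Ω (φ (e.symm y)) v w) (h1 v') (h1 w')).trans ?_
    refine (congrArg (fun b : EuclideanSpace ℝ (Fin 2) →L[ℝ] EuclideanSpace ℝ (Fin 2) →L[ℝ] ℝ =>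
      b (chartSymmDeriv e (τ y) (fderiv ℝ τ y v')) (chartSymmDeriv e (τ y) (fderiv ℝ τ y w')))
      h2).trans ?_
    refine (bilinAt_coordFrame_of_alternating hΩ.alt e (τ y) _ _).trans
      (Eq.trans ?_ (bilinAt_coordFrame_of_alternating hΩ.alt e y v' w').symm)
    rw [he1 _ hy, he1 _ (hτt y hy), hτdet]
  · rw [bilinAt_pullBilin_eq_self (hid x hx)]

/-- In every nonempty open set of a surface with an area form there is the support of an
area-preserving diffeomorphism, which is the identity near a point `e.symm y₁` of a disc in this open
set and not an isometry of any Riemannian metric at another point `e.symm y₀` of the same disc. -/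
theorem IsAreaForm.exists_diffeomorph [IsManifold (𝓡 2) ∞ M] [T2Space M] (hΩ : IsAreaForm Ω)
    {U : Set M} (hU : IsOpen U) (hne : U.Nonempty) :
    ∃ (φ : M ≃ₘ⟮𝓡 2, 𝓡 2⟯ M) (D : Set M), IsClosed D ∧ D ⊆ U ∧ (∀ x ∉ D, φ x = x) ∧
      pullBilin φ Ω = Ω ∧ ∃ e ∈ smoothCharts 2 M, e.source ⊆ U ∧
      ∃ B ⊆ e.target, IsOpen B ∧ Convex ℝ B ∧ ∃ y₀ ∈ B, ∃ y₁ ∈ B, φ =ᶠ[𝓝 (e.symm y₁)] id ∧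
      ∀ g : BilinField 2 M, IsSmoothMetric g →
        bilinAt (pullBilin φ g) (e.symm y₀) ≠ bilinAt g (e.symm y₀) := by
  obtain ⟨x, hx⟩ := hne
  obtain ⟨e', he', hxe', he1'⟩ := hΩ.exists_darboux_chart x
  obtain ⟨e, he, hxe, heU, he1⟩ : ∃ e ∈ smoothCharts 2 M, x ∈ e.source ∧ e.source ⊆ U ∧
      ∀ y ∈ e.target, coordMatrix Ω e y 0 1 = 1 :=
    ⟨e'.restr U, restr_mem_smoothCharts he' U, ⟨hxe', hU.interior_eq.symm ▸ hx⟩,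
      fun z hz => interior_subset hz.2, fun y hy => he1' y hy.1⟩
  obtain ⟨r, hr, hball⟩ := Metric.nhds_basis_closedBall.mem_iff.mp
    (e.open_target.mem_nhds (e.map_source hxe))
  set c := e x with hc
  have hdist : ∀ y : EuclideanSpace ℝ (Fin 2),
      dist y c ^ 2 = (y 0 - c 0) ^ 2 + (y 1 - c 1) ^ 2 := fun y => by
    rw [EuclideanSpace.dist_eq, Real.sq_sqrt (by positivity), Fin.sum_univ_two, Real.dist_eq,
      Real.dist_eq, sq_abs, sq_abs]
  -- With a = r²/2 the twist is the identity where the squared radius is at least 2a = r², while the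
  -- circle of radius √a, where the angle vanishes to first order only, lies inside the ball.
  have ha : 0 < r ^ 2 / 2 := by positivity
  obtain ⟨θ, hθ, hθ0, hθ2, hθa, hθa'⟩ := exists_twist_profile ha
  set a := r ^ 2 / 2 with hadef
  set τ := twist c θ with hτdef
  have hoff : ∀ θ' : ℝ → ℝ, (∀ s, 2 * a ≤ s → θ' s = 0) → ∀ y ∉ Metric.closedBall c r,
      twist c θ' y = y := fun θ' h y hy => by
    refine twist_eq_self (h _ ?_)
    rw [← hdist, hadef]
    have h1 : r < dist y c := not_le.mp hy
    nlinarith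
  have hτ := hoff θ hθ2
  have hτ' := hoff (-θ) fun s hs => by rw [Pi.neg_apply, hθ2 s hs, neg_zero]
  have hinv : ∀ y, twist c (-θ) (τ y) = y := twist_neg_twist
  have hinv' : ∀ y, τ (twist c (-θ) y) = y := fun y => by
    have h := twist_neg_twist (c := c) (θ := -θ) y
    rwa [neg_neg] at h
  have hτs : ContDiff ℝ ∞ τ := contDiff_twist hθ
  have hKc : IsCompact (Metric.closedBall c r) := isCompact_closedBall c r
  obtain ⟨φ, hφ⟩ := exists_diffeomorph_chartConjugate he hKc hball hinv hinv' hτs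
    (contDiff_twist hθ.neg) hτ hτ'
  have hφe : ∀ y ∈ e.target, φ (e.symm y) = e.symm (τ y) := fun y hy =>
    (hφ _).trans (chartConjugate_symm hy)
  have hτt : ∀ y ∈ e.target, τ y ∈ e.target := fun y hy =>
    mem_target_of_eq_self_off hball hinv hτ hτ' hy
  have hcl : IsClosed (e.symm '' Metric.closedBall c r) := isClosed_image_symm hKc hball
  have hφid : ∀ z ∉ e.symm '' Metric.closedBall c r, φ z = z := fun z hz =>
    (hφ z).trans (chartConjugate_eq_self hτ hz)
  have hDs : e.symm '' Metric.closedBall c r ⊆ e.source := by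
    rintro _ ⟨y, hy, rfl⟩
    exact e.map_target (hball hy)
  have hcB : c ∈ Metric.ball c r := Metric.mem_ball_self hr
  have hct : c ∈ e.target := hball (Metric.ball_subset_closedBall hcB)
  have hy₀B : c + √a • EuclideanSpace.single 0 1 ∈ Metric.ball c r := by
    rw [Metric.mem_ball, dist_self_add_left, norm_smul, PiLp.norm_single, norm_one,
      mul_one, Real.norm_of_nonneg (Real.sqrt_nonneg a)]
    exact (Real.sqrt_lt' hr).mpr (by rw [hadef]; linarith)
  refine ⟨φ, e.symm '' Metric.closedBall c r, hcl, hDs.trans heU, hφid,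
    pullBilin_areaForm_of_chart hΩ he he1 hτs hφe hτt (planeDet_fderiv_twist hθ) fun z hz => ?_,
    e, he, heU, Metric.ball c r, Metric.ball_subset_closedBall.trans hball, Metric.isOpen_ball,
    convex_ball c r, c + √a • EuclideanSpace.single 0 1, hy₀B, c, hcB, ?_, fun g hg h => ?_⟩
  · filter_upwards [hcl.isOpen_compl.mem_nhds fun h => hz (hDs h)] with w hw using hφid w hw
  · have h1 : {y : EuclideanSpace ℝ (Fin 2) | (y 0 - c 0) ^ 2 + (y 1 - c 1) ^ 2 < a / 2} ∈ 𝓝 c := by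
      refine (isOpen_lt (by fun_prop) continuous_const).mem_nhds ?_
      change (c 0 - c 0) ^ 2 + (c 1 - c 1) ^ 2 < a / 2
      simp only [sub_self]
      linarith
    have h2 := e.symm.continuousAt (x := c) hct
    have h3 : e ⁻¹' {y | (y 0 - c 0) ^ 2 + (y 1 - c 1) ^ 2 < a / 2} ∈ 𝓝 (e.symm c) :=
      (e.continuousAt (e.map_target hct)).preimage_mem_nhds (by rwa [e.right_inv hct])
    filter_upwards [h3, e.open_source.mem_nhds (e.map_target hct)] with z hz hze
    have h4 : τ (e z) = e z := twist_eq_self (hθ0 _ (le_of_lt hz))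
    rw [← e.left_inv hze, hφe _ (e.map_source hze), h4]
    rfl
  -- At `y₀` the angle is zero and its derivative is one. So φ fixes this point, and its
  -- differential is the shear u ↦ u + 2a w, w ↦ w. If it preserved `g`, then g(u,w) = g(u,w) + 2a
  -- g(w,w).
  · set y₀ := c + √a • EuclideanSpace.single 0 1 with hy₀
    have hy₀t : y₀ ∈ e.target := hball (Metric.ball_subset_closedBall hy₀B)
    have h0 : y₀ 0 = c 0 + √a := by simp [hy₀]
    have h1 : y₀ 1 = c 1 := by simp [hy₀]
    have hsq : √a ^ 2 = a := Real.sq_sqrt ha.le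
    have hτy : τ y₀ = y₀ := twist_eq_self (by rw [h0, h1, add_sub_cancel_left, sub_self, hsq]; simpa using hθa)
    have hs : √a ^ 2 + 0 ^ 2 = a := by rw [hsq]; ring
    have hd : ∀ v, fderiv ℝ τ y₀ v = !₂[v 0, v 1 + 2 * a * v 0] := fun v => by
      rw [hτdef, fderiv_twist_apply hθ y₀ v (p := √a) (q := 0) (A := 1) (B := 0)
        (k := 2 * √a * v 0) (by rw [h0]; ring) (by rw [h1]; ring) (by rw [hs, hθa, Real.cos_zero])
        (by rw [hs, hθa, Real.sin_zero]) (by rw [hs, hθa']; ring)]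
      ext i
      fin_cases i
      · simp
      · simp
        linear_combination (2 * v 0) * hsq
    have hd0 : fderiv ℝ τ y₀ (EuclideanSpace.single 0 1) =
        EuclideanSpace.single 0 1 + (2 * a) • EuclideanSpace.single 1 1 := by
      rw [hd]
      ext i
      fin_cases i <;> simp
    have hd1 : fderiv ℝ τ y₀ (EuclideanSpace.single 1 1) = EuclideanSpace.single 1 1 := by
      rw [hd]
      ext i
      fin_cases i <;> simp
    have hfix : φ (e.symm y₀) = e.symm y₀ := by rw [hφe _ hy₀t, hτy]
    have hD : ∀ v, diffeoDeriv φ (e.symm y₀) (coordFrame e y₀ v) =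
        coordFrame e y₀ (fderiv ℝ τ y₀ v) := fun v => by
      refine (diffeoDeriv_coordFrame φ he hτs hφe hy₀t (hτt _ hy₀t) v).trans ?_
      exact congrArg (fun z => chartSymmDeriv e z (fderiv ℝ τ y₀ v)) hτy
    set u : EuclideanSpace ℝ (Fin 2) := coordFrame e y₀ (EuclideanSpace.single 0 1) with hu
    set w : EuclideanSpace ℝ (Fin 2) := coordFrame e y₀ (EuclideanSpace.single 1 1) with hw
    have hDu : diffeoDeriv φ (e.symm y₀) u = u + (2 * a) • w := by
      refine (hD _).trans ?_
      rw [hd0]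
      exact (map_add (chartSymmDeriv e y₀) _ _).trans
        (congrArg (u + ·) (map_smul (chartSymmDeriv e y₀) _ _))
    have hDw : diffeoDeriv φ (e.symm y₀) w = w := by
      refine (hD _).trans ?_
      rw [hd1]
    have h2 := congrArg (fun b => b u w) h
    simp only [bilinAt_pullBilin, hDu, hDw, hfix, map_add, map_smul, add_apply, smul_apply,
      smul_eq_mul, add_eq_left] at h2
    have h3 : 0 < bilinAt g (e.symm y₀) w w :=
      hg.pos _ _ (coordFrame_injective he hy₀t (by simp))
    exact (mul_pos (by linarith : 0 < 2 * a) h3).ne' h2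

end AreaPreserving

/-! ## Locally finite families of open sets in noncompact spaces -/

section Exhaustion

/-- The sets are nonempty layers of a compact exhaustion. If only finitely many layers were
nonempty, the exhaustion would become stationary and the space would be compact. -/
theorem exists_locallyFinite_disjoint_isOpen (X : Type*) [TopologicalSpace X] [T2Space X]
    [WeaklyLocallyCompactSpace X] [SigmaCompactSpace X] [NoncompactSpace X] :
    ∃ U : ℕ → Set X, (∀ n, IsOpen (U n)) ∧ (∀ n, (U n).Nonempty) ∧ LocallyFinite U ∧
      Pairwise fun i j => Disjoint (U i) (U j) := by
  let K := CompactExhaustion.choice X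
  let V : ℕ → Set X := fun n => interior (K (n + 1)) \ K n
  have hfreq : ∃ᶠ n in atTop, (V n).Nonempty := by
    rw [frequently_atTop]
    by_contra! h
    obtain ⟨N, hN⟩ := h
    have h1 : ∀ n ≥ N, K n ⊆ K N := fun n hn => by
      induction n, hn using Nat.le_induction with
      | base => exact subset_rfl
      | succ n hn ih =>
        have h2 : interior (K (n + 2)) ⊆ K (n + 1) :=
          sdiff_eq_empty.mp (hN (n + 1) (by omega))
        have h3 : interior (K (n + 1)) ⊆ K n := sdiff_eq_empty.mp (hN n hn)
        -- Two consecutive empty layers are used: the upper one makes `K (n + 1)` equal to the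
        -- interior of `K (n + 2)`, hence open, and then the lower one puts it inside `K n`.
        have h4 : IsOpen (K (n + 1)) := by
          rw [Subset.antisymm (K.subset_interior_succ (n + 1)) h2]
          exact isOpen_interior
        rw [h4.interior_eq] at h3
        exact h3.trans ih
    refine noncompact_univ X ((K.isCompact N).of_isClosed_subset isClosed_univ fun x _ => ?_)
    obtain ⟨n, hn⟩ := K.exists_mem x
    exact h1 (max n N) (le_max_right _ _) (K.subset (le_max_left _ _) hn)
  obtain ⟨s, hs, hne⟩ := extraction_of_frequently_atTop hfreq
  have hdisj : ∀ m n, m < n → Disjoint (V m) (V n) := fun m n hmn =>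
    Set.disjoint_left.mpr fun x hx hx' => hx'.2 (K.subset hmn (interior_subset hx.1))
  refine ⟨V ∘ s, fun n => isOpen_interior.sdiff (K.isCompact _).isClosed, hne, ?_, fun i j hij => ?_⟩
  · refine LocallyFinite.comp_injective (f := V) (fun x => ?_) hs.injective
    obtain ⟨m, hm⟩ := K.exists_mem_nhds x
    refine ⟨K m, hm, (Set.finite_lt_nat m).subset ?_⟩
    rintro n ⟨y, hy, hym⟩
    by_contra h
    exact hy.2 (K.subset (not_lt.mp h) hym)
  · rcases lt_or_gt_of_ne hij with h | h
    · exact hdisj _ _ (hs h)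
    · exact (hdisj _ _ (hs h)).symm

end Exhaustion

/-! ## Gluing diffeomorphisms with disjoint supports -/

section Glue

theorem mapsTo_of_eq_self_off {X : Type*} {f : X → X} (hf : Function.Injective f) {D U : Set X}
    (hDU : D ⊆ U) (hD : ∀ x ∉ D, f x = x) : MapsTo f U U := by
  intro x hx
  by_cases h : f x ∈ D
  · exact hDU h
  · rwa [hf (hD _ h)]

open Classical in
/-- The map that is `f n` on `U n` for every `n`, and the identity elsewhere. -/
noncomputable def glueMaps {X : Type*} (U : ℕ → Set X) (f : ℕ → X → X) (x : X) : X :=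
  if h : ∃ n, x ∈ U n then f h.choose x else x

variable {X : Type*} {U D : ℕ → Set X} {f f' : ℕ → X → X}

theorem glueMaps_of_mem (hU : Pairwise fun i j => Disjoint (U i) (U j)) {n : ℕ} {x : X}
    (hx : x ∈ U n) : glueMaps U f x = f n x := by
  have h : ∃ n, x ∈ U n := ⟨n, hx⟩
  rw [glueMaps, dif_pos h]
  by_contra hne
  have hn : h.choose ≠ n := fun h' => hne (by rw [h'])
  exact Set.disjoint_left.mp (hU hn) h.choose_spec hx

theorem glueMaps_of_notMem (hU : Pairwise fun i j => Disjoint (U i) (U j))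
    (hf : ∀ n, ∀ x ∉ D n, f n x = x) {x : X} (hx : ∀ n, x ∉ D n) : glueMaps U f x = x := by
  by_cases h : ∃ n, x ∈ U n
  · obtain ⟨n, hn⟩ := h
    rw [glueMaps_of_mem hU hn, hf n x (hx n)]
  · rw [glueMaps, dif_neg h]

theorem glueMaps_glueMaps (hU : Pairwise fun i j => Disjoint (U i) (U j)) (hDU : ∀ n, D n ⊆ U n)
    (hf : ∀ n, ∀ x ∉ D n, f n x = x) (hinv : ∀ n x, f' n (f n x) = x) (x : X) :
    glueMaps U f' (glueMaps U f x) = x := by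
  by_cases h : ∃ n, x ∈ U n
  · obtain ⟨n, hn⟩ := h
    have hinj : Function.Injective (f n) := Function.LeftInverse.injective (hinv n)
    rw [glueMaps_of_mem hU hn, glueMaps_of_mem hU (mapsTo_of_eq_self_off hinj (hDU n) (hf n) hn),
      hinv]
  · have h1 : ∀ f, glueMaps U f x = x := fun f => dif_neg h
    rw [h1, h1]

theorem glueMaps_eventuallyEq [TopologicalSpace X] (hU : Pairwise fun i j => Disjoint (U i) (U j))
    (hUo : ∀ n, IsOpen (U n)) (hfin : LocallyFinite U) (hDc : ∀ n, IsClosed (D n))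
    (hDU : ∀ n, D n ⊆ U n) (hf : ∀ n, ∀ x ∉ D n, f n x = x) (x : X) :
    ∃ n, glueMaps U f =ᶠ[𝓝 x] f n := by
  by_cases h : ∃ n, x ∈ U n
  · obtain ⟨n, hn⟩ := h
    exact ⟨n, by filter_upwards [(hUo n).mem_nhds hn] with z hz using glueMaps_of_mem hU hz⟩
  -- By local finiteness the union of the supports is closed, so all maps are the identity near such
  -- a point and the index 0 below is an arbitrary choice.
  · have hcl : IsClosed (⋃ n, D n) := (hfin.subset hDU).isClosed_iUnion hDc
    have hx : x ∉ ⋃ n, D n := fun h1 => h (by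
      obtain ⟨n, hn⟩ := mem_iUnion.mp h1
      exact ⟨n, hDU n hn⟩)
    refine ⟨0, ?_⟩
    filter_upwards [hcl.isOpen_compl.mem_nhds hx] with z hz
    have hz' : ∀ n, z ∉ D n := fun n hn => hz (mem_iUnion.mpr ⟨n, hn⟩)
    rw [glueMaps_of_notMem hU hf hz', hf 0 z (hz' 0)]

variable {n : ℕ} [TopologicalSpace X] [ChartedSpace (EuclideanSpace ℝ (Fin n)) X]

/-- Diffeomorphisms supported in the members of a locally finite family of disjoint open sets can be
combined. -/
theorem exists_diffeomorph_glue (hU : Pairwise fun i j => Disjoint (U i) (U j))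
    (hUo : ∀ n, IsOpen (U n)) (hfin : LocallyFinite U) (hDc : ∀ n, IsClosed (D n))
    (hDU : ∀ n, D n ⊆ U n) (φ : ℕ → X ≃ₘ⟮𝓡 n, 𝓡 n⟯ X) (hφ : ∀ n, ∀ x ∉ D n, φ n x = x) :
    ∃ Φ : X ≃ₘ⟮𝓡 n, 𝓡 n⟯ X, (∀ x, ∃ n, Φ =ᶠ[𝓝 x] φ n) ∧ ∀ n, ∀ x ∈ U n, Φ =ᶠ[𝓝 x] φ n := by
  have hφ' : ∀ n, ∀ x ∉ D n, (φ n).symm x = x := fun n x hx => by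
    conv_lhs => rw [← hφ n x hx]
    exact (φ n).symm_apply_apply x
  have hloc := glueMaps_eventuallyEq (f := fun n => φ n) hU hUo hfin hDc hDU hφ
  have hloc' := glueMaps_eventuallyEq (f := fun n => (φ n).symm) hU hUo hfin hDc hDU hφ'
  exact ⟨{
    toFun := glueMaps U fun n => φ n
    invFun := glueMaps U fun n => (φ n).symm
    left_inv := glueMaps_glueMaps hU hDU hφ fun n => (φ n).symm_apply_apply
    right_inv := glueMaps_glueMaps hU hDU hφ' fun n => (φ n).apply_symm_apply
    contMDiff_toFun := fun x => by
      obtain ⟨n, hn⟩ := hloc x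
      exact (φ n).contMDiff.contMDiffAt.congr_of_eventuallyEq hn
    contMDiff_invFun := fun x => by
      obtain ⟨n, hn⟩ := hloc' x
      exact (φ n).symm.contMDiff.contMDiffAt.congr_of_eventuallyEq hn }, hloc, fun n x hx => by
    filter_upwards [(hUo n).mem_nhds hx] with z hz 
      using glueMaps_of_mem (f := fun n => φ n) hU hz⟩

end Glue

/-! ## Functions dominated by all positive sequences -/

section Diagonal

/-- If a sequence of functions is eventually dominated by each sequence of positive numbers, then
almost all of these functions vanish near the given point. -/
theorem eventually_eq_zero_of_dominated {X : Type*} [TopologicalSpace X] [FirstCountableTopology X]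
    {t : X} {c : ℕ → X → ℝ≥0∞}
    (h : ∀ δ : ℕ → ℝ, (∀ n, 0 < δ n) → ∀ᶠ s in 𝓝 t, ∀ n, c n s < ENNReal.ofReal (δ n)) :
    ∃ N, ∀ᶠ s in 𝓝 t, ∀ n ≥ N, c n s = 0 := by
  by_contra! hcon
  obtain ⟨V, hV⟩ := (𝓝 t).exists_antitone_basis
  have h1 : ∀ k, ∃ s ∈ V k, ∃ n ≥ k, c n s ≠ 0 := fun k => by
    have h2 := (hcon k).and_eventually (hV.toHasBasis.mem_of_mem (i := k) trivial)
    obtain ⟨s, hs, hsV⟩ := h2.exists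
    obtain ⟨n, hn⟩ := hs
    exact ⟨s, hsV, n, hn⟩
  choose s hsV n hn hc using h1
  have h2 : ∀ k, ∃ d : ℝ, 0 < d ∧ ENNReal.ofReal d ≤ c (n k) (s k) := fun k => by
    obtain ⟨d, hd, hd'⟩ := ENNReal.lt_iff_exists_nnreal_btwn.mp (pos_iff_ne_zero.mpr (hc k))
    exact ⟨d, by exact_mod_cast hd, by rw [ENNReal.ofReal_coe_nnreal]; exact hd'.le⟩
  choose d hd hdc using h2
  have h3 : ∀ m, (Finset.range (m + 1)).Nonempty := fun m => Finset.nonempty_range_add_one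
  -- The diagonal sequence δ_m = min of d_0, …, d_m. Since n_k ≥ k, it satisfies δ_{n_k} ≤ d_k ≤
  -- c_{n_k}(s_k), so it fails to dominate at points `s k` arbitrarily close to `t`.
  have h4 := h (fun m => (Finset.range (m + 1)).inf' (h3 m) d) fun m => by
    rw [Finset.lt_inf'_iff]
    exact fun k _ => hd k
  obtain ⟨k, -, hk⟩ := hV.toHasBasis.mem_iff.mp h4
  refine absurd (hk (hsV k) (n k)) (not_lt.mpr ?_)
  refine le_trans (ENNReal.ofReal_le_ofReal (Finset.inf'_le d ?_)) (hdc k)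
  exact Finset.mem_range.mpr (Nat.lt_succ_of_le (hn k))

end Diagonal

/-! ## A tame almost complex structure far from a given one -/

section FarACS

variable {M : Type*} [TopologicalSpace M] [ChartedSpace (EuclideanSpace ℝ (Fin 2)) M]
  {Ω : BilinField 2 M}

theorem IsAlmostComplex.isRightRotation (hΩ : ∀ x v, Ω x v v = 0) {J : EndField 2 M}
    (hJ : IsAlmostComplex J) : IsRightRotation (metricOf Ω J) J where
  smooth := hJ.smooth
  norm_eq x := by
    have h1 : ∀ v, endAt J x (endAt J x v) = -v := hJ.sq x
    have h2 : ∀ v w, bilinAt Ω x w v = -bilinAt Ω x v w := apply_swap_of_alternating (hΩ x)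
    have h3 : ∀ v, bilinAt (metricOf Ω J) x (endAt J x v) (endAt J x v) =
        bilinAt (metricOf Ω J) x v v := fun v => by
      rw [bilinAt_metricOf, bilinAt_metricOf, h1, map_neg, h2 v]
      ring
    exact h3
  orth x := by
    have h1 : ∀ v, endAt J x (endAt J x v) = -v := hJ.sq x
    have h0 : ∀ v, bilinAt Ω x v v = 0 := hΩ x
    have h3 : ∀ v, bilinAt (metricOf Ω J) x v (endAt J x v) = 0 := fun v => by
      rw [bilinAt_metricOf, h1, map_neg, h0, h0]
      ring
    exact h3

theorem bilinAt_metricOf_congr {J J' : EndField 2 M} {x : M} (h : endAt J x = endAt J' x) :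
    bilinAt (metricOf Ω J) x = bilinAt (metricOf Ω J') x := by
  ext v w : 2
  rw [bilinAt_metricOf, bilinAt_metricOf, h]

theorem endAt_eq_of_coordEnd_eq {n : ℕ} {M : Type*} [TopologicalSpace M]
    [ChartedSpace (EuclideanSpace ℝ (Fin n)) M] {J J' : EndField n M}
    {e : OpenPartialHomeomorph M (EuclideanSpace ℝ (Fin n))} (he : e ∈ smoothCharts n M)
    {y : EuclideanSpace ℝ (Fin n)} (hy : y ∈ e.target) (h : coordEnd J e y = coordEnd J' e y) :
    endAt J (e.symm y) = endAt J' (e.symm y) := by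
  refine ContinuousLinearMap.ext fun v => ?_
  obtain ⟨w, rfl⟩ : ∃ w, (coordFrame e y w : EuclideanSpace ℝ (Fin n)) = v :=
    ⟨_, coordFrame_coordCoframe he hy v⟩
  have h1 := coordFrame_coordEnd he hy J w
  have h2 := coordFrame_coordEnd he hy J' w
  rw [h] at h1
  exact h1.symm.trans h2

/-- On a noncompact surface, every tame almost complex structure `J` has a companion `J'` differing
from it at points `(e n).symm (y₀ n)` that leave every compact set, whereas the two structures
induce the same metric at points `(e n).symm (y₁ n)` of the same discs. -/
theorem IsAreaForm.exists_tameACS_ne [IsManifold (𝓡 2) ∞ M] [T2Space M]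
    [SecondCountableTopology M] [NoncompactSpace M] (hΩ : IsAreaForm Ω) (J : tameACS Ω) :
    ∃ (J' : tameACS Ω) (e : ℕ → OpenPartialHomeomorph M (EuclideanSpace ℝ (Fin 2)))
      (B : ℕ → Set (EuclideanSpace ℝ (Fin 2))) (y₀ y₁ : ℕ → EuclideanSpace ℝ (Fin 2)),
      (LocallyFinite fun n => (e n).source) ∧ ∀ n, e n ∈ smoothCharts 2 M ∧ B n ⊆ (e n).target ∧
        IsOpen (B n) ∧ Convex ℝ (B n) ∧ y₀ n ∈ B n ∧ y₁ n ∈ B n ∧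
        bilinAt (metricOf Ω J'.1) ((e n).symm (y₁ n)) =
          bilinAt (metricOf Ω J.1) ((e n).symm (y₁ n)) ∧
        bilinAt (metricOf Ω J'.1) ((e n).symm (y₀ n)) ≠
          bilinAt (metricOf Ω J.1) ((e n).symm (y₀ n)) := by
  have : LocallyCompactSpace M := ChartedSpace.locallyCompactSpace (EuclideanSpace ℝ (Fin 2)) M
  obtain ⟨U, hUo, hUne, hfin, hdisj⟩ := exists_locallyFinite_disjoint_isOpen M
  choose φ D hDc hDU hφ hφΩ e he heU B hBt hBo hBc y₀ hy₀ y₁ hy₁ hid hne using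
    fun n => hΩ.exists_diffeomorph (hUo n) (hUne n)
  obtain ⟨Φ, hΦ, hΦU⟩ := exists_diffeomorph_glue hdisj hUo hfin hDc hDU φ hφ
  have hΦΩ : pullBilin Φ Ω = Ω := by
    refine bilinField_ext fun x v w => ?_
    obtain ⟨n, hn⟩ := hΦ x
    rw [bilinAt_pullBilin_congr hn, hφΩ]
  have hmem : ∀ n, ∀ y ∈ B n, (e n).symm y ∈ U n := fun n y hy =>
    heU n ((e n).map_target (hBt n hy))
  refine ⟨⟨pullEnd Φ J.1, pullEnd_mem_tameACS Φ hΦΩ J.2⟩, e, B, y₀, y₁, hfin.subset heU,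
    fun n => ⟨he n, hBt n, hBo n, hBc n, hy₀ n, hy₁ n, ?_, ?_⟩⟩
  · rw [metricOf_pullEnd Φ hΦΩ, bilinAt_pullBilin_congr (hΦU n _ (hmem n _ (hy₁ n))),
      bilinAt_pullBilin_eq_self (hid n)]
  · rw [metricOf_pullEnd Φ hΦΩ, bilinAt_pullBilin_congr (hΦU n _ (hmem n _ (hy₀ n)))]
    exact hne n _ J.2.2.2.1.isMetric

end FarACS

/-! ## The strong topology -/

section StrongTopology

variable {M : Type*} [TopologicalSpace M] [ChartedSpace (EuclideanSpace ℝ (Fin 2)) M]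
  {Ω : BilinField 2 M}

/-- A path cannot change the structure at infinitely many of the points (e n).symm (y₀ n), because
the tolerances there can be chosen independently of each other. -/
theorem not_pathConnectedSpace_strongTopology [IsManifold (𝓡 2) ∞ M] [T2Space M]
    [SecondCountableTopology M] [NoncompactSpace M] (hΩ : IsAreaForm Ω) :
    ¬ @PathConnectedSpace (tameACS Ω) (strongTopology Ω) := by
  intro hpc
  let _ := strongTopology Ω
  obtain ⟨J⟩ := hpc.nonempty
  obtain ⟨J', e, B, y₀, y₁, hfin, h⟩ := hΩ.exists_tameACS_ne J
  have hy₀ : ∀ n, y₀ n ∈ (e n).target := fun n => (h n).2.1 (h n).2.2.2.2.1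
  let γ := hpc.somePath J J'
  let P : unitInterval → unitInterval → Prop := fun s t =>
    ∃ N, ∀ n ≥ N, coordEnd (γ s).1 (e n) (y₀ n) = coordEnd (γ t).1 (e n) (y₀ n)
  have hsymm : Std.Symm P := ⟨fun s t ⟨N, hN⟩ => ⟨N, fun n hn => (hN n hn).symm⟩⟩
  have htrans : IsTrans unitInterval P := ⟨fun s t u ⟨N, hN⟩ ⟨N', hN'⟩ =>
    ⟨max N N', fun n hn => (hN n (le_of_max_le_left hn)).trans (hN' n (le_of_max_le_right hn))⟩⟩
  have hloc : ∀ t, ∀ᶠ s in 𝓝 t, P t s := fun t => by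
    have hdom : ∃ N, ∀ᶠ s in 𝓝 t, ∀ n ≥ N,
        ENNReal.ofReal ‖iteratedFDeriv ℝ 0 (coordEnd (γ s).1 (e n)) (y₀ n) -
          iteratedFDeriv ℝ 0 (coordEnd (γ t).1 (e n)) (y₀ n)‖ = 0 := by
      refine eventually_eq_zero_of_dominated fun δ hδ => ?_
      -- Single points as compact sets and order zero suffice; the freedom that matters is the
      -- sequence of tolerances over the locally finite family.
      have hopen : IsOpen (strongNhd Ω e (fun n => {(e n).symm (y₀ n)}) δ 0 (γ t)) :=
        TopologicalSpace.isOpen_generateFrom_of_mem ⟨ℕ, e, _, δ, 0, γ t, fun n =>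
          ⟨(h n).1, isCompact_singleton, singleton_subset_iff.mpr ((e n).map_target (hy₀ n)), hδ n⟩,
          hfin, rfl⟩
      have hmem : γ t ∈ strongNhd Ω e (fun n => {(e n).symm (y₀ n)}) δ 0 (γ t) :=
        fun n y _ k _ => by rw [sub_self, norm_zero]; exact hδ n
      filter_upwards [γ.continuous.continuousAt.preimage_mem_nhds (hopen.mem_nhds hmem)] with s hs n
      exact (ENNReal.ofReal_lt_ofReal_iff (hδ n)).mpr
        (hs n (y₀ n) ⟨_, rfl, (e n).right_inv (hy₀ n)⟩ 0 le_rfl)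
    obtain ⟨N, hN⟩ := hdom
    filter_upwards [hN] with s hs
    refine ⟨N, fun n hn => ?_⟩
    have h1 := sub_eq_zero.mp (norm_le_zero_iff.mp (ENNReal.ofReal_eq_zero.mp (hs n hn)))
    have h2 := congrArg (fun m => m fun i => 0) h1
    simpa only [iteratedFDeriv_zero_apply] using h2.symm
  obtain ⟨N, hN⟩ := PreconnectedSpace.induction₂ P hloc htrans 0 1
  have h1 := hN N le_rfl
  rw [γ.source, γ.target] at h1
  exact (h N).2.2.2.2.2.2.2 (bilinAt_metricOf_congr
    (endAt_eq_of_coordEnd_eq (h N).1 (hy₀ N) h1.symm))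

end StrongTopology

/-! ## The uniform topology -/

section UniformTopology

variable {n : ℕ} {M : Type*} [TopologicalSpace M] [ChartedSpace (EuclideanSpace ℝ (Fin n)) M]

theorem iterCovDeriv_zero (G : EuclideanSpace ℝ (Fin n) → Matrix (Fin n) (Fin n) ℝ) {m : ℕ}
    (k : ℕ) : iterCovDeriv G (fun _ (_ : Fin m → Fin n) => (0 : ℝ)) k = fun _ _ => 0 := by
  induction k with
  | zero => rfl
  | succ k ih =>
    funext y a
    change covDeriv G (iterCovDeriv G _ k) y a = 0
    rw [ih]
    simp [covDeriv, partialDeriv]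

/-- This puts the centre into each generating set of the uniform topology, which makes that set a
neighbourhood of it. -/
theorem covDerivSup_sub_self (g B : BilinField n M) (k : ℕ) : covDerivSup g (B - B) k = 0 := by
  have h0 : B - B = 0 := bilinField_ext fun x v w => sub_self (bilinAt B x v w)
  rw [h0]
  simp only [covDerivSup, ENNReal.iSup_eq_zero]
  intro e _ y _
  have h1 : (fun z (a : Fin 2 → Fin n) => coordMatrix (0 : BilinField n M) e z (a 0) (a 1)) =
      fun _ _ => 0 := rfl
  rw [h1, iterCovDeriv_zero]
  simp [tensorNorm]

/-- If two metrics with the same Levi-Civita connection in a chart agree at one point of a convex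
domain, then they agree throughout. -/
theorem bilinAt_eq_of_christoffel_eq {g g' : BilinField n M} (hg : IsSmoothMetric g)
    (hg' : IsSmoothMetric g') {e : OpenPartialHomeomorph M (EuclideanSpace ℝ (Fin n))}
    (he : e ∈ smoothCharts n M) {B : Set (EuclideanSpace ℝ (Fin n))} (hB : B ⊆ e.target)
    (hBo : IsOpen B) (hBc : Convex ℝ B)
    (hΓ : ∀ k i j, ∀ y ∈ B, christoffel (coordMatrix g' e) k i j y =
      christoffel (coordMatrix g e) k i j y)
    {y₀ y₁ : EuclideanSpace ℝ (Fin n)} (hy₀ : y₀ ∈ B) (hy₁ : y₁ ∈ B)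
    (h : bilinAt g' (e.symm y₁) = bilinAt g (e.symm y₁)) :
    bilinAt g' (e.symm y₀) = bilinAt g (e.symm y₀) := by
  have hsm : ∀ {g : BilinField n M}, IsSmoothMetric g → ∀ i j,
      DifferentiableOn ℝ (fun y => coordMatrix g e y i j) B := fun hg i j =>
    ((hg.smooth e he i j).differentiableOn (by simp)).mono hB
  have hmet : ∀ {g : BilinField n M}, IsSmoothMetric g → ∀ y ∈ B, ∀ i j l,
      partialDeriv i (fun z => coordMatrix g e z j l) y =
        ∑ k, christoffel (coordMatrix g e) k i j y * coordMatrix g e y k l +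
          ∑ k, christoffel (coordMatrix g e) k i l y * coordMatrix g e y j k :=
    fun hg y hy i j l => partialDeriv_metric
      (.of_forall fun z => isSymm_coordMatrix hg.symm e z) (hg.det_ne_zero he (hB hy)) i j l
  have hzero : coordMatrix g' e y₀ - coordMatrix g e y₀ = 0 := by
    -- Each metric is parallel for the common connection, hence so is the difference, which vanishes
    -- at `y₁`.
    refine parallel_eq_zero_of_eq_zero (Γ := christoffel (coordMatrix g e))
      (H := fun y => coordMatrix g' e y - coordMatrix g e y) hBo hBc ?_ ?_ ?_ hy₁ hy₀ ?_
    · exact fun k i j => ((contDiffOn_christoffel e.open_target (hg.smooth e he)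
        (fun y hy => hg.det_ne_zero he hy) k i j).continuousOn).mono hB
    · exact fun i j => (hsm hg' i j).sub (hsm hg i j)
    · intro y hy i j l
      have hd : ∀ {g : BilinField n M}, IsSmoothMetric g →
          DifferentiableAt ℝ (fun z => coordMatrix g e z j l) y := fun hg =>
        (hsm hg j l).differentiableAt (hBo.mem_nhds hy)
      have h1 : partialDeriv i (fun z => (coordMatrix g' e z - coordMatrix g e z) j l) y =
          partialDeriv i (fun z => coordMatrix g' e z j l) y -
            partialDeriv i (fun z => coordMatrix g e z j l) y := by
        have h2 := ((hd hg').hasFDerivAt.sub (hd hg).hasFDerivAt).fderiv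
        exact congrArg (fun L : EuclideanSpace ℝ (Fin n) →L[ℝ] ℝ => L (EuclideanSpace.single i 1)) h2
      rw [h1, hmet hg' y hy, hmet hg y hy]
      simp only [hΓ _ _ _ y hy, Matrix.sub_apply, mul_sub, Finset.sum_sub_distrib]
      ring
    · ext i j
      exact sub_eq_zero.mpr (congrArg (fun b => b (coordFrame e y₁ (EuclideanSpace.single i 1))
        (coordFrame e y₁ (EuclideanSpace.single j 1))) h)
  refine ContinuousLinearMap.ext fun v => ContinuousLinearMap.ext fun w => ?_
  obtain ⟨v, rfl⟩ : ∃ v', (coordFrame e y₀ v' : EuclideanSpace ℝ (Fin n)) = v :=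
    ⟨_, coordFrame_coordCoframe he (hB hy₀) v⟩
  obtain ⟨w, rfl⟩ : ∃ w', (coordFrame e y₀ w' : EuclideanSpace ℝ (Fin n)) = w :=
    ⟨_, coordFrame_coordCoframe he (hB hy₀) w⟩
  have h1 := matrixForm_coordMatrix g' e y₀ v w
  rw [sub_eq_zero.mp hzero] at h1
  exact h1.symm.trans (matrixForm_coordMatrix g e y₀ v w)

/-- The Levi-Civita connection is locally constant along a path, hence the same at its ends; the
companion structure has a metric for which this is impossible. -/
theorem not_pathConnectedSpace_uniformTopology {M : Type*} [TopologicalSpace M]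
    [ChartedSpace (EuclideanSpace ℝ (Fin 2)) M] [IsManifold (𝓡 2) ∞ M] [T2Space M]
    [SecondCountableTopology M] [NoncompactSpace M] {Ω : BilinField 2 M} (hΩ : IsAreaForm Ω) :
    ¬ @PathConnectedSpace (tameACS Ω) (uniformTopology Ω) := by
  intro hpc
  let _ := uniformTopology Ω
  obtain ⟨J⟩ := hpc.nonempty
  obtain ⟨J', e, B, y₀, y₁, -, h⟩ := hΩ.exists_tameACS_ne J
  let γ := hpc.somePath J J'
  let P : unitInterval → unitInterval → Prop := fun s t =>
    ∀ e ∈ smoothCharts 2 M, ∀ y ∈ e.target, ∀ k i j,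
      christoffel (coordMatrix (metricOf Ω (γ s).1) e) k i j y =
        christoffel (coordMatrix (metricOf Ω (γ t).1) e) k i j y
  have hsymm : Std.Symm P :=
    ⟨fun s t hst e he y hy k i j => (hst e he y hy k i j).symm⟩
  have htrans : IsTrans unitInterval P := ⟨fun s t u hst htu e he y hy k i j =>
    (hst e he y hy k i j).trans (htu e he y hy k i j)⟩
  have hloc : ∀ t, ∀ᶠ s in 𝓝 t, P t s := fun t => by
    have hdom : ∀ δ : ℕ → ℝ, (∀ k, 0 < δ k) → ∀ᶠ s in 𝓝 t, ∀ k,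
        covDerivSup (metricOf Ω (γ t).1) (metricOf Ω (γ s).1 - metricOf Ω (γ t).1) k <
          ENNReal.ofReal (δ k) := fun δ hδ => by
      have hopen : IsOpen {J' : tameACS Ω | ∀ k, covDerivSup (metricOf Ω (γ t).1)
          (metricOf Ω J'.1 - metricOf Ω (γ t).1) k < ENNReal.ofReal (δ k)} :=
        TopologicalSpace.isOpen_generateFrom_of_mem ⟨γ t, δ, hδ, rfl⟩
      refine γ.continuous.continuousAt.preimage_mem_nhds (hopen.mem_nhds fun k => ?_)
      rw [covDerivSup_sub_self]
      exact ENNReal.ofReal_pos.mpr (hδ k)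
    obtain ⟨N, hN⟩ := eventually_eq_zero_of_dominated hdom
    -- The constant sequence 1 makes the suprema of all orders finite, including those below `N`, as
    -- the argument along geodesics requires.
    filter_upwards [hN, hdom 1 fun _ => one_pos] with s hs hs1 e he y hy k i j
    have ht := (γ t).2
    exact (christoffel_eq_of_covDerivSup ht.2.2.1.isMetric (ht.1.isRightRotation hΩ.alt)
      (γ s).2.2.2.1.isMetric ht.2.2.1.inj (fun k => (hs1 k).ne_top) hs he hy k i j).symm
  have h01 := PreconnectedSpace.induction₂ P hloc htrans 1 0
  obtain ⟨he, hBt, hBo, hBc, hy₀, hy₁, heq, hne⟩ := h 0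
  have hΓ := h01 (e 0) he
  rw [γ.source, γ.target] at hΓ
  exact hne (bilinAt_eq_of_christoffel_eq J.2.2.2.1.isMetric J'.2.2.2.1.isMetric he hBt hBo hBc
    (fun k i j y hy => hΓ y (hBt hy) k i j) hy₀ hy₁ heq)

end UniformTopology

theorem proposition7 {M : Type*} [TopologicalSpace M] [T2Space M] [SecondCountableTopology M]
    [NoncompactSpace M] [ChartedSpace (EuclideanSpace ℝ (Fin 2)) M] [IsManifold (𝓡 2) ∞ M]
    (Ω : BilinField 2 M) (hΩ : IsAreaForm Ω) (harea : totalArea Ω = ⊤) :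
    (¬ @PathConnectedSpace (tameACS Ω) (strongTopology Ω)) ∧
      ¬ @PathConnectedSpace (tameACS Ω) (uniformTopology Ω) :=
  ⟨not_pathConnectedSpace_strongTopology hΩ, not_pathConnectedSpace_uniformTopology hΩ⟩
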